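/- All graphs are finite and simple. Let $L$ be a cycle in a graph $G$. An $L$-bridge of $G$ is either an edge of $G$ not in $L$ with both ends on $L$ (together with its ends), or a component $D$ of $G-V(L)$ together with all edges between $V(D)$ and $V(L)$ (and their ends); the attachments of an $L$-bridge $B$ are the vertices in $V(L)\cap V(B)$. Two $L$-bridges $B_1,B_2$ overlap if $L$ cannot be partitioned into two edge-disjoint subpaths $L_1,L_2$ (with common ends) such that all attachments of $B_i$ lie on $L_i$ for $i=1,2$. The overlap graph $O_G(L)$ has the $L$-bridges as vertices, two distinct bridges being adjacent if and only if they overlap. For subgraphs $H_1,H_2$, let $H_1\triangle H_2$ denote the subgraph formed by the edge set $E(H_1)\triangle E(H_2)$ and the ends of these edges. Theorem. Let $L$ be a cycle in a $2$-connected graph $G$, and let $T_1,\dots,T_k$ be $L$-bridges of $G$ that are pairwise vertex-disjoint and induce a tree in $O_G(L)$ (in particular $k\ge 1$), where each $T_i$ is a tree whose leaves are exactly the attachments of $T_i$. Then there is a finite family (repetitions allowed) $\mathcal{C}$ of cycles in $L\cup T_1\cup\dots\cup T_k$ such that each edge of $L$ lies in exactly two members of $\mathcal{C}$, each edge of $T_1\cup\dots\cup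 T_k$ lies in at least four members of $\mathcal{C}$, and $L\triangle C$ is a cycle for every member $C$ of $\mathcal{C}$. In particular, if $T_1,\dots,T_k$ are all the $L$-bridges of $G$, then every edge of $G$ not in $L$ lies in at least four members of $\mathcal{C}$. -/

import Mathlib

namespace CycleBridges

variable {V : Type*} {G : SimpleGraph V}

/-- `G` is 2-connected: it has at least three vertices, is connected, and stays connected
after the removal of any single vertex. -/
def TwoConnected (G : SimpleGraph V) : Prop :=
  3 ≤ Nat.card V ∧ G.Connected ∧ ∀ v : V, (G.induce {v}ᶜ).Connected

/-- The subgraph `H` of `G` is a cycle. -/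
def IsCycleSubgraph (H : G.Subgraph) : Prop :=
  ∃ (u : V) (c : G.Walk u u), c.IsCycle ∧ c.toSubgraph = H

/-- The symmetric difference `H₁ △ H₂`: the subgraph induced by the edge set
`E(H₁) △ E(H₂)` (its vertices are the ends of these edges). -/
def symmDiffSubgraph (H₁ H₂ : G.Subgraph) : G.Subgraph where
  verts := {v | ∃ w, Xor (H₁.Adj v w) (H₂.Adj v w)}
  Adj v w := Xor (H₁.Adj v w) (H₂.Adj v w)
  adj_sub h := by
    rcases h with h | h
    · exact h.1.adj_sub
    · exact h.1.adj_sub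
  edge_vert {_ w} h := ⟨w, h⟩
  symm := ⟨fun v w h => by rwa [H₁.adj_comm w v, H₂.adj_comm w v]⟩

/-- The vertex set of a component of `G - V(H)`, as a set of vertices of `G`. -/
def componentVerts (H : G.Subgraph) (D : (G.induce H.vertsᶜ).ConnectedComponent) : Set V :=
  Subtype.val '' D.supp

/-- The subgraph formed by a component `D` of `G - V(H)` together with all edges of `G`
between `V(D)` and `V(H)` (and the ends of these edges).  An edge of `G` with an end in `D`
has its other end in `V(D)` or in `V(H)`. -/
def componentBridge (H : G.Subgraph) (D : (G.induce H.vertsᶜ).ConnectedComponent) :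
    G.Subgraph where
  verts := componentVerts H D ∪ {v | v ∈ H.verts ∧ ∃ w ∈ componentVerts H D, G.Adj v w}
  Adj v w := G.Adj v w ∧ (v ∈ componentVerts H D ∨ w ∈ componentVerts H D)
  adj_sub h := h.1
  edge_vert {v w} h := by
    obtain ⟨hvw, hv | hw⟩ := h
    · exact Or.inl hv
    · by_cases hH : v ∈ H.verts
      · exact Or.inr ⟨hH, w, hw, hvw⟩
      · left
        obtain ⟨w', hw', rfl⟩ := hw
        refine ⟨⟨v, hH⟩, ?_, rfl⟩
        have hadj : (G.induce H.vertsᶜ).Adj ⟨v, hH⟩ w' := hvw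
        rw [SimpleGraph.ConnectedComponent.mem_supp_iff] at hw' ⊢
        rw [← hw']
        exact SimpleGraph.ConnectedComponent.sound hadj.reachable
  symm := ⟨fun _ _ h => ⟨h.1.symm, h.2.symm⟩⟩

/-- `B` is an `H`-bridge of `G`: either a single edge of `G`, not in `H`, with both ends in
`V(H)`, or a component of `G - V(H)` together with all edges joining it to `V(H)`. -/
def IsBridgeOf (H B : G.Subgraph) : Prop :=
  (∃ (a b : V) (h : G.Adj a b), a ∈ H.verts ∧ b ∈ H.verts ∧ ¬ H.Adj a b ∧
    B = G.subgraphOfAdj h) ∨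
  ∃ D : (G.induce H.vertsᶜ).ConnectedComponent, B = componentBridge H D

/-- The type of `H`-bridges of `G`. -/
abbrev Bridge (H : G.Subgraph) : Type _ := {B : G.Subgraph // IsBridgeOf H B}

/-- The attachments of `B`: the vertices in `V(H) ∩ V(B)`. -/
def attachments (H B : G.Subgraph) : Set V := H.verts ∩ B.verts

/-- The leaves (vertices of degree one) of a subgraph. -/
def leaves (B : G.Subgraph) : Set V := {v | ∃! w, B.Adj v w}

/-- `B₁` and `B₂` overlap on the cycle `L`: the cycle `L` cannot be partitioned into two
subpaths `L₁`, `L₂` (edge-disjoint, with common ends) such that the attachments of `Bᵢ` all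
lie on `Lᵢ` for `i = 1, 2`. -/
def Overlap (L B₁ B₂ : G.Subgraph) : Prop :=
  ¬ ∃ (x y : V) (p q : G.Walk x y), p.IsPath ∧ q.IsPath ∧
      p.toSubgraph ⊔ q.toSubgraph = L ∧
      Disjoint p.toSubgraph.edgeSet q.toSubgraph.edgeSet ∧
      attachments L B₁ ⊆ p.toSubgraph.verts ∧ attachments L B₂ ⊆ q.toSubgraph.verts

theorem Overlap.symm {L B₁ B₂ : G.Subgraph} (h : Overlap L B₁ B₂) : Overlap L B₂ B₁ := by
  rintro ⟨x, y, p, q, hp, hq, hL, hd, h₁, h₂⟩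
  exact h ⟨x, y, q, p, hq, hp, by rw [sup_comm, hL], hd.symm, h₂, h₁⟩

/-- The overlap graph of `G` with respect to `L`: its vertices are the `L`-bridges, and two
distinct bridges are adjacent if and only if they overlap. -/
def overlapGraph (L : G.Subgraph) : SimpleGraph (Bridge L) where
  Adj B₁ B₂ := B₁ ≠ B₂ ∧ Overlap L B₁.1 B₂.1
  symm := ⟨fun _ _ h => ⟨h.1.symm, h.2.symm⟩⟩
  loopless := ⟨fun _ h => h.1 rfl⟩

end CycleBridges

/-!
Number the vertices of `L` by `ZMod n`, so that edge `e` joins `e` and `e + 1`, and let `A t` be the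
set of attachments of the `t`-th bridge. Two bridges overlap if and only if their sets of
attachments cross (`CycleParam.cross_of_overlap`, `CycleParam.overlap_of_cross`).

The cycles of the family are encoded by sets of edges of `L`. A set `X` whose boundary (the vertices
incident with exactly one edge in `X`) has no or two points in each `A t` is completed by the paths
that join these pairs of points within the bridges. All degrees are then two, so the result is a
cycle if it is connected, which is expressed in terms of `X` by `Good`. The complement of `X` has
the same boundary and yields the symmetric difference with `L`, so it must be good as well
(`CycleParam.exists_isCycleSubgraph_pair`). For fixed `t`, every set of the family whose boundary
meets `A t` is an edge of a multigraph on `A t`. Removing an edge of the `t`-th bridge, a tree with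
leaf set `A t`, separates `A t` into two nonempty parts (`exists_separation`), and a cycle of the
family uses the removed edge if its set leaves a part in the multigraph. Hence four cycles through
each edge of a bridge are provided by 4-edge-connectedness of all these multigraphs. A family of
sets with these properties that covers each edge of `L` twice is a `DoubleFamily`.

Double families exist by induction on the total number of attachments (`exists_doubleFamily`).

* For one bridge with two attachments, take both arcs between them twice.
* If a bridge has at least three attachments, and two of them, `b` and `b'`, are consecutive among
  all attachments, take a family without `b'`, remove the arc between `b` and `b'` from all its
  sets, and add this arc twice (`exists_doubleFamily_insert`).
* Otherwise there is a leaf `T` of the tree of overlaps, with neighbour `U`, and every arc of `A T`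
  contains points of `A U`, while the attachments of any other bridge stay within one arc. Take a
  family for the bridges other than `T`. By 4-edge-connectedness for `U` the pairs of sets at the
  points of `A T` are disjoint, and by goodness each such set lives on the two arcs next to its
  point. Cut these sets at the points of `A T` and recombine the pieces (`CrossesOnly.recolor`):
  each pair of consecutive points of `A T` becomes the boundary on `A T` of two new sets. The number
  of sets that leave a part of some `A s` inside one arc does not change, and the remaining cuts for
  `U` are reduced to those by uncrossing (`CrossesOnly.recolor_cut_neighbor`).
-/

/-! ### Edge sets and arcs of a cycle -/

namespace CycleBridges

variable {n : ℕ}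

/-- The cycle of length `n` has vertex set `ZMod n`, and its edge `e` joins the vertices `e` and
`e + 1`, so that a set of edges is a subset of `ZMod n` too. The boundary of a set `X` of edges
consists of the vertices incident with exactly one edge in `X`. -/
def boundary (X : Set (ZMod n)) : Set (ZMod n) := {v | ¬(v - 1 ∈ X ↔ v ∈ X)}

lemma mem_boundary {X : Set (ZMod n)} {v : ZMod n} :
    v ∈ boundary X ↔ ¬(v - 1 ∈ X ↔ v ∈ X) := Iff.rfl

lemma boundary_compl (X : Set (ZMod n)) : boundary Xᶜ = boundary X := by
  ext v
  simp only [mem_boundary, Set.mem_compl_iff]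
  tauto

lemma boundary_diff {X Y : Set (ZMod n)} (hYX : Y ⊆ X) (hb : boundary Y ⊆ boundary X) :
    boundary (X \ Y) = boundary X \ boundary Y := by
  ext v
  have h1 := @hYX v
  have h2 := @hYX (v - 1)
  have h3 := @hb v
  simp only [mem_boundary, Set.mem_sdiff] at *
  tauto

lemma boundary_empty : boundary (∅ : Set (ZMod n)) = ∅ := by
  ext v
  simp [mem_boundary]

variable [NeZero n]

/-- Induction along the whole cycle, from an arbitrary starting point. -/
lemma zmod_induction {p : ZMod n → Prop} (a : ZMod n) (ha : p a)
    (h : ∀ v, p (v - 1) → p v) (v : ZMod n) : p v := by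
  have key : ∀ k : ℕ, p (a + k) := by
    intro k
    induction k with
    | zero => simpa using ha
    | succ k ih =>
      apply h
      have : a + ((k + 1 : ℕ) : ZMod n) - 1 = a + k := by push_cast; ring
      rwa [this]
  have := key (v - a).val
  rwa [ZMod.natCast_zmod_val, add_sub_cancel] at this

lemma eq_empty_or_univ_of_boundary {X : Set (ZMod n)} (h : boundary X = ∅) :
    X = ∅ ∨ X = Set.univ := by
  rcases X.eq_empty_or_nonempty with h0 | ⟨a, ha⟩
  · exact Or.inl h0
  · right
    refine Set.eq_univ_of_forall fun v => zmod_induction (p := (· ∈ X)) a ha (fun w hw => ?_) v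
    by_contra hc
    have : w ∈ boundary X := by
      rw [mem_boundary]
      tauto
    rw [h] at this
    exact this

/-- The last point of `B` at or before `e` in the cyclic order (meaningful for nonempty `B` only).
The points of `B` cut the cycle into arcs; the arc starting at `d ∈ B` is the set of edges `e` with
`arcStart B e = d`. -/
noncomputable def arcStart (B : Set (ZMod n)) (e : ZMod n) : ZMod n :=
  e - (sInf {k : ℕ | e - k ∈ B} : ℕ)

section arcs
variable {B : Set (ZMod n)}

lemma arcStart_mem (hB : B.Nonempty) (e : ZMod n) : arcStart B e ∈ B := by
  have : {k : ℕ | e - k ∈ B}.Nonempty := by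
    obtain ⟨b, hb⟩ := hB
    refine ⟨(e - b).val, ?_⟩
    simpa using hb
  exact Nat.sInf_mem this

lemma arcStart_val_le {b : ZMod n} (hb : b ∈ B) (e : ZMod n) :
    (e - arcStart B e).val ≤ (e - b).val := by
  have h : sInf {k : ℕ | e - k ∈ B} ≤ (e - b).val := Nat.sInf_le (by simpa using hb)
  have : e - arcStart B e = (sInf {k : ℕ | e - k ∈ B} : ℕ) := by
    simp [arcStart]
  rw [this, ZMod.val_natCast_of_lt (lt_of_le_of_lt h (ZMod.val_lt _))]
  exact h

lemma arcStart_eq_of_le {e b : ZMod n} (hb : b ∈ B)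
    (h : ∀ x ∈ B, (e - b).val ≤ (e - x).val) : arcStart B e = b := by
  have h1 := arcStart_val_le hb e
  have h2 := h _ (arcStart_mem ⟨b, hb⟩ e)
  have := ZMod.val_injective n (le_antisymm h1 h2)
  simpa using this

lemma arcStart_self {e : ZMod n} (he : e ∈ B) : arcStart B e = e :=
  arcStart_eq_of_le he (by simp)

lemma val_sub_one {x : ZMod n} (hx : x ≠ 0) : (x - 1).val + 1 = x.val := by
  have h1 : x.val ≠ 0 := by rwa [ZMod.val_ne_zero]
  have h2 : x - 1 = ((x.val - 1 : ℕ) : ZMod n) := by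
    rw [Nat.cast_sub (by omega), ZMod.natCast_zmod_val]; simp
  have := ZMod.val_lt x
  rw [h2, ZMod.val_natCast_of_lt (by omega)]
  omega

lemma arcStart_sub_one (hB : B.Nonempty) {e : ZMod n} (he : e ∉ B) :
    arcStart B (e - 1) = arcStart B e := by
  refine arcStart_eq_of_le (arcStart_mem hB e) fun x hx => ?_
  have key : ∀ y ∈ B, (e - 1 - y).val + 1 = (e - y).val := by
    intro y hy
    rw [show e - 1 - y = (e - y) - 1 by ring]
    apply val_sub_one
    intro h0
    exact he (by rwa [sub_eq_zero.1 h0])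
  have h1 := key _ (arcStart_mem hB e)
  have h2 := key x hx
  have := arcStart_val_le hx e
  omega

lemma val_sub_eq (p q : ZMod n) :
    (p - q).val = if q.val ≤ p.val then p.val - q.val else n + p.val - q.val := by
  have hp := ZMod.val_lt p
  have hq := ZMod.val_lt q
  split_ifs with h
  · exact ZMod.val_sub h
  · have : p - q = ((n + p.val - q.val : ℕ) : ZMod n) := by
      rw [Nat.cast_sub (by omega)]; simp
    rw [this, ZMod.val_natCast_of_lt (by omega)]

/-- Sending a point `b` of `B` to the start of the arc that ends at `b` is injective, hence a
permutation; its inverse is the cyclic successor. -/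
lemma exists_arcNext (hB : B.Nonempty) :
    ∃ σ : Equiv.Perm B, ∀ b, arcStart B ((σ b : ZMod n) - 1) = b := by
  let f : B → B := fun b => ⟨arcStart B ((b : ZMod n) - 1), arcStart_mem hB _⟩
  have hf : Function.Injective f := by
    intro b c hbc
    have h0 : arcStart B ((b : ZMod n) - 1) = arcStart B ((c : ZMod n) - 1) :=
      congrArg Subtype.val hbc
    have hb := arcStart_val_le c.2 ((b : ZMod n) - 1)
    have hc := arcStart_val_le b.2 ((c : ZMod n) - 1)
    rw [h0] at hb
    set a := arcStart B ((c : ZMod n) - 1)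
    -- measured from the common point `a`, the two points `b` and `c` would each precede the other
    have e1 : ((b : ZMod n) - 1 - c) = ((b : ZMod n) - 1 - a) - ((c : ZMod n) - 1 - a) - 1 := by
      ring
    have e2 : ((c : ZMod n) - 1 - b) = ((c : ZMod n) - 1 - a) - ((b : ZMod n) - 1 - a) - 1 := by
      ring
    rw [e1] at hb
    rw [e2] at hc
    by_contra hne
    have hne' : ((b : ZMod n) - 1 - a) ≠ ((c : ZMod n) - 1 - a) := by
      intro h
      apply hne
      ext
      simpa using h
    set p := (b : ZMod n) - 1 - a
    set q := (c : ZMod n) - 1 - a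
    have hv : p.val ≠ q.val := fun h => hne' (ZMod.val_injective n h)
    have f1 := val_sub_one (sub_ne_zero.2 hne')
    have f2 := val_sub_one (sub_ne_zero.2 hne'.symm)
    rw [val_sub_eq p q] at f1
    rw [val_sub_eq q p] at f2
    have := ZMod.val_lt p
    have := ZMod.val_lt q
    split_ifs at f1 f2 <;> omega
  let e : B ≃ B := Equiv.ofBijective f (Finite.injective_iff_bijective.1 hf)
  refine ⟨e.symm, fun b => ?_⟩
  exact congrArg Subtype.val (e.apply_symm_apply b)

/-- The permutation `σ` sends each point of `B` to the next point of `B` in the cyclic order: the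
arc starting at `b` ends in the edge `σ b - 1`. -/
def IsNext (B : Set (ZMod n)) (σ : Equiv.Perm B) : Prop :=
  ∀ b, arcStart B ((σ b : ZMod n) - 1) = b

variable {σ : Equiv.Perm B}

omit [NeZero n] in
lemma IsNext.arcStart_sub_one (hσ : IsNext B σ) (b : B) :
    arcStart B ((b : ZMod n) - 1) = σ.symm b := by
  have := hσ (σ.symm b)
  rwa [σ.apply_symm_apply] at this

/-- The cyclic successor permutation acts transitively. -/
lemma IsNext.eq_univ (hσ : IsNext B σ) {Z : Set B} (hne : Z.Nonempty)
    (hZ : ∀ b, b ∈ Z ↔ σ b ∈ Z) : Z = Set.univ := by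
  obtain ⟨a, ha⟩ := hne
  have hB : B.Nonempty := ⟨a, a.2⟩
  let Y : Set (ZMod n) := {e | ⟨arcStart B e, arcStart_mem hB e⟩ ∈ Z}
  have hY : boundary Y = ∅ := by
    rw [Set.eq_empty_iff_forall_notMem]
    intro v hv
    apply hv
    by_cases hvB : v ∈ B
    · change _ ∈ Z ↔ _ ∈ Z
      have h1 : (⟨arcStart B v, arcStart_mem hB v⟩ : B) = ⟨v, hvB⟩ := by
        ext; exact arcStart_self hvB
      have h2 : (⟨arcStart B (v - 1), arcStart_mem hB (v - 1)⟩ : B) = σ.symm ⟨v, hvB⟩ := by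
        ext; exact hσ.arcStart_sub_one ⟨v, hvB⟩
      rw [h1, h2, hZ, σ.apply_symm_apply]
    · change _ ∈ Z ↔ _ ∈ Z
      simp only [CycleBridges.arcStart_sub_one hB hvB]
  have key : ∀ b : B, (b : ZMod n) ∈ Y ↔ b ∈ Z := by
    intro b
    change _ ∈ Z ↔ _
    simp only [arcStart_self b.2]
  rcases eq_empty_or_univ_of_boundary hY with h | h
  · have := (key a).2 ha
    rw [h] at this
    exact this.elim
  · refine Set.eq_univ_of_forall fun b => (key b).1 ?_
    rw [h]; trivial

lemma IsNext.exists_exit (hσ : IsNext B σ) {Z : Set B} (hne : Z.Nonempty) (hZ : Z ≠ Set.univ) :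
    ∃ b ∈ Z, σ b ∉ Z := by
  by_contra! hc
  apply hZ
  apply hσ.eq_univ hne
  intro b
  refine ⟨hc b, ?_⟩
  have : σ '' Z = Z := by
    apply Set.eq_of_subset_of_ncard_le
    · rintro _ ⟨b, hb, rfl⟩
      exact hc b hb
    · rw [Set.ncard_image_of_injective _ σ.injective]
    · exact Set.toFinite _
  intro h
  rw [← this] at h
  obtain ⟨c, hc, hcb⟩ := h
  rwa [← σ.injective hcb]

lemma IsNext.exists_enter (hσ : IsNext B σ) {Z : Set B} (hne : Z.Nonempty) (hZ : Z ≠ Set.univ) :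
    ∃ b, b ∉ Z ∧ σ b ∈ Z := by
  obtain ⟨b, hb, h⟩ := hσ.exists_exit (Z := Zᶜ) (Set.nonempty_compl.2 hZ)
    (by intro h; rw [Set.compl_univ_iff] at h; exact hne.ne_empty h)
  exact ⟨b, hb, by simpa using h⟩

lemma IsNext.ne_self (hσ : IsNext B σ) (hB : B.Nontrivial) (b : B) : σ b ≠ b := by
  intro h
  obtain ⟨c, hc, hcb⟩ := hB.exists_ne (b : ZMod n)
  have : ({b} : Set B) ≠ Set.univ := by
    intro hu
    have : (⟨c, hc⟩ : B) ∈ ({b} : Set B) := by rw [hu]; trivial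
    exact hcb (congrArg Subtype.val this)
  obtain ⟨x, hx, hx'⟩ := hσ.exists_exit (Set.singleton_nonempty b) this
  rw [Set.mem_singleton_iff] at hx
  subst hx
  exact hx' h

/-- The inner vertices of the arc of `B` starting at `d`, which excludes both ends of the arc. -/
def arcInner (B : Set (ZMod n)) (d : ZMod n) : Set (ZMod n) := {v | v ∉ B ∧ arcStart B v = d}

/-- At an inner vertex of an arc, the boundary of a set depends on its edges in that arc only. -/
lemma arcInner_congr {X Y : Set (ZMod n)} {d v : ZMod n} (hv : v ∈ arcInner B d)
    (hB : B.Nonempty)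
    (h : ∀ e, arcStart B e = d → (e ∈ X ↔ e ∈ Y)) : v ∈ boundary X ↔ v ∈ boundary Y := by
  rw [mem_boundary, mem_boundary, h v hv.2,
    h (v - 1) (by rw [arcStart_sub_one hB hv.1]; exact hv.2)]

lemma IsNext.boundary_arc (hσ : IsNext B σ) (b : B) (hne : σ b ≠ b) :
    boundary {e | arcStart B e = b} = {(b : ZMod n), (σ b : ZMod n)} := by
  have hB : B.Nonempty := ⟨b, b.2⟩
  ext v
  rw [mem_boundary, Set.mem_ofPred_eq, Set.mem_ofPred_eq, Set.mem_insert_iff, Set.mem_singleton_iff]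
  by_cases hv : v ∈ B
  · lift v to B using hv
    rw [hσ.arcStart_sub_one v, arcStart_self v.2, Subtype.coe_inj, Subtype.coe_inj, Subtype.coe_inj,
      Equiv.symm_apply_eq]
    by_cases h1 : v = b
    · subst h1
      simp [hne.symm]
    · simp [h1]
  · rw [CycleBridges.arcStart_sub_one hB hv]
    simp only [not_true_eq_false, false_iff, not_or]
    exact ⟨fun h => hv (h ▸ b.2), fun h => hv (h ▸ (σ b).2)⟩

/-- An edge set `X` contains both or neither of the first and the last edge of an arc if and only if
it has an even number of boundary vertices inside that arc. -/
lemma IsNext.even_ncard (hσ : IsNext B σ) (X : Set (ZMod n)) (d : B) :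
    Even (boundary X ∩ arcInner B d).ncard ↔ ((d : ZMod n) ∈ X ↔ (σ d : ZMod n) - 1 ∈ X) := by
  classical
  have hB : B.Nonempty := ⟨d, d.2⟩
  let g : ZMod n → ZMod 2 := fun e => if e ∈ X then 1 else 0
  let J : Finset (ZMod n) := Finset.univ.filter fun e => arcStart B e = d
  let K : Finset (ZMod n) := Finset.univ.filter fun v => v ∉ B ∧ arcStart B v = d
  have hdK : (d : ZMod n) ∉ K := by simp [K]
  have hsK : (σ d : ZMod n) ∉ K := by simp [K]
  have hJ : J = insert (d : ZMod n) K := by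
    ext e
    simp only [J, K, Finset.mem_filter, Finset.mem_univ, true_and, Finset.mem_insert]
    constructor
    · intro h
      by_cases he : e ∈ B
      · left; rw [← h, arcStart_self he]
      · exact Or.inr ⟨he, h⟩
    · rintro (rfl | h)
      · exact arcStart_self d.2
      · exact h.2
  have hJ' : J.map (Equiv.addRight (1 : ZMod n)).toEmbedding = insert (σ d : ZMod n) K := by
    ext e
    simp only [J, K, Finset.mem_map_equiv, Finset.mem_filter, Finset.mem_univ, true_and,
      Finset.mem_insert, Equiv.addRight_symm, Equiv.coe_addRight, ← sub_eq_add_neg]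
    constructor
    · intro h
      by_cases he : e ∈ B
      · left
        have := hσ.arcStart_sub_one ⟨e, he⟩
        rw [h] at this
        have h2 : d = σ.symm ⟨e, he⟩ := Subtype.ext this
        rw [h2, σ.apply_symm_apply]
      · exact Or.inr ⟨he, by rwa [CycleBridges.arcStart_sub_one hB he] at h⟩
    · rintro (rfl | h)
      · exact hσ d
      · rw [CycleBridges.arcStart_sub_one hB h.1]; exact h.2
  have s1 : ∑ e ∈ J, g e = g d + ∑ e ∈ K, g e := by rw [hJ, Finset.sum_insert hdK]
  have s2 : ∑ e ∈ J, g e = g ((σ d : ZMod n) - 1) + ∑ e ∈ K, g (e - 1) := by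
    rw [← Finset.sum_insert (f := fun e => g (e - 1)) hsK, ← hJ', Finset.sum_map]
    simp
  have s3 : (((boundary X ∩ arcInner B d).ncard : ℕ) : ZMod 2)
      = ∑ e ∈ K, (g e + g (e - 1)) := by
    have : boundary X ∩ arcInner B d = ((K.filter (· ∈ boundary X) : Finset _) : Set (ZMod n)) := by
      ext e
      simp [K, arcInner, and_comm]
    rw [this, Set.ncard_coe_finset, Finset.card_filter]
    push_cast
    refine Finset.sum_congr rfl fun e _ => ?_
    simp only [mem_boundary, g]
    by_cases h1 : e ∈ X <;> by_cases h2 : e - 1 ∈ X <;> simp [h1, h2]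
    decide
  rw [← ZMod.natCast_eq_zero_iff_even, s3, Finset.sum_add_distrib]
  have s4 : ∑ e ∈ K, g e + ∑ e ∈ K, g (e - 1) = g d + g ((σ d : ZMod n) - 1) := by
    have h2 : ∀ a b c e : ZMod 2, a + b = c + e → b + e = a + c := by decide
    exact h2 _ _ _ _ (s1.symm.trans s2)
  rw [s4]
  simp only [g]
  by_cases h1 : (d : ZMod n) ∈ X <;> by_cases h2 : (σ d : ZMod n) - 1 ∈ X <;> simp [h1, h2]
  decide

end arcs

end CycleBridges

/-! ### Crossing sets and double families -/

namespace CycleBridges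

variable {n : ℕ} [NeZero n] {ι : Type*}

/-- The sets `A` and `B` of vertices of the cycle cross: there are points `x, u, y, v` in this
strict cyclic order with `x, y ∈ A` and `u, v ∈ B`. The order is expressed by the distances from
`x`. -/
def Cross (A B : Set (ZMod n)) : Prop :=
  ∃ x ∈ A, ∃ y ∈ A, ∃ u ∈ B, ∃ v ∈ B,
    0 < (u - x).val ∧ (u - x).val < (y - x).val ∧ (y - x).val < (v - x).val

lemma Cross.symm {A B : Set (ZMod n)} (h : Cross A B) : Cross B A := by
  obtain ⟨x, hx, y, hy, u, hu, v, hv, h1, h2, h3⟩ := h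
  refine ⟨u, hu, v, hv, y, hy, x, hx, ?_⟩
  have e1 := val_sub_eq (y - x) (u - x)
  have e2 := val_sub_eq (v - x) (u - x)
  have e3 := val_sub_eq (x - x) (u - x)
  have := ZMod.val_lt (v - x)
  rw [sub_sub_sub_cancel_right] at e1 e2 e3
  rw [sub_self, ZMod.val_zero] at e3
  rw [e1, e2, e3]
  split_ifs <;> omega

lemma Cross.exists_arcStart_ne {A B : Set (ZMod n)} (h : Cross A B) :
    ∃ u ∈ B, ∃ v ∈ B, arcStart A u ≠ arcStart A v := by
  obtain ⟨x, hx, y, hy, u, hu, v, hv, h1, h2, h3⟩ := h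
  refine ⟨u, hu, v, hv, fun heq => ?_⟩
  have f1 := arcStart_val_le hx u
  have f2 := arcStart_val_le hy v
  rw [← heq] at f2
  set a := arcStart A u
  have e1 := val_sub_eq (u - x) (a - x)
  have e2 := val_sub_eq (v - x) (a - x)
  have e3 := val_sub_eq (v - x) (y - x)
  have := ZMod.val_lt (v - x)
  have := ZMod.val_lt (a - x)
  simp only [sub_sub_sub_cancel_right] at e1 e2 e3
  rw [e1] at f1
  rw [e2, e3] at f2
  split_ifs at f1 f2 <;> omega

/-- If `B` meets two different arcs of the disjoint set `A`, then `A` and `B` cross. -/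
lemma cross_of_arcStart_ne {A B : Set (ZMod n)} (hd : Disjoint A B) (hA : A.Nonempty)
    {u v : ZMod n} (hu : u ∈ B) (hv : v ∈ B) (h : arcStart A u ≠ arcStart A v) : Cross A B := by
  have ha := arcStart_mem hA u
  have hy := arcStart_mem hA v
  have f1 := arcStart_val_le hy u
  have f2 := arcStart_val_le ha v
  set a := arcStart A u
  set y := arcStart A v
  refine ⟨a, ha, y, hy, u, hu, v, hv, ?_⟩
  have n1 : (u - a).val ≠ 0 := by
    rw [Ne, ZMod.val_eq_zero, sub_eq_zero]
    intro h0
    exact Set.disjoint_left.1 hd ha (h0 ▸ hu)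
  have n2 : (y - a).val ≠ 0 := by
    rw [Ne, ZMod.val_eq_zero, sub_eq_zero]
    exact h.symm
  have n3 : (v - a).val ≠ (y - a).val := by
    intro h0
    have := ZMod.val_injective n h0
    rw [sub_left_inj] at this
    exact Set.disjoint_left.1 hd hy (this ▸ hv)
  have e1 := val_sub_eq (u - a) (y - a)
  have e2 := val_sub_eq (v - a) (y - a)
  have := ZMod.val_lt (u - a)
  have := ZMod.val_lt (v - a)
  have := ZMod.val_lt (y - a)
  simp only [sub_sub_sub_cancel_right] at e1 e2
  rw [e1] at f1
  rw [e2] at f2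
  split_ifs at f1 f2 <;> omega

/-- Let `A t` be the attachments of the `t`-th bridge. A set `N` of edges of the cycle that has no
boundary vertex or exactly two boundary vertices in each `A t` stands for the subgraph consisting of
`N` and, for each `t`, of a path in the `t`-th bridge between those two vertices. The set `Y` is
compatible with `N` if it is the set of cycle edges of a union of components of this subgraph. -/
def Compatible (A : ι → Set (ZMod n)) (N Y : Set (ZMod n)) : Prop :=
  Y ⊆ N ∧ boundary Y ⊆ boundary N ∧
    ∀ t, boundary Y ∩ A t = ∅ ∨ boundary Y ∩ A t = boundary N ∩ A t

/-- The subgraph that `N` stands for (see `Compatible`) is connected. As all its degrees are two, it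
then is a cycle, unless `N` has no boundary. -/
def Good (A : ι → Set (ZMod n)) (N : Set (ZMod n)) : Prop :=
  ∀ Y, Compatible A N Y → Y = ∅ ∨ Y = N

omit [NeZero n] in
/-- It suffices to consider the components that avoid the `t`-th bridge, because complements within
`N` of compatible sets are compatible. -/
lemma good_of {A : ι → Set (ZMod n)} {N : Set (ZMod n)} (t : ι)
    (h : ∀ Y, Compatible A N Y → boundary Y ∩ A t = ∅ → Y = ∅) : Good A N := by
  intro Y hY
  obtain ⟨h1, h2, h3⟩ := hY
  rcases h3 t with h4 | h4
  · exact Or.inl (h Y ⟨h1, h2, h3⟩ h4)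
  · right
    have hb := boundary_diff h1 h2
    have key : N \ Y = ∅ := by
      apply h
      · refine ⟨Set.sdiff_subset, ?_, fun s => ?_⟩
        · rw [hb]; exact Set.sdiff_subset
        · rw [hb, Set.sdiff_inter_right_comm, ← Set.sdiff_inter_self_eq_sdiff]
          rcases h3 s with h5 | h5
          · right
            ext x
            have := Set.ext_iff.1 h5 x
            simp only [Set.mem_inter_iff, Set.mem_sdiff, Set.mem_empty_iff_false] at *
            tauto
          · left
            ext x
            have := Set.ext_iff.1 h5 x
            simp only [Set.mem_inter_iff, Set.mem_sdiff, Set.mem_empty_iff_false] at *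
            tauto
      · rw [hb]
        ext x
        have := Set.ext_iff.1 h4 x
        simp only [Set.mem_inter_iff, Set.mem_sdiff, Set.mem_empty_iff_false] at *
        tauto
    exact Set.Subset.antisymm h1 (Set.sdiff_eq_empty.1 key)

/-- The combinatorial form of the family of cycles. Each colour `c` stands for the subgraph given by
`X c` as in `Compatible`, and its symmetric difference with the cycle is given by `(X c)ᶜ`, which
has the same boundary. Each edge of the cycle gets two colours (`cover`), and for each `t` the
multigraph on `A t` with an edge for every colour that has two boundary vertices in `A t` is
4-edge-connected (`cut`). -/
structure DoubleFamily (A : ι → Set (ZMod n)) {γ : Type} [Finite γ] (X : γ → Set (ZMod n)) :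
    Prop where
  cover : ∀ e, {c | e ∈ X c}.ncard = 2
  sub : ∀ c, boundary (X c) ⊆ ⋃ t, A t
  ne : ∀ c, (boundary (X c)).Nonempty
  two : ∀ c t, boundary (X c) ∩ A t = ∅ ∨ (boundary (X c) ∩ A t).ncard = 2
  cut : ∀ t Z, Z ⊆ A t → Z.Nonempty → Z ≠ A t →
    4 ≤ {c | (boundary (X c) ∩ Z).ncard = 1}.ncard
  good : ∀ c, Good A (X c)
  good_compl : ∀ c, Good A (X c)ᶜ

/-- A single bridge with two attachments: take each of the two arcs between them twice. -/
lemma exists_doubleFamily_of_pair (A : ι → Set (ZMod n)) (t : ι) (ht : ∀ s, s = t)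
    (hA : (A t).ncard = 2) :
    ∃ X : Bool × Bool → Set (ZMod n), DoubleFamily A X := by
  have hfin : (A t).Finite := Set.toFinite _
  have hnt : (A t).Nontrivial := by
    rw [← Set.one_lt_ncard_iff_nontrivial]; omega
  obtain ⟨σ, hσ⟩ := exists_arcNext hnt.nonempty
  change IsNext _ σ at hσ
  obtain ⟨b, hb⟩ := hnt.nonempty
  set d : A t := ⟨b, hb⟩
  set I : Set (ZMod n) := {e | arcStart (A t) e = d} with hI
  have hne : σ d ≠ d := hσ.ne_self hnt d
  have hbI : boundary I = A t := by
    rw [hI, hσ.boundary_arc d hne]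
    symm
    apply (Set.eq_of_subset_of_ncard_le _ _ hfin).symm
    · rintro x (rfl | rfl)
      · exact d.2
      · exact (σ d).2
    · rw [hA, Set.ncard_pair]
      exact fun h => hne (Subtype.ext h.symm)
  have hsub : ∀ s : Set (ZMod n), s ⊆ A t → s ≠ A t → s.Nonempty → s.ncard = 1 := by
    intro s hs hne hs0
    have h1 := Set.ncard_lt_ncard (hs.ssubset_of_ne hne)
    have h2 := hs0.ncard_pos
    omega
  have hgood : ∀ N : Set (ZMod n), boundary N = A t → Good A N := by
    intro N hN
    refine good_of t fun Y ⟨hYN, hbY, _⟩ h => ?_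
    have : boundary Y = ∅ := by
      rw [← h, Set.inter_eq_left.2 (hbY.trans hN.le)]
    rcases eq_empty_or_univ_of_boundary this with h0 | h0
    · exact h0
    · exfalso
      have : N = Set.univ := Set.univ_subset_iff.1 (h0 ▸ hYN)
      rw [this, ← Set.compl_empty, boundary_compl, boundary_empty] at hN
      exact hnt.nonempty.ne_empty hN.symm
  let X : Bool × Bool → Set (ZMod n) := fun c => if c.1 then I else Iᶜ
  have hbX : ∀ c, boundary (X c) = A t := by
    intro c
    by_cases hc : c.1 <;> simp [X, hc, boundary_compl, hbI]
  refine ⟨X, ⟨fun e => ?_, fun c => ?_, fun c => ?_, fun c s => ?_, fun s Z hZ hZ0 hZ1 => ?_,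
    fun c => hgood _ (hbX c), fun c => hgood _ (by rw [boundary_compl, hbX c])⟩⟩
  · by_cases he : e ∈ I
    · have : {c | e ∈ X c} = {(true, true), (true, false)} := by
        ext ⟨a, b⟩
        cases a <;> cases b <;> simp [X, he]
      rw [this, Set.ncard_pair (by simp)]
    · have : {c | e ∈ X c} = {(false, true), (false, false)} := by
        ext ⟨a, b⟩
        cases a <;> cases b <;> simp [X, he]
      rw [this, Set.ncard_pair (by simp)]
  · rw [hbX]; exact Set.subset_iUnion A t
  · rw [hbX]; exact hnt.nonempty
  · right
    rw [ht s, hbX, Set.inter_self, hA]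
  · rw [ht s] at hZ hZ1
    have : {c | (boundary (X c) ∩ Z).ncard = 1} = Set.univ := by
      refine Set.eq_univ_of_forall fun c => ?_
      rw [Set.mem_ofPred_eq, hbX, Set.inter_eq_right.2 hZ]
      exact hsub Z hZ hZ1 hZ0
    rw [this, Set.ncard_univ]
    simp

end CycleBridges

/-! ### Inserting an attachment next to another one -/

namespace CycleBridges

variable {n : ℕ} [NeZero n] {ι : Type*}

/-- A set without boundary inside an arc contains all of its edges or none. -/
lemma mem_iff_of_arcStart_eq {B X : Set (ZMod n)} (hB : B.Nonempty) {d : ZMod n}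
    (h : ∀ v ∈ arcInner B d, v ∉ boundary X) {e : ZMod n} (he : arcStart B e = d) :
    e ∈ X ↔ d ∈ X := by
  have key : ∀ k : ℕ, ∀ e, arcStart B e = d → (e - d).val = k → (e ∈ X ↔ d ∈ X) := by
    intro k
    induction k with
    | zero =>
      intro e _ hk
      rw [ZMod.val_eq_zero, sub_eq_zero] at hk
      rw [hk]
    | succ k ih =>
      intro e he hk
      have heB : e ∉ B := by
        intro heB
        rw [← he, arcStart_self heB] at hk
        simp at hk
      have h1 := h e ⟨heB, he⟩
      rw [mem_boundary, not_not] at h1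
      rw [← h1]
      apply ih
      · rw [arcStart_sub_one hB heB, he]
      · have h2 : e - d ≠ 0 := by
          intro h0
          rw [h0] at hk
          simp at hk
        have := val_sub_one h2
        rw [sub_right_comm]
        omega
  exact key _ e he rfl

/-- Two pairs whose symmetric difference has at least four elements are disjoint. This is how the
cut condition forces the colours at different edges of the cycle to be different. -/
lemma disjoint_of_symmDiff {γ : Type*} [Finite γ] {P Q S : Set γ} (hP : P.ncard = 2)
    (hQ : Q.ncard = 2) (hS : 4 ≤ S.ncard) (h : ∀ c ∈ S, ¬(c ∈ P ↔ c ∈ Q)) : Disjoint P Q := by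
  rw [Set.disjoint_left]
  intro c hcP hcQ
  have h1 : S ⊆ (P \ {c}) ∪ (Q \ {c}) := by
    intro x hx
    have := h x hx
    have hxc : x ≠ c := by
      rintro rfl
      tauto
    simp only [Set.mem_union, Set.mem_sdiff, Set.mem_singleton_iff]
    tauto
  have h2 := Set.ncard_le_ncard h1
  have h3 := Set.ncard_union_le (P \ {c}) (Q \ {c})
  rw [Set.ncard_sdiff_singleton_of_mem hcP, Set.ncard_sdiff_singleton_of_mem hcQ] at h3
  omega

omit [NeZero n] in
lemma Good.congr {A A' : ι → Set (ZMod n)} {N : Set (ZMod n)} (h : Good A' N)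
    (hA : ∀ s, boundary N ∩ A s = boundary N ∩ A' s) : Good A N := by
  rintro Y ⟨h1, h2, h3⟩
  have key : ∀ s, boundary Y ∩ A s = boundary Y ∩ A' s := by
    intro s
    rw [← Set.inter_eq_left.2 h2, Set.inter_assoc, hA, ← Set.inter_assoc]
  refine h Y ⟨h1, h2, fun s => ?_⟩
  rw [← key, ← hA]
  exact h3 s

/-- An edge of a multigraph on `A` leaves `Z` if and only if it leaves `A \ Z`. -/
lemma ncard_inter_diff_eq_one_iff {A D Z : Set (ZMod n)} (hD : D ∩ A = ∅ ∨ (D ∩ A).ncard = 2)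
    (hZ : Z ⊆ A) : (D ∩ (A \ Z)).ncard = 1 ↔ (D ∩ Z).ncard = 1 := by
  have h1 : D ∩ A = (D ∩ (A \ Z)) ∪ (D ∩ Z) := by
    rw [← Set.inter_union_distrib_left, Set.sdiff_union_of_subset hZ]
  have h2 : Disjoint (D ∩ (A \ Z)) (D ∩ Z) :=
    (Set.disjoint_sdiff_left).mono Set.inter_subset_right Set.inter_subset_right
  have h3 := Set.ncard_union_eq h2
  rw [← h1] at h3
  rcases hD with h | h
  · rw [h, Set.ncard_empty] at h3
    omega
  · omega

lemma exchange_inter_of_notMem {α : Type*} {D Z : Set α} {b b' : α} (h : b ∉ Z) (h' : b' ∉ Z) :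
    insert b' (D \ {b}) ∩ Z = D ∩ Z := by
  ext v
  have h4 : v = b' → v ∉ Z := fun e => e ▸ h'
  have h5 : v = b → v ∉ Z := fun e => e ▸ h
  simp only [Set.mem_inter_iff, Set.mem_insert_iff, Set.mem_sdiff, Set.mem_singleton_iff]
  tauto

lemma exchange_inter_of_mem {α : Type*} {D Z : Set α} {b b' : α} (hD : b' ∉ D) (h' : b' ∈ Z) :
    insert b' (D \ {b}) ∩ Z = insert b' ((D ∩ (Z \ {b'})) \ {b}) := by
  ext v
  have h4 : v = b' → v ∉ D := fun e => e ▸ hD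
  have h5 : v = b' → v ∈ Z := fun e => e ▸ h'
  simp only [Set.mem_inter_iff, Set.mem_insert_iff, Set.mem_sdiff, Set.mem_singleton_iff]
  tauto

set_option maxHeartbeats 1000000 in
/-- Inserting an attachment `σ b` of the `t`-th bridge next to its attachment `b`, with no
attachment of any bridge between the two: remove the arc `I` between them from all sets of the
family, and add `I` twice. The two old colours at the first edge of `I` have a boundary vertex at
`b`, which moves to `σ b`. In the multigraph on `A t`, this splits off the vertex `σ b` from `b`,
gives it the two edges of these colours, and joins it to `b` by two new edges. -/
lemma exists_doubleFamily_insert {A A' : ι → Set (ZMod n)}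
    (hA : Pairwise fun s s' => Disjoint (A s) (A s')) {t : ι} {σ : Equiv.Perm (A t)}
    (hσ : IsNext (A t) σ) (b : A t)
    (hcard : 3 ≤ (A t).ncard) (hinner : ∀ v ∈ arcInner (A t) b, ∀ s, v ∉ A s)
    (hAt : A' t = A t \ {(σ b : ZMod n)}) (hAs : ∀ s, s ≠ t → A' s = A s)
    {γ : Type} [Finite γ] {X : γ → Set (ZMod n)} (hX : DoubleFamily A' X) :
    ∃ X' : γ ⊕ Bool → Set (ZMod n), DoubleFamily A X' := by
  have hfin : (A t).Finite := Set.toFinite _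
  have hnt : (A t).Nontrivial := by
    rw [← Set.one_lt_ncard_iff_nontrivial]; omega
  have hne' : σ b ≠ b := hσ.ne_self hnt b
  have hne : (σ b : ZMod n) ≠ b := fun h => hne' (Subtype.ext h)
  obtain ⟨b, hb⟩ := b
  set b' : ZMod n := ((σ ⟨b, hb⟩ : A t) : ZMod n) with hb'def
  have hb' : b' ∈ A t := (σ ⟨b, hb⟩).2
  set I : Set (ZMod n) := {e | arcStart (A t) e = b} with hI
  have hbI : boundary I = {b, b'} := hσ.boundary_arc ⟨b, hb⟩ hne'
  have hnot : ∀ s, s ≠ t → ∀ x ∈ A t, x ∉ A s := fun s hs x hx hx' =>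
    Set.disjoint_left.1 (hA hs) hx' hx
  have hA'sub : ∀ s, A' s ⊆ A s := by
    intro s
    by_cases hs : s = t
    · subst hs; rw [hAt]; exact Set.sdiff_subset
    · rw [hAs s hs]
  have hb'A' : ∀ s, b' ∉ A' s := by
    intro s
    by_cases hs : s = t
    · subst hs; rw [hAt]; simp
    · rw [hAs s hs]; exact hnot s hs b' hb'
  have hbA' : b ∈ A' t := by rw [hAt]; exact ⟨hb, fun h => hne h.symm⟩
  have hbdA' : ∀ c v, (∀ s, v ∉ A' s) → v ∉ boundary (X c) := by
    intro c v hv h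
    obtain ⟨s, hs⟩ := Set.mem_iUnion.1 (hX.sub c h)
    exact hv s hs
  have hb'bd : ∀ c, b' ∉ boundary (X c) := fun c => hbdA' c b' hb'A'
  have hbI' : b ∈ I := arcStart_self hb
  have hb'I : b' - 1 ∈ I := hσ ⟨b, hb⟩
  have hb'I' : b' ∉ I := by
    intro h
    have : arcStart (A t) b' = b := h
    rw [arcStart_self hb'] at this
    exact hne this
  have hbI'' : b - 1 ∉ I := by
    have : b ∈ boundary I := by rw [hbI]; simp
    rw [mem_boundary] at this
    tauto
  have hconst : ∀ c, ∀ e ∈ I, e ∈ X c ↔ b ∈ X c := fun c e he =>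
    mem_iff_of_arcStart_eq hnt.nonempty
      (fun v hv => hbdA' c v fun s hs => hinner v hv s (hA'sub s hs)) he
  have hb'X : ∀ c, b' ∈ X c ↔ b ∈ X c := by
    intro c
    have := hb'bd c
    rw [mem_boundary, not_not, hconst c _ hb'I] at this
    exact this.symm
  have hbt : A' t ≠ {b} := by
    intro h
    have h2 : A t = {b, b'} := by
      rw [Set.pair_comm, ← h, hAt, Set.insert_sdiff_singleton, Set.insert_eq_of_mem hb']
    rw [h2, Set.ncard_pair hne.symm] at hcard
    omega
  have hdisj : Disjoint {c | b - 1 ∈ X c} {c | b ∈ X c} := by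
    refine disjoint_of_symmDiff (hX.cover _) (hX.cover _)
      (hX.cut t {b} (Set.singleton_subset_iff.2 hbA') (Set.singleton_nonempty b) hbt.symm) ?_
    intro c hc
    have hc' : (boundary (X c) ∩ {b}).ncard = 1 := hc
    have : b ∈ boundary (X c) := by
      by_contra h
      rw [Set.inter_singleton_eq_empty.2 h, Set.ncard_empty] at hc'
      omega
    exact this
  have hbm : ∀ c, b ∈ X c → b - 1 ∉ X c := fun c h h' => Set.disjoint_left.1 hdisj h' h
  have hbbd : ∀ c, b ∈ X c → b ∈ boundary (X c) := by
    intro c h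
    have := hbm c h
    rw [mem_boundary]; tauto
  have hX1 : ∀ c, b ∉ X c → X c \ I = X c := by
    intro c hc
    rw [sdiff_eq_left, Set.disjoint_right]
    intro e he
    rwa [hconst c e he]
  -- removing the arc moves the boundary vertex `b` to `b'`, as no inner vertex is in the boundary
  have hbd2 : ∀ c, b ∈ X c → boundary (X c \ I) = insert b' (boundary (X c) \ {b}) := by
    intro c hc
    have h1 := hbm c hc
    have h2 := (hb'X c).2 hc
    ext v
    rw [Set.mem_insert_iff, Set.mem_sdiff, Set.mem_singleton_iff]
    by_cases hv1 : v = b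
    · subst hv1
      simp only [mem_boundary, Set.mem_sdiff]
      tauto
    by_cases hv2 : v = b'
    · subst hv2
      simp only [mem_boundary, Set.mem_sdiff]
      tauto
    have hvI : v ∉ boundary I := by rw [hbI]; simp [hv1, hv2]
    rw [mem_boundary, not_not] at hvI
    by_cases hvI' : v ∈ I
    · have hv3 : v ∉ boundary (X c) := by
        rw [mem_boundary, not_not, hconst c v hvI', hconst c (v - 1) (hvI.2 hvI')]
      have hv4 : v ∉ boundary (X c \ I) := by
        simp only [mem_boundary, Set.mem_sdiff]
        tauto
      tauto
    · simp only [mem_boundary, Set.mem_sdiff]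
      tauto
  let X' : γ ⊕ Bool → Set (ZMod n) := Sum.elim (fun c => X c \ I) (fun _ => I)
  have hcover : {c | b ∈ X c}.ncard = 2 := hX.cover b
  have hinr : (Sum.inr '' (Set.univ : Set Bool) : Set (γ ⊕ Bool)).ncard = 2 := by
    rw [Set.ncard_image_of_injective _ Sum.inr_injective, Set.ncard_univ]; simp
  have hdisjLR : ∀ (P : Set γ) (Q : Set Bool),
      Disjoint (Sum.inl '' P : Set (γ ⊕ Bool)) (Sum.inr '' Q) := by
    intro P Q
    rw [Set.disjoint_left]
    rintro _ ⟨c, _, rfl⟩ ⟨d, _, h⟩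
    cases h
  have hfour : ∀ (P : Set γ) (S : Set (γ ⊕ Bool)), 2 ≤ P.ncard →
      (∀ c ∈ P, Sum.inl c ∈ S) → (∀ i, Sum.inr i ∈ S) → 4 ≤ S.ncard := by
    intro P S hP h1 h2
    have h3 : (Sum.inl '' P ∪ Sum.inr '' Set.univ : Set (γ ⊕ Bool)) ⊆ S := by
      rintro _ (⟨c, hc, rfl⟩ | ⟨i, _, rfl⟩)
      · exact h1 c hc
      · exact h2 i
    have h4 := Set.ncard_le_ncard h3
    rw [Set.ncard_union_eq (hdisjLR _ _), hinr,
      Set.ncard_image_of_injective _ Sum.inl_injective] at h4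
    omega
  have htwo : ∀ c s, boundary (X' c) ∩ A s = ∅ ∨ (boundary (X' c) ∩ A s).ncard = 2 := by
    rintro (c | i) s
    · by_cases hs : s = t
      · subst hs
        have h1 := hX.two c s
        by_cases hc : b ∈ X c
        · right
          have h3 : boundary (X' (Sum.inl c)) ∩ A s
              = insert b' ((boundary (X c) ∩ A' s) \ {b}) := by
            change boundary (X c \ I) ∩ A s = _
            rw [hbd2 c hc, hAt, exchange_inter_of_mem (hb'bd c) hb']
          have h4 : b ∈ boundary (X c) ∩ A' s := ⟨hbbd c hc, hbA'⟩
          rw [h3, Set.ncard_exchange (fun h => hb'bd c h.1) h4]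
          rcases h1 with h1 | h1
          · rw [h1] at h4; exact h4.elim
          · exact h1
        · have h3 : boundary (X' (Sum.inl c)) ∩ A s = boundary (X c) ∩ A' s := by
            change boundary (X c \ I) ∩ A s = _
            rw [hX1 c hc, hAt, ← Set.inter_sdiff_assoc,
              Set.sdiff_singleton_eq_self fun h => hb'bd c h.1]
          rw [h3]; exact h1
      · have h3 : boundary (X' (Sum.inl c)) ∩ A s = boundary (X c) ∩ A' s := by
          change boundary (X c \ I) ∩ A s = _
          rw [hAs s hs]
          by_cases hc : b ∈ X c
          · rw [hbd2 c hc, exchange_inter_of_notMem (hnot s hs b hb) (hnot s hs b' hb')]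
          · rw [hX1 c hc]
        rw [h3]; exact hX.two c s
    · by_cases hs : s = t
      · subst hs
        right
        change (boundary I ∩ A s).ncard = 2
        rw [hbI, Set.inter_eq_left.2, Set.ncard_pair hne.symm]
        rintro x (rfl | rfl)
        exacts [hb, hb']
      · left
        change boundary I ∩ A s = ∅
        rw [hbI, Set.eq_empty_iff_forall_notMem]
        rintro x ⟨rfl | rfl, hx⟩
        exacts [hnot s hs _ hb hx, hnot s hs _ hb' hx]
  have hAA' : ∀ N : Set (ZMod n), b' ∉ boundary N →
      ∀ s, boundary N ∩ A s = boundary N ∩ A' s := by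
    intro N hN s
    by_cases hs : s = t
    · subst hs
      rw [hAt, ← Set.inter_sdiff_assoc, Set.sdiff_singleton_eq_self fun h => hN h.1]
    · rw [hAs s hs]
  have hcompat : ∀ c, b ∈ X c → ∀ Y : Set (ZMod n), boundary Y ∩ A t = ∅ →
      (∀ s, boundary Y ∩ A s = ∅ ∨ boundary Y ∩ A s = boundary (X c \ I) ∩ A s) →
      ∀ s, boundary Y ∩ A' s = ∅ ∨ boundary Y ∩ A' s = boundary (X c) ∩ A' s := by
    intro c hc Y h0 hY s
    by_cases hs : s = t
    · left
      subst hs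
      exact Set.eq_empty_of_subset_empty (h0 ▸ Set.inter_subset_inter_right _ (hA'sub _))
    · have h3 : boundary (X c \ I) ∩ A s = boundary (X c) ∩ A s := by
        rw [hbd2 c hc, exchange_inter_of_notMem (hnot s hs b hb) (hnot s hs b' hb')]
      rw [hAs s hs, ← h3]
      exact hY s
  have hgoodI : ∀ N : Set (ZMod n), boundary N = boundary I → N ≠ Set.univ → Good A N := by
    intro N hN hN1
    refine good_of t fun Y ⟨hYN, hbY, _⟩ h0 => ?_
    have : boundary Y = ∅ := by
      rw [← h0, Set.inter_eq_left.2]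
      refine hbY.trans ?_
      rw [hN, hbI]
      rintro x (rfl | rfl)
      exacts [hb, hb']
    rcases eq_empty_or_univ_of_boundary this with h | h
    · exact h
    · exact (hN1 (Set.univ_subset_iff.1 (h ▸ hYN))).elim
  refine ⟨X', ⟨fun e => ?_, ?_, ?_, htwo, ?_, ?_, ?_⟩⟩
  · by_cases he : e ∈ I
    · have : {c | e ∈ X' c} = Sum.inr '' Set.univ := by
        ext (c | i) <;> simp [X', he]
      rw [this, hinr]
    · have : {c | e ∈ X' c} = Sum.inl '' {c | e ∈ X c} := by
        ext (c | i) <;> simp [X', he]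
      rw [this, Set.ncard_image_of_injective _ Sum.inl_injective, hX.cover]
  · rintro (c | i)
    · have h1 : boundary (X c) ⊆ ⋃ s, A s := (hX.sub c).trans (Set.iUnion_mono hA'sub)
      change boundary (X c \ I) ⊆ _
      by_cases hc : b ∈ X c
      · rw [hbd2 c hc]
        exact Set.insert_subset (Set.mem_iUnion.2 ⟨t, hb'⟩) (Set.sdiff_subset.trans h1)
      · rwa [hX1 c hc]
    · change boundary I ⊆ _
      rw [hbI]
      rintro x (rfl | rfl)
      exacts [Set.mem_iUnion.2 ⟨t, hb⟩, Set.mem_iUnion.2 ⟨t, hb'⟩]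
  · rintro (c | i)
    · change (boundary (X c \ I)).Nonempty
      by_cases hc : b ∈ X c
      · rw [hbd2 c hc]; exact Set.insert_nonempty _ _
      · rw [hX1 c hc]; exact hX.ne c
    · change (boundary I).Nonempty
      rw [hbI]; exact Set.insert_nonempty _ _
  · intro s Z hZ hZ0 hZ1
    by_cases hs : s = t
    swap
    · rw [← hAs s hs] at hZ hZ1
      refine (hX.cut s Z hZ hZ0 hZ1).trans ?_
      rw [← Set.ncard_image_of_injective _ (Sum.inl_injective (β := Bool))]
      refine Set.ncard_le_ncard ?_ (Set.toFinite _)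
      rintro _ ⟨c, hc, rfl⟩
      change (boundary (X c \ I) ∩ Z).ncard = 1
      have h3 : boundary (X c \ I) ∩ Z = boundary (X c) ∩ Z := by
        rw [hAs s hs] at hZ
        by_cases hc : b ∈ X c
        · rw [hbd2 c hc, exchange_inter_of_notMem (fun h => hnot s hs b hb (hZ h))
            (fun h => hnot s hs b' hb' (hZ h))]
        · rw [hX1 c hc]
      rw [h3]; exact hc
    subst hs
    -- both new colours join `b` and `b'`, hence leave `Z` if `Z` separates `b` from `b'`
    have hcase : ∀ Z, Z ⊆ A s → b ∈ Z → b' ∉ Z →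
        4 ≤ {c | (boundary (X' c) ∩ Z).ncard = 1}.ncard := by
      intro Z hZ hbZ hb'Z
      have hinrZ : ∀ i, Sum.inr i ∈ {c | (boundary (X' c) ∩ Z).ncard = 1} := by
        intro i
        change (boundary I ∩ Z).ncard = 1
        have : boundary I ∩ Z = {b} := by
          rw [hbI]
          ext v
          simp only [Set.mem_inter_iff, Set.mem_insert_iff, Set.mem_singleton_iff]
          constructor
          · rintro ⟨rfl | rfl, h⟩
            · rfl
            · exact (hb'Z h).elim
          · rintro rfl
            exact ⟨Or.inl rfl, hbZ⟩
        rw [this, Set.ncard_singleton]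
      by_cases hZA : Z = A' s
      · refine hfour _ _ hcover.ge (fun c hc => ?_) hinrZ
        have hb'c : b' ∈ boundary (X' (Sum.inl c)) := by
          change b' ∈ boundary (X c \ I)
          rw [hbd2 c hc]; exact Set.mem_insert _ _
        rcases htwo (Sum.inl c) s with h | h
        · exact absurd (h ▸ ⟨hb'c, hb'⟩ : b' ∈ (∅ : Set (ZMod n))) (Set.notMem_empty _)
        · have hm : b' ∈ boundary (X' (Sum.inl c)) ∩ A s := ⟨hb'c, hb'⟩
          change (boundary (X' (Sum.inl c)) ∩ Z).ncard = 1
          rw [hZA, hAt, ← Set.inter_sdiff_assoc, Set.ncard_sdiff_singleton_of_mem hm, h]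
      · have hZ' : Z ⊆ A' s := by
          rw [hAt]
          exact fun x hx => ⟨hZ hx, fun h => hb'Z (h ▸ hx)⟩
        have h1 := hX.cut s Z hZ' ⟨b, hbZ⟩ hZA
        refine hfour ({c | (boundary (X c) ∩ Z).ncard = 1} \ {c | b ∈ X c}) _ ?_ ?_ hinrZ
        · have := Set.le_ncard_sdiff {c | b ∈ X c} {c | (boundary (X c) ∩ Z).ncard = 1}
          omega
        · rintro c ⟨hc, hc'⟩
          change (boundary (X c \ I) ∩ Z).ncard = 1
          rw [hX1 c hc']
          exact hc
    by_cases h1 : b ∈ Z <;> by_cases h2 : b' ∈ Z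
    rotate_left
    · exact hcase Z hZ h1 h2
    · have := hcase (A s \ Z) Set.sdiff_subset ⟨hb, h1⟩ (fun h => h.2 h2)
      simpa only [ncard_inter_diff_eq_one_iff (htwo _ s) hZ] using this
    -- `b` and `b'` on the same side: compare with the old cut obtained by deleting `b'`
    all_goals
      have h3 : 4 ≤ {c | (boundary (X c) ∩ (Z \ {b'})).ncard = 1}.ncard := by
        apply hX.cut s
        · rw [hAt]; exact Set.sdiff_subset_sdiff_left hZ
        · first
          | exact ⟨b, h1, fun h => hne h.symm⟩
          | rwa [Set.sdiff_singleton_eq_self h2]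
        · intro h
          have hbZ : b ∈ Z \ {b'} := h ▸ hbA'
          first
          | exact h1 hbZ.1
          | apply hZ1
            rw [← Set.insert_eq_of_mem h2, ← Set.insert_sdiff_singleton, h, hAt,
              Set.insert_sdiff_singleton, Set.insert_eq_of_mem hb']
      refine h3.trans ?_
      rw [← Set.ncard_image_of_injective _ (Sum.inl_injective (β := Bool))]
      refine Set.ncard_le_ncard ?_ (Set.toFinite _)
      rintro _ ⟨c, hc, rfl⟩
      change (boundary (X c \ I) ∩ Z).ncard = 1
      rw [← show _ = 1 from hc]
      by_cases hc' : b ∈ X c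
      · rw [hbd2 c hc']
        first
        | rw [exchange_inter_of_mem (hb'bd c) h2]
          exact Set.ncard_exchange (fun h => hb'bd c h.1) ⟨hbbd c hc', h1, fun h => hne h.symm⟩
        | rw [exchange_inter_of_notMem h1 h2, Set.sdiff_singleton_eq_self h2]
      · rw [hX1 c hc', ← Set.inter_sdiff_assoc, Set.sdiff_singleton_eq_self fun h => hb'bd c h.1]
  · rintro (c | i)
    · change Good A (X c \ I)
      by_cases hc : b ∈ X c
      swap
      · rw [hX1 c hc]
        exact (hX.good c).congr (hAA' _ (hb'bd c))
      refine good_of t fun Y ⟨hYN, hbY, hY⟩ h0 => ?_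
      have hb'Y : b' ∉ boundary Y := fun h => by
        have h1 : b' ∈ boundary Y ∩ A t := ⟨h, hb'⟩
        rw [h0] at h1
        exact h1
      have h1 : boundary Y ⊆ boundary (X c) := by
        intro v hv
        have := hbY hv
        rw [hbd2 c hc] at this
        rcases this with rfl | h
        · exact (hb'Y hv).elim
        · exact h.1
      rcases hX.good c Y ⟨hYN.trans Set.sdiff_subset, h1, hcompat c hc Y h0 hY⟩ with h | h
      · exact h
      · exact ((hYN (h ▸ hc)).2 hbI').elim
    · exact hgoodI I rfl (fun h => hb'I' (h ▸ trivial))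
  · rintro (c | i)
    · change Good A (X c \ I)ᶜ
      by_cases hc : b ∈ X c
      swap
      · rw [hX1 c hc]
        exact (hX.good_compl c).congr (hAA' _ (by rw [boundary_compl]; exact hb'bd c))
      refine good_of t fun Y ⟨hYN, hbY, hY⟩ h0 => ?_
      rw [boundary_compl] at hbY hY
      have hb'Y : b' ∉ boundary Y := fun h => by
        have h1 : b' ∈ boundary Y ∩ A t := ⟨h, hb'⟩
        rw [h0] at h1
        exact h1
      have h1 : boundary Y ⊆ boundary (X c) := by
        intro v hv
        have := hbY hv
        rw [hbd2 c hc] at this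
        rcases this with rfl | h
        · exact (hb'Y hv).elim
        · exact h.1
      -- `Y` misses the arc, as it misses the edge after `b'`, and `b'` is not in its boundary
      have h2 : b' ∉ Y := fun h => hYN h ⟨(hb'X c).2 hc, hb'I'⟩
      have h3 : b' - 1 ∉ Y := by
        rw [mem_boundary, not_not] at hb'Y
        rwa [hb'Y]
      have h4 : ∀ e ∈ I, e ∈ Y ↔ b ∈ Y := fun e he =>
        mem_iff_of_arcStart_eq hnt.nonempty
          (fun v hv h => hbdA' c v (fun s hs => hinner v hv s (hA'sub s hs)) (h1 h)) he
      have h5 : Y ⊆ (X c)ᶜ := by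
        intro e he hec
        have := hYN he
        have hnI : e ∉ I := fun heI => h3 ((h4 _ hb'I).2 ((h4 e heI).1 he))
        exact this ⟨hec, hnI⟩
      rcases hX.good_compl c Y ⟨h5, by rwa [boundary_compl], by
        rw [boundary_compl]; exact hcompat c hc Y h0 hY⟩ with h | h
      · exact h
      · exfalso
        have h6 : b ∈ boundary Y := by
          rw [h, boundary_compl]; exact hbbd c hc
        have h7 : b ∈ boundary Y ∩ A t := ⟨h6, hb⟩
        rw [h0] at h7
        exact h7
    · exact hgoodI Iᶜ (boundary_compl I) (fun h => (h ▸ Set.mem_univ b : b ∈ Iᶜ) hbI')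

end CycleBridges

/-! ### A set that crosses only one other set -/

namespace CycleBridges

variable {n : ℕ} [NeZero n] {ι : Type*}

/-- The `T`-th bridge crosses the `U`-th bridge and no other: every arc of `A T` contains a point of
`A U`, and each other `A s` lies inside one arc of `A T`. The family `A'` is obtained from `A` by
emptying `A T`, and `σ` is the cyclic successor on `A T`. -/
structure CrossesOnly (A A' : ι → Set (ZMod n)) (T U : ι) (σ : Equiv.Perm (A T)) : Prop where
  disj : Pairwise fun s s' => Disjoint (A s) (A s')
  next : IsNext (A T) σ
  nontrivial : (A T).Nontrivial
  ne : U ≠ T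
  meets : ∀ d : A T, (A U ∩ arcInner (A T) d).Nonempty
  other : ∀ s, s ≠ T → s ≠ U → ∃ d : A T, ∀ x ∈ A s, arcStart (A T) x = d
  old_self : A' T = ∅
  old_of_ne : ∀ s, s ≠ T → A' s = A s

namespace CrossesOnly

variable {A A' : ι → Set (ZMod n)} {T U : ι} {σ : Equiv.Perm (A T)}

section
variable (h : CrossesOnly A A' T U σ)
include h

omit [NeZero n] in
lemma old_subset (s : ι) : A' s ⊆ A s := by
  by_cases hs : s = T
  · rw [hs, h.old_self]; exact Set.empty_subset _
  · rw [h.old_of_ne s hs]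

omit [NeZero n] in
lemma notMem_old {v : ZMod n} (hv : v ∈ A T) (s : ι) : v ∉ A' s := by
  by_cases hs : s = T
  · rw [hs, h.old_self]; exact Set.notMem_empty _
  · rw [h.old_of_ne s hs]
    exact fun hv' => Set.disjoint_left.1 (h.disj hs) hv' hv

omit [NeZero n] in
lemma mem_arcInner {s : ι} (hs : s ≠ T) {x : ZMod n} (hx : x ∈ A s) {d : ZMod n}
    (hd : arcStart (A T) x = d) : x ∈ arcInner (A T) d :=
  ⟨fun hT => Set.disjoint_left.1 (h.disj hs) hx hT, hd⟩

/-- Inside an arc of `A T`, the bridges other than `T` and `U` have all or none of their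
attachments, so they do not contribute to the parity in `IsNext.even_ncard`. -/
lemma even_ncard_iff [Finite ι] {Y : Set (ZMod n)} (hY : boundary Y ⊆ ⋃ s, A s)
    (hY2 : ∀ s, boundary Y ∩ A s = ∅ ∨ (boundary Y ∩ A s).ncard = 2) (d : A T) :
    Even (boundary Y ∩ (A U ∩ arcInner (A T) d)).ncard ↔
      ((d : ZMod n) ∈ Y ↔ (σ d : ZMod n) - 1 ∈ Y) := by
  classical
  have := Fintype.ofFinite ι
  rw [← h.next.even_ncard Y d]
  let F : ι → Finset (ZMod n) := fun s =>
    (Set.toFinite (boundary Y ∩ (A s ∩ arcInner (A T) d))).toFinset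
  have hF : boundary Y ∩ arcInner (A T) d =
      ((Finset.univ.biUnion F : Finset _) : Set (ZMod n)) := by
    ext v
    simp only [Set.mem_inter_iff, Finset.coe_biUnion, Set.mem_iUnion, F, Set.Finite.coe_toFinset,
      Finset.mem_coe, Finset.mem_univ, exists_prop, true_and]
    constructor
    · rintro ⟨h1, h2⟩
      obtain ⟨s, hs⟩ := Set.mem_iUnion.1 (hY h1)
      exact ⟨s, h1, hs, h2⟩
    · rintro ⟨s, h1, h2, h3⟩
      exact ⟨h1, h3⟩
  have hcard : (boundary Y ∩ arcInner (A T) d).ncard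
      = ∑ s, (boundary Y ∩ (A s ∩ arcInner (A T) d)).ncard := by
    rw [hF, Set.ncard_coe_finset, Finset.card_biUnion]
    · refine Finset.sum_congr rfl fun s _ => ?_
      rw [Set.ncard_eq_toFinset_card _ (Set.toFinite _)]
    · intro s _ s' _ hss'
      rw [Function.onFun, Finset.disjoint_left]
      intro x hx hx'
      simp only [F, Set.Finite.mem_toFinset] at hx hx'
      exact Set.disjoint_left.1 (h.disj hss') hx.2.1 hx'.2.1
  rw [hcard, ← Finset.add_sum_erase _ _ (Finset.mem_univ U), Nat.even_add]
  have : Even (∑ s ∈ Finset.univ.erase U, (boundary Y ∩ (A s ∩ arcInner (A T) d)).ncard) := by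
    refine Finset.even_sum _ fun s hs => ?_
    have hsU : s ≠ U := Finset.ne_of_mem_erase hs
    by_cases hsT : s = T
    · have : A s ∩ arcInner (A T) d = ∅ := by
        rw [hsT, Set.eq_empty_iff_forall_notMem]
        exact fun x hx => hx.2.1 hx.1
      rw [this, Set.inter_empty, Set.ncard_empty]
      exact Even.zero
    · obtain ⟨d', hd'⟩ := h.other s hsT hsU
      by_cases hdd : d' = d
      · have : A s ∩ arcInner (A T) d = A s :=
          Set.inter_eq_left.2 fun x hx => h.mem_arcInner hsT hx (hdd ▸ hd' x hx)
        rw [this]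
        rcases hY2 s with h0 | h0 <;> rw [h0]
        · rw [Set.ncard_empty]; exact Even.zero
        · exact even_two
      · have : A s ∩ arcInner (A T) d = ∅ := by
          rw [Set.eq_empty_iff_forall_notMem]
          intro x hx
          exact hdd (Subtype.ext ((hd' x hx.1).symm.trans hx.2.2))
        rw [this, Set.inter_empty, Set.ncard_empty]
        exact Even.zero
  tauto

/-- A set without edges in an arc has no boundary inside it. -/
lemma notMem_boundary_of_forall {Y : Set (ZMod n)} {d v : ZMod n} (hv : v ∈ arcInner (A T) d)
    (hY : ∀ e, arcStart (A T) e = d → e ∉ Y) : v ∉ boundary Y := by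
  have := arcInner_congr (Y := ∅) hv h.nontrivial.nonempty
    fun e he => iff_of_false (hY e he) (Set.notMem_empty _)
  rw [this, boundary_empty]
  exact Set.notMem_empty _

/-- A criterion for compatibility, with the old family, of a set of edges within one arc. -/
lemma compatible_piece {Q Y : Set (ZMod n)} (d : A T)
    (hYd : ∀ x ∈ Y, arcStart (A T) x = d) (hYQ : Y ⊆ Q)
    (hd : (d : ZMod n) ∉ Y) (hd' : (σ d : ZMod n) - 1 ∉ Y)
    (hbd : ∀ v ∈ arcInner (A T) d, v ∈ boundary Y → v ∈ boundary Q)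
    (hU : boundary Y ∩ A U = ∅)
    (hs : ∀ s, s ≠ T → s ≠ U → (∀ x ∈ A s, arcStart (A T) x = d) →
      boundary Y ∩ A s = ∅ ∨ boundary Y ∩ A s = boundary Q ∩ A s) : Compatible A' Q Y := by
  have hB : (A T).Nonempty := h.nontrivial.nonempty
  have hY : ∀ v ∈ boundary Y, v ∈ arcInner (A T) d := by
    intro v hv
    by_cases hvT : v ∈ A T
    · exfalso
      have h1 : v ∉ Y := by
        intro hvY
        have := hYd v hvY
        rw [arcStart_self hvT] at this
        exact hd (this ▸ hvY)
      have h2 : v - 1 ∉ Y := by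
        intro hvY
        have h3 := hYd _ hvY
        have h4 := h.next.arcStart_sub_one ⟨v, hvT⟩
        rw [h3] at h4
        have h5 : d = σ.symm ⟨v, hvT⟩ := Subtype.ext h4
        rw [h5, Equiv.apply_symm_apply] at hd'
        exact hd' hvY
      exact hv (iff_of_false h2 h1)
    · by_contra hvd
      refine h.notMem_boundary_of_forall (d := arcStart (A T) v) ⟨hvT, rfl⟩ (fun e he heY => ?_) hv
      exact hvd ⟨hvT, he ▸ hYd e heY⟩
  refine ⟨hYQ, fun v hv => hbd v (hY v hv) hv, fun s => ?_⟩
  by_cases hsT : s = T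
  · left; rw [hsT, h.old_self, Set.inter_empty]
  rw [h.old_of_ne s hsT]
  by_cases hsU : s = U
  · left; rw [hsU, hU]
  obtain ⟨d', hd'⟩ := h.other s hsT hsU
  by_cases hdd : d' = d
  · exact hs s hsT hsU (hdd ▸ hd')
  · left
    rw [Set.eq_empty_iff_forall_notMem]
    rintro x ⟨hx, hxs⟩
    exact hdd (Subtype.ext ((hd' x hxs).symm.trans (hY x hx).2))

/-- A set `N` is good if its boundary contains two consecutive points `b`, `σ b` of `A T` and one
point of `A U` between them, and if on each arc of `A T` it either has no boundary, or agrees with a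
set that is good for the old family and has a boundary point of `A U` there. A component that avoids
the `T`-th bridge also avoids the `U`-th by the parity on the arc between `b` and `σ b`. It then
contains no edge at a point of `A T`, so on each arc it is a component of the old subgraph that
misses `A U`. -/
lemma good_of_arcs [Finite ι] {N : Set (ZMod n)} (hN : boundary N ⊆ ⋃ s, A s)
    (hN2 : ∀ s, boundary N ∩ A s = ∅ ∨ (boundary N ∩ A s).ncard = 2)
    (b : A T) (hb : (b : ZMod n) ∈ boundary N) (hb' : (σ b : ZMod n) ∈ boundary N)
    (hbU : (boundary N ∩ (A U ∩ arcInner (A T) b)).ncard = 1)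
    (hQ : ∀ d : A T, (∀ v ∈ arcInner (A T) d, v ∉ boundary N) ∨
      ∃ Q, Good A' Q ∧ (∀ x, arcStart (A T) x = d → (x ∈ N ↔ x ∈ Q)) ∧
        (boundary Q ∩ (A U ∩ arcInner (A T) d)).Nonempty) : Good A N := by
  have hB : (A T).Nonempty := h.nontrivial.nonempty
  refine good_of T fun Y ⟨hYN, hbY, hY⟩ h0 => ?_
  have hT : ∀ d : A T, (d : ZMod n) - 1 ∈ Y ↔ (d : ZMod n) ∈ Y := by
    intro d
    by_contra hd
    have : (d : ZMod n) ∈ boundary Y ∩ A T := ⟨hd, d.2⟩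
    rw [h0] at this
    exact this
  have hNb : ∀ d : A T, (d : ZMod n) ∈ boundary N → (d : ZMod n) ∉ Y := by
    intro d hd hdY
    exact hd (iff_of_true (hYN ((hT d).2 hdY)) (hYN hdY))
  have hYs : boundary Y ⊆ ⋃ s, A s := hbY.trans hN
  have hY2 : ∀ s, boundary Y ∩ A s = ∅ ∨ (boundary Y ∩ A s).ncard = 2 := by
    intro s
    rcases hY s with h1 | h1
    · exact Or.inl h1
    · rw [h1]; exact hN2 s
  have hpar := h.even_ncard_iff hYs hY2
  have hYU : boundary Y ∩ A U = ∅ := by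
    rcases hY U with h1 | h1
    · exact h1
    · exfalso
      have h2 : boundary Y ∩ (A U ∩ arcInner (A T) b) = boundary N ∩ (A U ∩ arcInner (A T) b) := by
        rw [← Set.inter_assoc, h1, Set.inter_assoc]
      have h3 := (hpar b).2 (iff_of_false (hNb b hb) (fun h3 => hNb _ hb' ((hT _).1 h3)))
      rw [h2, hbU] at h3
      exact absurd h3 (by decide)
  have hYd : ∀ d : A T, (d : ZMod n) ∈ Y ↔ (σ d : ZMod n) ∈ Y := by
    intro d
    rw [← hT (σ d), ← hpar d, ← Set.inter_assoc, hYU, Set.empty_inter, Set.ncard_empty]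
    exact Even.zero
  have hYd0 : ∀ d : A T, (d : ZMod n) ∉ Y := by
    intro d hd
    have := h.next.eq_univ (Z := {d | (d : ZMod n) ∈ Y}) ⟨d, hd⟩ hYd
    have h1 : b ∈ {d : A T | (d : ZMod n) ∈ Y} := by rw [this]; trivial
    exact hNb b hb h1
  rw [Set.eq_empty_iff_forall_notMem]
  intro x hx
  set d : A T := ⟨arcStart (A T) x, arcStart_mem hB x⟩
  rcases hQ d with h1 | ⟨Q, hQ, hNQ, hQU⟩
  · have := mem_iff_of_arcStart_eq (X := Y) hB (d := d) (fun v hv hv' => h1 v hv (hbY hv'))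
      (e := x) rfl
    exact hYd0 d (this.1 hx)
  · set Z : Set (ZMod n) := {e | e ∈ Y ∧ arcStart (A T) e = d}
    have hZY : ∀ e, arcStart (A T) e = d → (e ∈ Z ↔ e ∈ Y) := fun e he => by simp [Z, he]
    have hZb : ∀ v ∈ arcInner (A T) d, v ∈ boundary Z ↔ v ∈ boundary Y :=
      fun v hv => arcInner_congr hv hB hZY
    have hNQb : ∀ v ∈ arcInner (A T) d, v ∈ boundary N ↔ v ∈ boundary Q :=
      fun v hv => arcInner_congr hv hB hNQ
    have hZU : boundary Z ∩ A U = ∅ := by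
      rw [Set.eq_empty_iff_forall_notMem]
      rintro v ⟨hv, hvU⟩
      have hvT : v ∉ A T := fun hvT => Set.disjoint_left.1 (h.disj h.ne) hvU hvT
      by_cases hvd : arcStart (A T) v = d
      · have : v ∈ boundary Y ∩ A U := ⟨(hZb v ⟨hvT, hvd⟩).1 hv, hvU⟩
        rw [hYU] at this
        exact this
      · refine h.notMem_boundary_of_forall (d := arcStart (A T) v) ⟨hvT, rfl⟩
          (fun e he heY => ?_) hv
        exact hvd (he ▸ heY.2)
    have hcomp : Compatible A' Q Z := by
      refine h.compatible_piece d (fun e he => he.2) (fun e he => (hNQ e he.2).1 (hYN he.1))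
        (fun hd => hYd0 d hd.1) (fun hd => hYd0 (σ d) ((hT _).1 hd.1))
        (fun v hv hvZ => (hNQb v hv).1 (hbY ((hZb v hv).1 hvZ))) hZU ?_
      intro s hsT hsU hsd
      have e1 : boundary Z ∩ A s = boundary Y ∩ A s := by
        ext v
        exact and_congr_left fun hv => hZb v (h.mem_arcInner hsT hv (hsd v hv))
      have e2 : boundary Q ∩ A s = boundary N ∩ A s := by
        ext v
        exact and_congr_left fun hv => (hNQb v (h.mem_arcInner hsT hv (hsd v hv))).symm
      rw [e1, e2]
      exact hY s
    rcases hQ Z hcomp with h2 | h2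
    · have : x ∈ Z := ⟨hx, rfl⟩
      rw [h2] at this
      exact this
    · obtain ⟨v, hv, hvU, _⟩ := hQU
      have : v ∈ boundary Z ∩ A U := ⟨h2 ▸ hv, hvU⟩
      rw [hZU] at this
      exact this

end

end CrossesOnly

end CycleBridges

/-! ### Recolouring -/

namespace CycleBridges

variable {n : ℕ} [NeZero n] {ι : Type*}

namespace CrossesOnly

variable {A A' : ι → Set (ZMod n)} {T U : ι} {σ : Equiv.Perm (A T)}
variable {γ : Type} [Finite γ] {X : γ → Set (ZMod n)}

section
variable (h : CrossesOnly A A' T U σ) (hX : DoubleFamily A' X)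
include h hX

omit [NeZero n] in
/-- As `A' T` is empty, a colour contains both edges of the cycle at a point of `A T`, or none. -/
lemma sub_one_mem_iff (c : γ) (d : A T) : (d : ZMod n) - 1 ∈ X c ↔ (d : ZMod n) ∈ X c := by
  by_contra hd
  obtain ⟨s, hs⟩ := Set.mem_iUnion.1 (hX.sub c hd)
  exact h.notMem_old d.2 s hs

omit [NeZero n] in
lemma boundary_inter_self (c : γ) : boundary (X c) ∩ A T = ∅ := by
  rw [Set.eq_empty_iff_forall_notMem]
  rintro v ⟨hv, hvT⟩
  exact hv (h.sub_one_mem_iff hX c ⟨v, hvT⟩)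

omit [NeZero n] in
lemma boundary_inter_eq (c : γ) (s : ι) : boundary (X c) ∩ A s = boundary (X c) ∩ A' s := by
  by_cases hs : s = T
  · rw [hs, h.boundary_inter_self hX, h.old_self, Set.inter_empty]
  · rw [h.old_of_ne s hs]

omit [NeZero n] in
lemma old_two (c : γ) (s : ι) :
    boundary (X c) ∩ A s = ∅ ∨ (boundary (X c) ∩ A s).ncard = 2 := by
  rw [h.boundary_inter_eq hX]
  exact hX.two c s

omit [NeZero n] in
lemma old_sub (c : γ) : boundary (X c) ⊆ ⋃ s, A s :=
  (hX.sub c).trans (Set.iUnion_mono h.old_subset)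

/-- A colour has a single boundary point of `A U` inside an arc of `A T` if and only if it is
present at exactly one end of the arc. -/
lemma ncard_eq_one_iff [Finite ι] (c : γ) (d : A T) :
    (boundary (X c) ∩ (A U ∩ arcInner (A T) d)).ncard = 1 ↔
      ¬((d : ZMod n) ∈ X c ↔ (σ d : ZMod n) ∈ X c) := by
  rw [← h.sub_one_mem_iff hX c (σ d), ← h.even_ncard_iff (h.old_sub hX c) (h.old_two hX c) d]
  have h1 : (boundary (X c) ∩ (A U ∩ arcInner (A T) d)).ncard ≤ (boundary (X c) ∩ A U).ncard :=
    Set.ncard_le_ncard (Set.inter_subset_inter_right _ Set.inter_subset_left) (Set.toFinite _)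
  have h2 : (boundary (X c) ∩ A U).ncard ≤ 2 := by
    rcases h.old_two hX c U with h3 | h3 <;> rw [h3]
    simp
  constructor
  · intro h3; rw [h3]; decide
  · intro h3
    have h4 := h1.trans h2
    interval_cases (boundary (X c) ∩ (A U ∩ arcInner (A T) d)).ncard
    · exact absurd Even.zero h3
    · rfl
    · exact absurd even_two h3

omit hX in
lemma inter_ne (d : A T) : A U ∩ arcInner (A T) d ≠ A U := by
  intro h0
  obtain ⟨x, hxU, hx⟩ := h.meets (σ d)
  rw [← h0] at hxU
  have : σ d = d := Subtype.ext (hx.2.symm.trans hxU.2.2)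
  exact h.next.ne_self h.nontrivial d this

omit h hX [NeZero n] in
lemma inter_disjoint {d e : A T} (hde : d ≠ e) :
    Disjoint (A U ∩ arcInner (A T) d) (A U ∩ arcInner (A T) e) := by
  rw [Set.disjoint_left]
  intro x hx hx'
  exact hde (Subtype.ext (hx.2.2.symm.trans hx'.2.2))

omit [NeZero n] in
lemma four_le_cut {Z : Set (ZMod n)} (hZU : Z ⊆ A U) (hZ0 : Z.Nonempty) (hZ : Z ≠ A U) :
    4 ≤ {c | (boundary (X c) ∩ Z).ncard = 1}.ncard := by
  have hU := h.old_of_ne U h.ne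
  exact hX.cut U Z (hU ▸ hZU) hZ0 (hU ▸ hZ)

/-- By the cut condition for the points of `A U` in one arc, the two colours at the start of the arc
are different from the two at its end. -/
lemma disjoint_next [Finite ι] (c : γ) (d : A T) (hc : (d : ZMod n) ∈ X c) :
    (σ d : ZMod n) ∉ X c := by
  have := disjoint_of_symmDiff (P := {c | (d : ZMod n) ∈ X c}) (Q := {c | (σ d : ZMod n) ∈ X c})
    (hX.cover _) (hX.cover _)
    (h.four_le_cut hX (Z := A U ∩ arcInner (A T) d) Set.inter_subset_left (h.meets d)
      (h.inter_ne d))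
    (fun c hc => (h.ncard_eq_one_iff hX c d).1 hc)
  exact fun hc' => Set.disjoint_left.1 this hc hc'

/-- Both boundary points in `A U` of a colour at `d ∈ A T` lie in the two arcs incident with `d`. -/
lemma inter_eq_empty [Finite ι] {c : γ} {d e : A T} (hc : (d : ZMod n) ∈ X c) (hed : e ≠ d)
    (hed' : σ e ≠ d) : boundary (X c) ∩ (A U ∩ arcInner (A T) e) = ∅ := by
  obtain ⟨d', rfl⟩ := σ.surjective d
  have h1 : (d' : ZMod n) ∉ X c := fun h1 => h.disjoint_next hX c d' h1 hc
  have h2 := h.disjoint_next hX c _ hc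
  have h3 := (h.ncard_eq_one_iff hX c d').2 (by tauto)
  have h4 := (h.ncard_eq_one_iff hX c (σ d')).2 (by tauto)
  have hne : d' ≠ σ d' := fun h0 => h.next.ne_self h.nontrivial d' h0.symm
  have hed'' : e ≠ d' := fun h0 => hed' (by rw [h0])
  have h5 : (boundary (X c) ∩ (A U ∩ arcInner (A T) d')) ∪
      (boundary (X c) ∩ (A U ∩ arcInner (A T) (σ d'))) = boundary (X c) ∩ A U := by
    apply Set.eq_of_subset_of_ncard_le
    · exact Set.union_subset (Set.inter_subset_inter_right _ Set.inter_subset_left)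
        (Set.inter_subset_inter_right _ Set.inter_subset_left)
    · rw [Set.ncard_union_eq
        ((inter_disjoint hne).mono Set.inter_subset_right Set.inter_subset_right) (Set.toFinite _)
        (Set.toFinite _), h3, h4]
      rcases h.old_two hX c U with h6 | h6 <;> rw [h6]
      simp
    · exact Set.toFinite _
  rw [Set.eq_empty_iff_forall_notMem]
  rintro x ⟨hx, hxU, hxe⟩
  have h6 : x ∈ boundary (X c) ∩ A U := ⟨hx, hxU⟩
  rw [← h5] at h6
  rcases h6 with h6 | h6
  · exact Set.disjoint_left.1 (inter_disjoint hed'') ⟨hxU, hxe⟩ h6.2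
  · exact Set.disjoint_left.1 (inter_disjoint hed) ⟨hxU, hxe⟩ h6.2

/-- Each colour is present at one point of `A T` at most. -/
lemma eq_of_mem [Finite ι] {c : γ} {d e : A T} (hc : (d : ZMod n) ∈ X c)
    (hc' : (e : ZMod n) ∈ X c) : d = e := by
  by_contra hde
  have h1 : σ e ≠ d := by
    rintro rfl
    exact h.disjoint_next hX c e hc' hc
  have h2 := h.inter_eq_empty hX hc (Ne.symm hde) h1
  have h3 := (h.ncard_eq_one_iff hX c e).2 (by have := h.disjoint_next hX c e hc'; tauto)
  rw [h2] at h3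
  simp at h3

/-- A colour that is present at `d ∈ A T` uses edges of the two arcs incident with `d` only:
anything else would be a component of its own. -/
lemma notMem_of_arcStart [Finite ι] {c : γ} {d e : A T} (hc : (d : ZMod n) ∈ X c) (hed : e ≠ d)
    (hed' : σ e ≠ d) {x : ZMod n} (hx : arcStart (A T) x = e) : x ∉ X c := by
  intro hxc
  have hB : (A T).Nonempty := h.nontrivial.nonempty
  set Y : Set (ZMod n) := {x | x ∈ X c ∧ arcStart (A T) x = e}
  have hYX : ∀ x, arcStart (A T) x = e → (x ∈ Y ↔ x ∈ X c) := fun x hx => by simp [Y, hx]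
  have hYb : ∀ v ∈ arcInner (A T) e, v ∈ boundary Y ↔ v ∈ boundary (X c) :=
    fun v hv => arcInner_congr hv hB hYX
  have hcomp : Compatible A' (X c) Y := by
    refine h.compatible_piece e (fun x hx => hx.2) (fun x hx => hx.1)
      (fun h1 => hed (h.eq_of_mem hX h1.1 hc)) (fun h1 => hed' (h.eq_of_mem hX
        ((h.sub_one_mem_iff hX c (σ e)).1 h1.1) hc)) (fun v hv => (hYb v hv).1) ?_ ?_
    · rw [Set.eq_empty_iff_forall_notMem]
      rintro v ⟨hv, hvU⟩
      have hvT : v ∉ A T := fun hvT => Set.disjoint_left.1 (h.disj h.ne) hvU hvT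
      by_cases hve : arcStart (A T) v = e
      · have : v ∈ boundary (X c) ∩ (A U ∩ arcInner (A T) e) :=
          ⟨(hYb v ⟨hvT, hve⟩).1 hv, hvU, hvT, hve⟩
        rw [h.inter_eq_empty hX hc hed hed'] at this
        exact this
      · refine h.notMem_boundary_of_forall (d := arcStart (A T) v) ⟨hvT, rfl⟩
          (fun y hy hyY => ?_) hv
        exact hve (hy ▸ hyY.2)
    · intro s hsT hsU hse
      right
      ext v
      exact and_congr_left fun hv => hYb v (h.mem_arcInner hsT hv (hse v hv))
  rcases hX.good c Y hcomp with h1 | h1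
  · have : x ∈ Y := ⟨hxc, hx⟩
    rw [h1] at this
    exact this
  · have : (d : ZMod n) ∈ Y := h1 ▸ hc
    have h2 := this.2
    rw [arcStart_self d.2] at h2
    exact hed (Subtype.ext h2.symm)

omit h [NeZero n] in
lemma exists_pairs : ∃ p p' : A T → γ, (∀ d, p d ≠ p' d) ∧
    ∀ (d : A T) (c : γ), (d : ZMod n) ∈ X c ↔ c = p d ∨ c = p' d := by
  have : ∀ d : A T, ∃ x y, x ≠ y ∧ {c | (d : ZMod n) ∈ X c} = {x, y} := fun d =>
    Set.ncard_eq_two.1 (hX.cover d)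
  choose p p' h1 h2 using this
  exact ⟨p, p', h1, fun d c => by
    have := Set.ext_iff.1 (h2 d) c
    simpa using this⟩

end

/-- The arc that carries the first piece of the new colour `ν` in `recolor`. -/
def fstArc (σ : Equiv.Perm (A T)) (ν : A T × Bool) : A T := if ν.2 then σ.symm ν.1 else ν.1

/-- The arc of the second piece of the new colour `ν` in `recolor`; it follows the first arc. -/
def sndArc (σ : Equiv.Perm (A T)) (ν : A T × Bool) : A T := if ν.2 then ν.1 else σ ν.1

/-- The new family in the step that adds a bridge `T` crossing `U` only, where `p d` and `p' d` are
the two old colours at `d ∈ A T`. Old colours that are absent at all points of `A T` are kept. Each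
other old colour lives on the two arcs at one point of `A T` and is cut there into two pieces. The
pieces are recombined: each `b ∈ A T` yields two new colours, both with boundary `{b, σ b}` on
`A T`. The new colour `(b, false)` consists of the pieces of `p b` and `p' (σ b)` that follow `b`
and `σ b`, and `(b, true)` of the pieces that precede them. -/
def recolor (σ : Equiv.Perm (A T)) (X : γ → Set (ZMod n)) (p p' : A T → γ) :
    {c : γ // ∀ d : A T, (d : ZMod n) ∉ X c} ⊕ (A T × Bool) → Set (ZMod n)
  | .inl c => X c
  | .inr ν =>
    {e | (arcStart (A T) e = fstArc σ ν ∧ e ∈ X (p ν.1)) ∨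
      (arcStart (A T) e = sndArc σ ν ∧ e ∈ X (p' (σ ν.1)))}

omit [NeZero n] in
lemma next_fstArc (σ : Equiv.Perm (A T)) (ν : A T × Bool) : σ (fstArc σ ν) = sndArc σ ν := by
  rcases ν with ⟨b, s⟩
  cases s <;> simp [fstArc, sndArc]

omit [NeZero n] in
lemma fstArc_or (σ : Equiv.Perm (A T)) (ν : A T × Bool) :
    fstArc σ ν = ν.1 ∨ σ (fstArc σ ν) = ν.1 := by
  rcases ν with ⟨b, s⟩
  cases s <;> simp [fstArc]

omit [NeZero n] in
lemma sndArc_or (σ : Equiv.Perm (A T)) (ν : A T × Bool) :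
    sndArc σ ν = σ ν.1 ∨ σ (sndArc σ ν) = σ ν.1 := by
  rcases ν with ⟨b, s⟩
  cases s <;> simp [sndArc]

lemma boundary_inter_congr {B Y Y' Z : Set (ZMod n)} (hB : B.Nonempty) {d : ZMod n}
    (h : ∀ e, arcStart B e = d → (e ∈ Y ↔ e ∈ Y')) (hZ : Z ⊆ arcInner B d) :
    boundary Y ∩ Z = boundary Y' ∩ Z := by
  ext v
  exact and_congr_left fun hv => arcInner_congr (hZ hv) hB h

section
variable (h : CrossesOnly A A' T U σ)
include h

lemma fstArc_ne (ν : A T × Bool) : fstArc σ ν ≠ sndArc σ ν := by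
  rw [← next_fstArc]
  exact (h.next.ne_self h.nontrivial _).symm

omit [Finite γ] in
lemma mem_recolor_fst {p p' : A T → γ} {ν : A T × Bool} {e : ZMod n}
    (he : arcStart (A T) e = fstArc σ ν) :
    e ∈ recolor σ X p p' (.inr ν) ↔ e ∈ X (p ν.1) := by
  have := h.fstArc_ne ν
  simp [recolor, he, Subtype.coe_inj, this]

omit [Finite γ] in
lemma mem_recolor_snd {p p' : A T → γ} {ν : A T × Bool} {e : ZMod n}
    (he : arcStart (A T) e = sndArc σ ν) :
    e ∈ recolor σ X p p' (.inr ν) ↔ e ∈ X (p' (σ ν.1)) := by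
  have := (h.fstArc_ne ν).symm
  simp [recolor, he, Subtype.coe_inj, this]

omit h [NeZero n] [Finite γ] in
lemma notMem_recolor {p p' : A T → γ} {ν : A T × Bool} {d : A T} {e : ZMod n}
    (he : arcStart (A T) e = d) (h1 : d ≠ fstArc σ ν) (h2 : d ≠ sndArc σ ν) :
    e ∉ recolor σ X p p' (.inr ν) := by
  simp [recolor, he, Subtype.coe_inj, h1, h2]

variable (hX : DoubleFamily A' X)
include hX

lemma ncard_eq_one [Finite ι] {c : γ} {d e : A T} (hc : (d : ZMod n) ∈ X c)
    (he : e = d ∨ σ e = d) : (boundary (X c) ∩ (A U ∩ arcInner (A T) e)).ncard = 1 := by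
  rw [h.ncard_eq_one_iff hX]
  rcases he with rfl | rfl
  · have := h.disjoint_next hX c _ hc
    tauto
  · have := fun h1 => h.disjoint_next hX c e h1 hc
    tauto

variable {p p' : A T → γ} (hne : ∀ d, p d ≠ p' d)
  (hp : ∀ (d : A T) (c : γ), (d : ZMod n) ∈ X c ↔ c = p d ∨ c = p' d)
include hp

lemma mem_p (d e : A T) [Finite ι] : (e : ZMod n) ∈ X (p d) ↔ e = d := by
  have h1 : (d : ZMod n) ∈ X (p d) := (hp d _).2 (Or.inl rfl)
  constructor
  · exact fun h2 => h.eq_of_mem hX h2 h1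
  · rintro rfl; exact h1

lemma mem_p' (d e : A T) [Finite ι] : (e : ZMod n) ∈ X (p' d) ↔ e = d := by
  have h1 : (d : ZMod n) ∈ X (p' d) := (hp d _).2 (Or.inr rfl)
  constructor
  · exact fun h2 => h.eq_of_mem hX h2 h1
  · rintro rfl; exact h1

lemma recolor_ncard_fst [Finite ι] (ν : A T × Bool) :
    (boundary (recolor σ X p p' (.inr ν)) ∩ (A U ∩ arcInner (A T) (fstArc σ ν))).ncard = 1 := by
  rw [boundary_inter_congr h.nontrivial.nonempty (fun e he => h.mem_recolor_fst he)
    Set.inter_subset_right]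
  exact h.ncard_eq_one hX ((h.mem_p hX hp _ _).2 rfl) (fstArc_or σ ν)

lemma recolor_ncard_snd [Finite ι] (ν : A T × Bool) :
    (boundary (recolor σ X p p' (.inr ν)) ∩ (A U ∩ arcInner (A T) (sndArc σ ν))).ncard = 1 := by
  rw [boundary_inter_congr h.nontrivial.nonempty (fun e he => h.mem_recolor_snd he)
    Set.inter_subset_right]
  exact h.ncard_eq_one hX ((h.mem_p' hX hp _ _).2 rfl) (sndArc_or σ ν)

lemma recolor_boundary_self [Finite ι] (ν : A T × Bool) :
    boundary (recolor σ X p p' (.inr ν)) ∩ A T = {(ν.1 : ZMod n), (σ ν.1 : ZMod n)} := by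
  have key : ∀ v : A T, (v : ZMod n) ∈ boundary (recolor σ X p p' (.inr ν)) ↔
      v = ν.1 ∨ v = σ ν.1 := by
    intro v
    have e1 : (v : ZMod n) ∈ recolor σ X p p' (.inr ν) ↔
        (v = fstArc σ ν ∧ v = ν.1) ∨ (v = sndArc σ ν ∧ v = σ ν.1) := by
      simp only [recolor, Set.mem_ofPred_eq, arcStart_self v.2, Subtype.coe_inj,
        h.mem_p hX hp, h.mem_p' hX hp]
    have e2 : (v : ZMod n) - 1 ∈ recolor σ X p p' (.inr ν) ↔
        (σ.symm v = fstArc σ ν ∧ v = ν.1) ∨ (σ.symm v = sndArc σ ν ∧ v = σ ν.1) := by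
      simp only [recolor, Set.mem_ofPred_eq, h.next.arcStart_sub_one, Subtype.coe_inj,
        h.mem_p hX hp, h.mem_p' hX hp, h.sub_one_mem_iff hX]
    rw [mem_boundary, e1, e2]
    obtain ⟨b, s⟩ := ν
    have hb := h.next.ne_self h.nontrivial b
    have hb2 := h.next.ne_self h.nontrivial (σ b)
    have hb3 : σ.symm b ≠ b := fun h0 => hb (by rw [← h0, Equiv.apply_symm_apply, h0])
    cases s
    · simp only [fstArc, sndArc, Bool.false_eq_true, if_false]
      by_cases h1 : v = b
      · subst h1; simp [hb3, hb.symm]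
      · by_cases h2 : v = σ b
        · subst h2; simp [hb, hb.symm]
        · simp [h1, h2]
    · simp only [fstArc, sndArc, if_true]
      by_cases h1 : v = b
      · subst h1; simp [hb3.symm, hb.symm]
      · by_cases h2 : v = σ b
        · subst h2; simp [hb]
        · simp [h1, h2]
  ext v
  constructor
  · rintro ⟨hv, hvT⟩
    rcases (key ⟨v, hvT⟩).1 hv with h1 | h1
    · left; exact congrArg Subtype.val h1
    · right; exact congrArg Subtype.val h1
  · rintro (rfl | rfl)
    · exact ⟨(key _).2 (Or.inl rfl), ν.1.2⟩
    · exact ⟨(key _).2 (Or.inr rfl), (σ ν.1).2⟩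

end

end CrossesOnly

end CycleBridges

/-! ### The recoloured family is a double family -/

namespace CycleBridges

variable {n : ℕ} [NeZero n] {ι : Type*}

lemma ncard_setOf_eq_sum {α : Type*} [Fintype α] (P : α → Prop) [DecidablePred P] :
    {a | P a}.ncard = ∑ a, if P a then 1 else 0 := by
  rw [← Finset.card_filter, ← Set.ncard_coe_finset]
  congr 1
  ext a
  simp

/-- Cuts in multigraphs are posimodular. Here each `c` is an edge joining the two points of `D c` in
`A`, or no edge if there are none. -/
lemma ncard_cut_posimodular {γ α : Type*} [Finite γ] [Finite α] {D : γ → Set α} {A Z J : Set α}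
    (hD : ∀ c, D c ∩ A = ∅ ∨ (D c ∩ A).ncard = 2) (hZ : Z ⊆ A) (hJ : J ⊆ A) :
    {c | (D c ∩ (Z \ J)).ncard = 1}.ncard + {c | (D c ∩ (J \ Z)).ncard = 1}.ncard ≤
      {c | (D c ∩ Z).ncard = 1}.ncard + {c | (D c ∩ J).ncard = 1}.ncard := by
  classical
  have := Fintype.ofFinite γ
  simp only [ncard_setOf_eq_sum, ← Finset.sum_add_distrib]
  refine Finset.sum_le_sum fun c _ => ?_
  have key : ∀ S, S ⊆ A → D c ∩ S = (D c ∩ A) ∩ S := fun S hS => by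
    rw [Set.inter_assoc, Set.inter_eq_right.2 hS]
  rw [key _ hZ, key _ hJ, key _ (Set.sdiff_subset.trans hZ), key _ (Set.sdiff_subset.trans hJ)]
  rcases hD c with h | h
  · simp [h]
  · obtain ⟨x, y, hxy, h⟩ := Set.ncard_eq_two.1 h
    have hcard : ∀ S : Set α, (({x, y} : Set α) ∩ S).ncard = 1 ↔ ¬(x ∈ S ↔ y ∈ S) := by
      intro S
      by_cases hx : x ∈ S <;> by_cases hy : y ∈ S
      · rw [Set.inter_eq_left.2 (Set.insert_subset hx (Set.singleton_subset_iff.2 hy)),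
          Set.ncard_pair hxy]
        simp [hx, hy]
      · rw [Set.insert_inter_of_mem hx, Set.singleton_inter_eq_empty.2 hy]
        simp [hx, hy]
      · rw [Set.insert_inter_of_notMem hx, Set.inter_eq_left.2 (Set.singleton_subset_iff.2 hy)]
        simp [hx, hy]
      · rw [Set.insert_inter_of_notMem hx, Set.singleton_inter_eq_empty.2 hy]
        simp [hx, hy]
    rw [h]
    simp only [hcard, Set.mem_sdiff]
    by_cases h1 : x ∈ Z <;> by_cases h2 : x ∈ J <;> by_cases h3 : y ∈ Z <;> by_cases h4 : y ∈ J <;>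
      simp [h1, h2, h3, h4]

namespace CrossesOnly

variable {A A' : ι → Set (ZMod n)} {T U : ι} {σ : Equiv.Perm (A T)}
variable {γ : Type} [Finite γ] {X : γ → Set (ZMod n)}

section
variable (h : CrossesOnly A A' T U σ) (hX : DoubleFamily A' X)
  {p p' : A T → γ} (hne : ∀ d, p d ≠ p' d)
  (hp : ∀ (d : A T) (c : γ), (d : ZMod n) ∈ X c ↔ c = p d ∨ c = p' d)
include h hX hne hp

/-- Recolouring preserves the number of colours with a given property, as long as the property
depends on the edges in a single arc only and fails for the empty set: it only recombines pieces. -/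
lemma recolor_count [Finite ι] (d : A T) {R : Set (ZMod n) → Prop}
    (hR : ∀ Y Y', (∀ e, arcStart (A T) e = d → (e ∈ Y ↔ e ∈ Y')) → (R Y ↔ R Y'))
    (hR0 : ¬R ∅) :
    {ν | R (recolor σ X p p' ν)}.ncard = {c | R (X c)}.ncard := by
  classical
  have := Fintype.ofFinite γ
  have hR0' : ∀ Y, (∀ e, arcStart (A T) e = d → e ∉ Y) → ¬R Y := fun Y hY => by
    rwa [hR Y ∅ fun e he => iff_of_false (hY e he) (Set.notMem_empty _)]
  have hpm : ∀ b, (b : ZMod n) ∈ X (p b) := fun b => (hp b _).2 (Or.inl rfl)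
  have hpm' : ∀ b, (b : ZMod n) ∈ X (p' b) := fun b => (hp b _).2 (Or.inr rfl)
  let f : γ → ℕ := fun c => if R (X c) then 1 else 0
  let g : A T × Bool → {c : γ // ¬∀ d : A T, (d : ZMod n) ∉ X c} := fun ν =>
    ⟨if ν.2 then p' ν.1 else p ν.1, by
      intro h0
      by_cases hs : ν.2
      · rw [if_pos hs] at h0; exact h0 _ (hpm' _)
      · rw [if_neg hs] at h0; exact h0 _ (hpm _)⟩
  have hg : Function.Bijective g := by
    constructor
    · rintro ⟨b, s⟩ ⟨b', s'⟩ hbs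
      have h1 : (if s then p' b else p b) = (if s' then p' b' else p b') := congrArg Subtype.val hbs
      have h2 : (b : ZMod n) ∈ X (if s then p' b else p b) := by split_ifs; exacts [hpm' b, hpm b]
      have h3 : (b' : ZMod n) ∈ X (if s' then p' b' else p b') := by
        split_ifs; exacts [hpm' b', hpm b']
      have h4 := h.eq_of_mem hX h2 (h1 ▸ h3)
      subst h4
      cases s <;> cases s' <;> simp [hne, (hne _).symm] at h1 ⊢
    · rintro ⟨c, hc⟩
      push Not at hc
      obtain ⟨b, hb⟩ := hc
      rcases (hp b c).1 hb with h1 | h1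
      · exact ⟨(b, false), Subtype.ext h1.symm⟩
      · exact ⟨(b, true), Subtype.ext h1.symm⟩
  have hold : ∑ c, f c = ∑ c : {c : γ // ∀ d : A T, (d : ZMod n) ∉ X c}, f c +
      (f (p' d) + f (p d) + (f (p' (σ d)) + f (p (σ d)))) := by
    rw [← Fintype.sum_subtype_add_sum_subtype (fun c => ∀ d : A T, (d : ZMod n) ∉ X c) f,
      ← hg.sum_comp, Fintype.sum_prod_type]
    congr 1
    simp only [Fintype.sum_bool, g, if_true, Bool.false_eq_true, if_false]
    refine Fintype.sum_eq_add d (σ d) (h.next.ne_self h.nontrivial d).symm fun b hb => ?_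
    have h1 : ∀ c, (b : ZMod n) ∈ X c → f c = 0 := fun c hc =>
      if_neg (hR0' _ fun e he => h.notMem_of_arcStart hX hc (Ne.symm hb.1) (Ne.symm hb.2) he)
    rw [h1 _ (hpm b), h1 _ (hpm' b), add_zero]
  have hnew : ∀ ν : A T × Bool, (if R (recolor σ X p p' (.inr ν)) then 1 else 0) =
      (if d = fstArc σ ν then f (p ν.1) else 0) +
        (if d = sndArc σ ν then f (p' (σ ν.1)) else 0) := by
    intro ν
    by_cases h1 : d = fstArc σ ν
    · have h2 : d ≠ sndArc σ ν := h1 ▸ h.fstArc_ne ν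
      rw [if_pos h1, if_neg h2, add_zero]
      simp only [f]
      rw [hR _ (X (p ν.1)) fun e he => h.mem_recolor_fst (he.trans (congrArg Subtype.val h1))]
    · by_cases h2 : d = sndArc σ ν
      · rw [if_neg h1, if_pos h2, zero_add]
        simp only [f]
        rw [hR _ (X (p' (σ ν.1)))
          fun e he => h.mem_recolor_snd (he.trans (congrArg Subtype.val h2))]
      · rw [if_neg h1, if_neg h2, if_neg]
        exact hR0' _ fun e he => notMem_recolor he h1 h2
  rw [ncard_setOf_eq_sum, ncard_setOf_eq_sum]
  change _ = ∑ c, f c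
  rw [hold, Fintype.sum_sum_type]
  congr 1
  rw [Finset.sum_congr rfl fun ν _ => hnew ν, Fintype.sum_prod_type]
  simp only [Fintype.sum_bool, fstArc, sndArc, if_true, Bool.false_eq_true, if_false,
    Finset.sum_add_distrib]
  have s1 : ∑ b, (if d = σ.symm b then f (p b) else 0) = f (p (σ d)) := by
    rw [← Equiv.sum_comp σ]
    simp
  have s2 : ∑ b, (if d = σ b then f (p' (σ b)) else 0) = f (p' d) := by
    rw [Equiv.sum_comp σ (fun b => if d = b then f (p' b) else 0)]
    simp
  rw [s1, s2]
  simp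
  ring

omit hne in
lemma recolor_two [Finite ι] (ν) (s : ι) : boundary (recolor σ X p p' ν) ∩ A s = ∅ ∨
    (boundary (recolor σ X p p' ν) ∩ A s).ncard = 2 := by
  have hB := h.nontrivial.nonempty
  rcases ν with c | ν
  · exact h.old_two hX c s
  by_cases hsT : s = T
  · subst hsT
    right
    rw [h.recolor_boundary_self hX hp, Set.ncard_pair]
    exact fun h0 => h.next.ne_self h.nontrivial ν.1 (Subtype.ext h0.symm)
  by_cases hsU : s = U
  · subst hsU
    right
    have : boundary (recolor σ X p p' (.inr ν)) ∩ A s =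
        (boundary (recolor σ X p p' (.inr ν)) ∩ (A s ∩ arcInner (A T) (fstArc σ ν))) ∪
        (boundary (recolor σ X p p' (.inr ν)) ∩ (A s ∩ arcInner (A T) (sndArc σ ν))) := by
      apply Set.Subset.antisymm
      · rintro v ⟨hv, hvs⟩
        have hvd := h.mem_arcInner hsT hvs rfl
        by_contra hc
        refine h.notMem_boundary_of_forall hvd (fun e he => ?_) hv
        refine notMem_recolor (d := ⟨arcStart (A T) v, arcStart_mem hB v⟩) he ?_ ?_ <;>
        · intro h0
          have h1 := congrArg Subtype.val h0
          apply hc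
          rw [← h1]
          first
          | exact Or.inl ⟨hv, hvs, hvd⟩
          | exact Or.inr ⟨hv, hvs, hvd⟩
      · exact Set.union_subset (Set.inter_subset_inter_right _ Set.inter_subset_left)
          (Set.inter_subset_inter_right _ Set.inter_subset_left)
    rw [this, Set.ncard_union_eq ((inter_disjoint (h.fstArc_ne ν)).mono Set.inter_subset_right
      Set.inter_subset_right) (Set.toFinite _) (Set.toFinite _), h.recolor_ncard_fst hX hp,
      h.recolor_ncard_snd hX hp]
  obtain ⟨d, hd⟩ := h.other s hsT hsU
  have hsd : A s ⊆ arcInner (A T) d := fun x hx => h.mem_arcInner hsT hx (hd x hx)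
  by_cases h1 : d = fstArc σ ν
  · rw [boundary_inter_congr hB
      (fun e he => h.mem_recolor_fst (he.trans (congrArg Subtype.val h1))) hsd]
    exact h.old_two hX _ s
  by_cases h2 : d = sndArc σ ν
  · rw [boundary_inter_congr hB
      (fun e he => h.mem_recolor_snd (he.trans (congrArg Subtype.val h2))) hsd]
    exact h.old_two hX _ s
  · left
    rw [Set.eq_empty_iff_forall_notMem]
    rintro v ⟨hv, hvs⟩
    exact h.notMem_boundary_of_forall (hsd hvs) (fun e he => notMem_recolor he h1 h2) hv

omit hne hp in
lemma recolor_sub [Finite ι] (ν) : boundary (recolor σ X p p' ν) ⊆ ⋃ s, A s := by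
  have hB := h.nontrivial.nonempty
  rcases ν with c | ν
  · exact h.old_sub hX c
  intro v hv
  by_cases hvT : v ∈ A T
  · exact Set.mem_iUnion.2 ⟨T, hvT⟩
  have hvd : v ∈ arcInner (A T) (arcStart (A T) v) := ⟨hvT, rfl⟩
  by_cases h1 : arcStart (A T) v = fstArc σ ν
  · exact h.old_sub hX _ ((arcInner_congr hvd hB fun e he => h.mem_recolor_fst (he.trans h1)).1 hv)
  by_cases h2 : arcStart (A T) v = sndArc σ ν
  · exact h.old_sub hX _ ((arcInner_congr hvd hB fun e he => h.mem_recolor_snd (he.trans h2)).1 hv)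
  · refine (h.notMem_boundary_of_forall hvd (fun e he => ?_) hv).elim
    exact notMem_recolor (d := ⟨arcStart (A T) v, arcStart_mem hB v⟩) he
      (fun h0 => h1 (congrArg Subtype.val h0)) (fun h0 => h2 (congrArg Subtype.val h0))

lemma recolor_cut_arc [Finite ι] (d : A T) {Z : Set (ZMod n)} (hZ : Z ⊆ arcInner (A T) d) :
    {ν | (boundary (recolor σ X p p' ν) ∩ Z).ncard = 1}.ncard =
      {c | (boundary (X c) ∩ Z).ncard = 1}.ncard :=
  h.recolor_count hX hne hp d (R := fun Y => (boundary Y ∩ Z).ncard = 1)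
    (fun Y Y' hY => by rw [boundary_inter_congr h.nontrivial.nonempty hY hZ])
    (by simp [boundary_empty])

omit hX hne hp in
lemma exists_exit_enter {W : Set (A T)} (hW : W.Nonempty) (hW' : W ≠ Set.univ) :
    ∃ b b', b ∈ W ∧ σ b ∉ W ∧ b' ∉ W ∧ σ b' ∈ W := by
  obtain ⟨b, h1, h2⟩ := h.next.exists_exit hW hW'
  obtain ⟨b', h3, h4⟩ := h.next.exists_enter hW hW'
  exact ⟨b, b', h1, h2, h3, h4⟩

omit hne in
lemma recolor_cut_self [Finite ι] {Z : Set (ZMod n)} (hZ : Z ⊆ A T) (hZ0 : Z.Nonempty)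
    (hZ1 : Z ≠ A T) : 4 ≤ {ν | (boundary (recolor σ X p p' ν) ∩ Z).ncard = 1}.ncard := by
  obtain ⟨b, b', h1, h2, h3, h4⟩ := h.exists_exit_enter (W := {d | (d : ZMod n) ∈ Z})
    (by obtain ⟨x, hx⟩ := hZ0; exact ⟨⟨x, hZ hx⟩, hx⟩)
    (by
      intro h0
      apply hZ1
      refine Set.Subset.antisymm hZ fun x hx => ?_
      have : (⟨x, hx⟩ : A T) ∈ {d : A T | (d : ZMod n) ∈ Z} := by rw [h0]; trivial
      exact this)
  simp only [Set.mem_ofPred_eq] at h1 h2 h3 h4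
  have hbb' : b ≠ b' := fun h0 => h3 (h0 ▸ h1)
  have h5 : ∀ s, boundary (recolor σ X p p' (.inr s)) ∩ Z
      = ({(s.1 : ZMod n), (σ s.1 : ZMod n)} : Set (ZMod n)) ∩ Z := by
    intro s
    rw [← h.recolor_boundary_self hX hp s, Set.inter_assoc, Set.inter_eq_right.2 hZ]
  have h6 : (Sum.inr '' (({b, b'} : Set (A T)) ×ˢ (Set.univ : Set Bool))) ⊆
      {ν | (boundary (recolor σ X p p' ν) ∩ Z).ncard = 1} := by
    rintro _ ⟨⟨c, s⟩, ⟨hc, _⟩, rfl⟩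
    rw [Set.mem_ofPred_eq, h5]
    rcases hc with hc | hc <;> simp only at hc <;> subst hc
    · rw [Set.insert_inter_of_mem h1, Set.singleton_inter_eq_empty.2 h2]
      simp
    · rw [Set.insert_inter_of_notMem h3, Set.inter_eq_left.2 (Set.singleton_subset_iff.2 h4)]
      simp
  have h7 := Set.ncard_le_ncard h6 (Set.toFinite _)
  rw [Set.ncard_image_of_injective _ Sum.inr_injective, Set.ncard_prod, Set.ncard_pair hbb',
    Set.ncard_univ] at h7
  simpa using h7

/-- The multigraph on `A U` remains 4-edge-connected; the induction is on the size of `Z`. -/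
lemma recolor_cut_neighbor [Finite ι] (k : ℕ) : ∀ {Z : Set (ZMod n)}, Z.ncard = k → Z ⊆ A U →
    Z.Nonempty → Z ≠ A U →
    4 ≤ {ν | (boundary (recolor σ X p p' ν) ∩ Z).ncard = 1}.ncard := by
  induction k using Nat.strong_induction_on with
  | _ k ih =>
  intro Z hk hZU hZ0 hZ1
  have hB := h.nontrivial.nonempty
  -- within one arc the cut sizes are the old ones
  by_cases hZd : ∃ d : A T, Z ⊆ arcInner (A T) d
  · obtain ⟨d, hd⟩ := hZd
    rw [h.recolor_cut_arc hX hne hp d hd]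
    exact h.four_le_cut hX hZU hZ0 hZ1
  push Not at hZd
  -- if an arc splits its part `J` of `A U`, then uncross `Z` and `J`, whose cut has size four
  by_cases hsplit : ∃ d : A T, (Z ∩ (A U ∩ arcInner (A T) d)).Nonempty ∧
      ((A U ∩ arcInner (A T) d) \ Z).Nonempty
  · obtain ⟨d, hd1, hd2⟩ := hsplit
    set J := A U ∩ arcInner (A T) d with hJ
    have hpos := ncard_cut_posimodular (D := fun ν => boundary (recolor σ X p p' ν))
      (A := A U) (Z := Z) (J := J) (fun ν => h.recolor_two hX hp ν U) hZU Set.inter_subset_left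
    have hJ4 : {ν | (boundary (recolor σ X p p' ν) ∩ J).ncard = 1}.ncard ≤ 4 := by
      rw [h.recolor_cut_arc hX hne hp d Set.inter_subset_right]
      simp only [h.ncard_eq_one_iff hX]
      have : {c | ¬((d : ZMod n) ∈ X c ↔ (σ d : ZMod n) ∈ X c)} ⊆
          {c | (d : ZMod n) ∈ X c} ∪ {c | (σ d : ZMod n) ∈ X c} := by
        intro c hc
        simp only [Set.mem_ofPred_eq, Set.mem_union] at hc ⊢
        tauto
      refine (Set.ncard_le_ncard this (Set.toFinite _)).trans ((Set.ncard_union_le _ _).trans ?_)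
      rw [hX.cover, hX.cover]
    have hJZ : 4 ≤ {ν | (boundary (recolor σ X p p' ν) ∩ (J \ Z)).ncard = 1}.ncard := by
      rw [h.recolor_cut_arc hX hne hp d (Set.sdiff_subset.trans Set.inter_subset_right)]
      refine h.four_le_cut hX (Set.sdiff_subset.trans Set.inter_subset_left) hd2 ?_
      intro h0
      obtain ⟨x, hx⟩ := hZ0
      have := hZU hx
      rw [← h0] at this
      exact this.2 hx
    have hlt : (Z \ J).ncard < k := by
      rw [← hk]
      refine Set.ncard_lt_ncard ⟨Set.sdiff_subset, fun h0 => ?_⟩ (Set.toFinite _)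
      obtain ⟨x, hx1, hx2⟩ := hd1
      exact (h0 hx1).2 hx2
    have hZJ0 : (Z \ J).Nonempty := by
      rw [Set.nonempty_iff_ne_empty, Ne, Set.sdiff_eq_empty]
      exact fun h0 => hZd d (h0.trans Set.inter_subset_right)
    have hZJ1 : Z \ J ≠ A U := by
      intro h0
      obtain ⟨x, hx1, hx2⟩ := hd1
      have : x ∈ A U := hx2.1
      rw [← h0] at this
      exact this.2 hx2
    have := ih _ hlt rfl (Set.sdiff_subset.trans hZU) hZJ0 hZJ1
    omega
  · push Not at hsplit
    -- now `Z` is a union of parts of `A U` in arcs, and two new colours leave each of the two ends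
    set W : Set (A T) := {d | A U ∩ arcInner (A T) d ⊆ Z} with hW
    have hWn : ∀ d, d ∉ W → Z ∩ (A U ∩ arcInner (A T) d) = ∅ := by
      intro d hd
      by_contra h0
      have := hsplit d (Set.nonempty_iff_ne_empty.2 h0)
      exact hd (Set.sdiff_eq_empty.1 this)
    have hmem : ∀ x ∈ A U, x ∈ A U ∩ arcInner (A T)
        ((⟨arcStart (A T) x, arcStart_mem hB x⟩ : A T) : ZMod n) :=
      fun x hx => ⟨hx, h.mem_arcInner h.ne hx rfl⟩
    obtain ⟨b, b', h1, h2, h3, h4⟩ := h.exists_exit_enter (W := W)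
      (by
        obtain ⟨x, hx⟩ := hZ0
        refine ⟨⟨arcStart (A T) x, arcStart_mem hB x⟩, ?_⟩
        by_contra h0
        have : x ∈ Z ∩ _ := ⟨hx, hmem x (hZU hx)⟩
        rw [hWn _ h0] at this
        exact this)
      (by
        intro h0
        apply hZ1
        refine Set.Subset.antisymm hZU fun x hx => ?_
        have : (⟨arcStart (A T) x, arcStart_mem hB x⟩ : A T) ∈ W := by rw [h0]; trivial
        exact this (hmem x hx))
    have hbb' : b ≠ b' := fun h0 => h3 (h0 ▸ h1)
    have key : ∀ ν : A T × Bool, ¬(fstArc σ ν ∈ W ↔ sndArc σ ν ∈ W) →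
        (boundary (recolor σ X p p' (.inr ν)) ∩ Z).ncard = 1 := by
      intro ν hν
      set D := boundary (recolor σ X p p' (.inr ν)) with hD
      have hDZ : ∀ d : A T, d ∈ W → (∀ e, e ∈ W → e ≠ d → e ≠ fstArc σ ν ∧ e ≠ sndArc σ ν) →
          D ∩ Z = D ∩ (A U ∩ arcInner (A T) d) := by
        intro d hd hde
        refine Set.Subset.antisymm ?_ (Set.inter_subset_inter_right _ hd)
        rintro x ⟨hx, hxZ⟩
        refine ⟨hx, ?_⟩
        set e : A T := ⟨arcStart (A T) x, arcStart_mem hB x⟩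
        have hxe := hmem x (hZU hxZ)
        have he : e ∈ W := by
          by_contra h0
          have : x ∈ Z ∩ _ := ⟨hxZ, hxe⟩
          rw [hWn _ h0] at this
          exact this
        by_cases hed : e = d
        · rw [← hed]; exact hxe
        · exfalso
          obtain ⟨h5, h6⟩ := hde e he hed
          exact h.notMem_boundary_of_forall hxe.2 (fun y hy => notMem_recolor hy h5 h6) hx
      by_cases h5 : fstArc σ ν ∈ W
      · have h6 : sndArc σ ν ∉ W := by tauto
        rw [hDZ _ h5 fun e he hne => ⟨hne, fun h0 => h6 (h0 ▸ he)⟩]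
        exact h.recolor_ncard_fst hX hp ν
      · have h6 : sndArc σ ν ∈ W := by tauto
        rw [hDZ _ h6 fun e he hne => ⟨fun h0 => h5 (h0 ▸ he), hne⟩]
        exact h.recolor_ncard_snd hX hp ν
    have h6 : (Sum.inr '' ({(b, false), (σ b, true), (b', false), (σ b', true)} :
        Set (A T × Bool))) ⊆ {ν | (boundary (recolor σ X p p' ν) ∩ Z).ncard = 1} := by
      rintro _ ⟨ν, hν, rfl⟩
      apply key
      rcases hν with rfl | rfl | rfl | rfl <;> simp [fstArc, sndArc, h1, h2, h3, h4]
    have h7 := Set.ncard_le_ncard h6 (Set.toFinite _)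
    rw [Set.ncard_image_of_injective _ Sum.inr_injective,
      Set.ncard_insert_of_notMem (by simp [hbb']), Set.ncard_insert_of_notMem (by simp [hbb']),
      Set.ncard_insert_of_notMem (by simp),
      Set.ncard_singleton] at h7
    exact h7

omit hne in
lemma recolor_good [Finite ι] (ν : A T × Bool) {N : Set (ZMod n)}
    (hN : N = recolor σ X p p' (.inr ν) ∨ N = (recolor σ X p p' (.inr ν))ᶜ) : Good A N := by
  have hbN : boundary N = boundary (recolor σ X p p' (.inr ν)) := by
    rcases hN with rfl | rfl
    · rfl
    · exact boundary_compl _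
  have hbT := h.recolor_boundary_self hX hp ν
  have hm : ∀ x ∈ ({(ν.1 : ZMod n), (σ ν.1 : ZMod n)} : Set (ZMod n)), x ∈ boundary N := by
    intro x hx
    rw [← hbT, ← hbN] at hx
    exact hx.1
  refine h.good_of_arcs (by rw [hbN]; exact h.recolor_sub hX _)
    (by rw [hbN]; exact h.recolor_two hX hp _) ν.1 (hm _ (by simp)) (hm _ (by simp)) ?_ ?_
  · rw [hbN]
    rcases ν with ⟨b, s⟩
    cases s
    · exact h.recolor_ncard_fst hX hp (b, false)
    · exact h.recolor_ncard_snd hX hp (b, true)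
  · have hgood : ∀ (d : A T) (c : γ),
        (∀ e, arcStart (A T) e = d → (e ∈ recolor σ X p p' (.inr ν) ↔ e ∈ X c)) →
        (boundary (X c) ∩ (A U ∩ arcInner (A T) d)).Nonempty →
        ∃ Q, Good A' Q ∧ (∀ x, arcStart (A T) x = d → (x ∈ N ↔ x ∈ Q)) ∧
        (boundary Q ∩ (A U ∩ arcInner (A T) d)).Nonempty := by
      intro d c hc hU
      rcases hN with rfl | rfl
      · exact ⟨X c, hX.good c, hc, hU⟩
      · exact ⟨(X c)ᶜ, hX.good_compl c, fun x hx => not_congr (hc x hx), by rwa [boundary_compl]⟩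
    intro d
    by_cases h1 : d = fstArc σ ν
    · right
      subst h1
      refine hgood _ (p ν.1) (fun e he => h.mem_recolor_fst he) ?_
      apply Set.nonempty_of_ncard_ne_zero
      rw [h.ncard_eq_one hX ((h.mem_p hX hp _ _).2 rfl) (fstArc_or σ ν)]
      exact one_ne_zero
    by_cases h2 : d = sndArc σ ν
    · right
      subst h2
      refine hgood _ (p' (σ ν.1)) (fun e he => h.mem_recolor_snd he) ?_
      apply Set.nonempty_of_ncard_ne_zero
      rw [h.ncard_eq_one hX ((h.mem_p' hX hp _ _).2 rfl) (sndArc_or σ ν)]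
      exact one_ne_zero
    · left
      intro v hv
      rw [hbN]
      exact h.notMem_boundary_of_forall hv fun e he => notMem_recolor he h1 h2

lemma recolor_doubleFamily [Finite ι] : DoubleFamily A (recolor σ X p p') := by
  have hB := h.nontrivial.nonempty
  refine ⟨fun e => ?_, h.recolor_sub hX, ?_, h.recolor_two hX hp, ?_, ?_, ?_⟩
  · rw [h.recolor_count hX hne hp ⟨arcStart (A T) e, arcStart_mem hB e⟩ (R := fun Y => e ∈ Y)
      (fun Y Y' hY => hY e rfl) (Set.notMem_empty e)]
    exact hX.cover e
  · rintro (c | ν)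
    · exact hX.ne c
    · have : (ν.1 : ZMod n) ∈ boundary (recolor σ X p p' (.inr ν)) ∩ A T := by
        rw [h.recolor_boundary_self hX hp]; simp
      exact ⟨_, this.1⟩
  · intro s Z hZ hZ0 hZ1
    by_cases hsT : s = T
    · subst hsT; exact h.recolor_cut_self hX hp hZ hZ0 hZ1
    by_cases hsU : s = U
    · subst hsU; exact h.recolor_cut_neighbor hX hne hp _ rfl hZ hZ0 hZ1
    obtain ⟨d, hd⟩ := h.other s hsT hsU
    rw [h.recolor_cut_arc hX hne hp d fun x hx => h.mem_arcInner hsT (hZ hx) (hd x (hZ hx))]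
    have hs := h.old_of_ne s hsT
    exact hX.cut s Z (hs ▸ hZ) hZ0 (hs ▸ hZ1)
  · rintro (c | ν)
    · exact (hX.good c).congr (h.boundary_inter_eq hX c)
    · exact h.recolor_good hX hp ν (Or.inl rfl)
  · rintro (c | ν)
    · exact (hX.good_compl c).congr (by rw [boundary_compl]; exact h.boundary_inter_eq hX c)
    · exact h.recolor_good hX hp ν (Or.inr rfl)

end

end CrossesOnly

end CycleBridges

/-! ### Double families from trees of crossings -/

namespace CycleBridges

variable {n : ℕ} [NeZero n]

/-- The graph on the index set in which two indices are adjacent if their sets cross. -/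
def crossGraph {ι : Type*} (A : ι → Set (ZMod n)) : SimpleGraph ι where
  Adj i j := i ≠ j ∧ Cross (A i) (A j)
  symm := ⟨fun _ _ h => ⟨h.1.symm, h.2.symm⟩⟩
  loopless := ⟨fun _ h => h.1 rfl⟩

lemma arcStart_eq_arcStart {B C : Set (ZMod n)} (hB : B.Nonempty) (hC : C.Nonempty) {d e : ZMod n}
    (hd : ∀ v ∈ arcInner B d, v ∉ C) (he : arcStart B e = d) : arcStart C e = arcStart C d := by
  refine (mem_iff_of_arcStart_eq (X := {e | arcStart C e = arcStart C d}) hB (fun v hv hvX => ?_)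
    he).2 rfl
  refine hvX ?_
  rw [Set.mem_ofPred_eq, Set.mem_ofPred_eq, arcStart_sub_one hC (hd v hv)]

/-- If all of `D` lies in one arc of `B` and that arc has no point of `C` inside, then `C` and `D`
do not cross. -/
lemma not_cross_of_arc {B C D : Set (ZMod n)} (hB : B.Nonempty) (hC : C.Nonempty) {d : ZMod n}
    (hd : ∀ v ∈ arcInner B d, v ∉ C) (hD : ∀ x ∈ D, arcStart B x = d) : ¬Cross C D := by
  intro h
  obtain ⟨u, hu, v, hv, huv⟩ := h.exists_arcStart_ne
  apply huv
  rw [arcStart_eq_arcStart hB hC hd (hD u hu), arcStart_eq_arcStart hB hC hd (hD v hv)]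

omit [NeZero n] in
lemma Cross.mono {B B' C C' : Set (ZMod n)} (h : Cross B C) (hB : B ⊆ B') (hC : C ⊆ C') :
    Cross B' C' := by
  obtain ⟨x, hx, y, hy, u, hu, v, hv, h⟩ := h
  exact ⟨x, hB hx, y, hB hy, u, hC hu, v, hC hv, h⟩

/-- Deleting the point `σ b` of `B` does not affect crossings with a set that has no point between
`b` and `σ b`. -/
lemma cross_diff_iff {B C : Set (ZMod n)} (hdisj : Disjoint C B) (hC : C.Nonempty)
    {σ : Equiv.Perm B} (hσ : IsNext B σ) {b : B} (hb : σ b ≠ b)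
    (hinner : ∀ v ∈ arcInner B b, v ∉ C) : Cross (B \ {(σ b : ZMod n)}) C ↔ Cross B C := by
  have hB : B.Nonempty := ⟨b, b.2⟩
  refine ⟨fun h => h.mono Set.sdiff_subset subset_rfl, fun h => ?_⟩
  obtain ⟨u, hu, v, hv, huv⟩ := h.symm.exists_arcStart_ne
  have hσb : arcStart C (σ b) = arcStart C b := by
    rw [← arcStart_sub_one hC fun h => Set.disjoint_left.1 hdisj h (σ b).2]
    exact arcStart_eq_arcStart hB hC hinner (hσ b)
  have key : ∀ x ∈ B, ∃ y ∈ B \ {(σ b : ZMod n)}, arcStart C y = arcStart C x := by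
    intro x hx
    by_cases hxb : x = σ b
    · exact ⟨b, ⟨b.2, fun h0 => hb (Subtype.ext h0.symm)⟩, by rw [hxb, hσb]⟩
    · exact ⟨x, ⟨hx, hxb⟩, rfl⟩
  obtain ⟨u', hu', hu''⟩ := key u hu
  obtain ⟨v', hv', hv''⟩ := key v hv
  refine (cross_of_arcStart_ne (hdisj.mono_right Set.sdiff_subset) hC hu' hv' ?_).symm
  rwa [hu'', hv'']

omit [NeZero n] in
/-- Adding an empty set to the family of sets. -/
lemma DoubleFamily.of_subtype {ι : Type*} {A A' : ι → Set (ZMod n)} {T : ι} {γ : Type} [Finite γ]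
    {X : γ → Set (ZMod n)} (hX : DoubleFamily (fun i : {i // i ≠ T} => A i) X) (hT : A' T = ∅)
    (hs : ∀ s, s ≠ T → A' s = A s) : DoubleFamily A' X := by
  have hgood : ∀ N, Good (fun i : {i // i ≠ T} => A i) N → Good A' N := by
    rintro N hN Y ⟨h1, h2, h3⟩
    exact hN Y ⟨h1, h2, fun s => by have := h3 s; rwa [hs s s.2] at this⟩
  refine ⟨hX.cover, fun c => (hX.sub c).trans ?_, hX.ne, fun c s => ?_, fun s Z hZ hZ0 hZ1 => ?_,
    fun c => hgood _ (hX.good c), fun c => hgood _ (hX.good_compl c)⟩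
  · refine Set.iUnion_subset fun s => ?_
    rw [← hs s s.2]
    exact Set.subset_iUnion A' s
  · by_cases hsT : s = T
    · left; rw [hsT, hT, Set.inter_empty]
    · rw [hs s hsT]; exact hX.two c ⟨s, hsT⟩
  · by_cases hsT : s = T
    · rw [hsT, hT] at hZ
      exact (hZ0.ne_empty (Set.subset_empty_iff.1 hZ)).elim
    · rw [hs s hsT] at hZ hZ1
      exact hX.cut ⟨s, hsT⟩ Z hZ hZ0 hZ1

lemma _root_.SimpleGraph.Reachable.mem_of_adj_closed {V : Type*} {G : SimpleGraph V} {W : Set V}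
    (hW : ∀ x ∈ W, ∀ y, G.Adj x y → y ∈ W) {x y : V} (h : G.Reachable x y) (hx : x ∈ W) :
    y ∈ W := by
  obtain ⟨p⟩ := h
  induction p with
  | nil => exact hx
  | cons hadj _ ih => exact ih (hW _ hx _ hadj)

/-- A leaf `T` of the crossing graph, with neighbour `U`, meets the requirements of `CrossesOnly` if
no bridge with three attachments has two consecutive ones with no attachment between them. If `A T`
has two points only, its crossing with `A U` suffices. Otherwise an arc of `A T` without points of
`A U` would contain some `A t` by `hred`; going from `t` towards `U` in the crossing graph without
`T`, all sets would remain inside this arc. -/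
lemma exists_crossesOnly {ι : Type} [Finite ι] {A : ι → Set (ZMod n)}
    (hdisj : Pairwise fun s s' => Disjoint (A s) (A s')) (hcard : ∀ s, 2 ≤ (A s).ncard)
    (hred : ∀ t (σ : Equiv.Perm (A t)), IsNext (A t) σ → ∀ b : A t, 3 ≤ (A t).ncard →
      ∃ v ∈ arcInner (A t) b, ∃ s, v ∈ A s)
    {T U : ι} (hTU : (crossGraph A).Adj T U) (huniq : ∀ s, (crossGraph A).Adj T s → s = U)
    (hconn : ((crossGraph A).induce {T}ᶜ).Connected) {A' : ι → Set (ZMod n)} (hT : A' T = ∅)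
    (hs : ∀ s, s ≠ T → A' s = A s) : ∃ σ, CrossesOnly A A' T U σ := by
  have hnt : ∀ s, (A s).Nontrivial := fun s => by
    rw [← Set.one_lt_ncard_iff_nontrivial]
    have := hcard s
    omega
  have hne : ∀ s, (A s).Nonempty := fun s => (hnt s).nonempty
  have hB := hne T
  obtain ⟨σ, hσ⟩ := exists_arcNext hB
  change IsNext _ σ at hσ
  have hUT : U ≠ T := hTU.1.symm
  have hother : ∀ s, s ≠ T → s ≠ U → ∃ d : A T, ∀ x ∈ A s, arcStart (A T) x = d := by
    intro s hsT hsU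
    obtain ⟨x, hx⟩ := hne s
    refine ⟨⟨arcStart (A T) x, arcStart_mem hB x⟩, fun y hy => ?_⟩
    by_contra hxy
    exact hsU (huniq s ⟨hsT.symm, cross_of_arcStart_ne (hdisj hsT.symm) hB hy hx hxy⟩)
  have hin : ∀ s, s ≠ T → ∀ x ∈ A s, ∀ d, arcStart (A T) x = d → x ∈ arcInner (A T) d :=
    fun s hs x hx d hd => ⟨fun hxT => Set.disjoint_left.1 (hdisj hs) hx hxT, hd⟩
  refine ⟨σ, hdisj, hσ, hnt T, hUT, fun d => ?_, hother, hT, hs⟩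
  by_contra hd
  rw [Set.not_nonempty_iff_eq_empty] at hd
  have hdU : ∀ v ∈ arcInner (A T) d, v ∉ A U := fun v hv hvU => by
    have : v ∈ A U ∩ arcInner (A T) d := ⟨hvU, hv⟩
    rw [hd] at this
    exact this
  by_cases hlab : ∃ v ∈ arcInner (A T) d, ∃ s, v ∈ A s
  · obtain ⟨v, hv, t, hvt⟩ := hlab
    have htT : t ≠ T := by rintro rfl; exact hv.1 hvt
    have htU : t ≠ U := by rintro rfl; exact hdU v hv hvt
    have hW : (⟨U, hUT⟩ : ({T}ᶜ : Set ι)) ∈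
        {s : ({T}ᶜ : Set ι) | ∀ x ∈ A s, arcStart (A T) x = d} := by
      refine (hconn.preconnected ⟨t, htT⟩ ⟨U, hUT⟩).mem_of_adj_closed ?_ ?_
      · rintro ⟨s, hsT⟩ hsW ⟨s', hsT'⟩ hadj
        have hcross : Cross (A s') (A s) := hadj.2.symm
        have hnot : ¬∀ v ∈ arcInner (A T) d, v ∉ A s' := fun h0 =>
          not_cross_of_arc hB (hne s') h0 hsW hcross
        push Not at hnot
        obtain ⟨w, hw, hws⟩ := hnot
        have hsU' : s' ≠ U := by rintro rfl; exact hdU w hw hws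
        obtain ⟨d', hd'⟩ := hother s' hsT' hsU'
        intro x hx
        rw [hd' x hx, ← hd' w hws]
        exact hw.2
      · obtain ⟨d', hd'⟩ := hother t htT htU
        intro x hx
        rw [hd' x hx, ← hd' v hvt]
        exact hv.2
    obtain ⟨x, hx⟩ := hne U
    exact hdU x (hin U hUT x hx d (hW x hx)) hx
  · have hcT : (A T).ncard = 2 := by
      by_contra h0
      exact hlab (hred T σ hσ d (by have := hcard T; omega))
    have hAT : ∀ e ∈ A T, e ≠ d → e = σ d := by
      have : ({(d : ZMod n), (σ d : ZMod n)} : Set (ZMod n)) = A T := by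
        apply Set.eq_of_subset_of_ncard_le
        · rintro x (rfl | rfl)
          exacts [d.2, (σ d).2]
        · rw [hcT, Set.ncard_pair]
          exact fun h0 => hσ.ne_self (hnt T) d (Subtype.ext h0.symm)
        · exact Set.toFinite _
      intro e he hed
      rw [← this] at he
      exact he.resolve_left hed
    obtain ⟨u, hu, v, hv, huv⟩ := hTU.2.exists_arcStart_ne
    apply huv
    rw [hAT _ (arcStart_mem hB u) fun h0 => hdU u (hin U hUT u hu d h0) hu,
      hAT _ (arcStart_mem hB v) fun h0 => hdU v (hin U hUT v hv d h0) hv]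

/-- If the crossing graph is a tree, then a `DoubleFamily` exists. The induction is on the total
number of attachments: either an attachment can be deleted that follows another one of the same
bridge (`exists_doubleFamily_insert`), or there is a single bridge with two attachments, or a leaf
of the tree is removed (`CrossesOnly.recolor_doubleFamily`). -/
theorem exists_doubleFamily (N : ℕ) : ∀ (ι : Type) [Fintype ι] (A : ι → Set (ZMod n)),
    ∑ s, (A s).ncard = N → (Pairwise fun s s' => Disjoint (A s) (A s')) →
    (∀ s, 2 ≤ (A s).ncard) → (crossGraph A).IsTree →
    ∃ (γ : Type) (_ : Finite γ) (X : γ → Set (ZMod n)), DoubleFamily A X := by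
  classical
  induction N using Nat.strong_induction_on with
  | _ N ih =>
  intro ι _ A hN hdisj hcard htree
  have hnt : ∀ s, (A s).Nontrivial := fun s => by
    rw [← Set.one_lt_ncard_iff_nontrivial]
    have := hcard s
    omega
  have hne : ∀ s, (A s).Nonempty := fun s => (hnt s).nonempty
  by_cases hred : ∃ t, ∃ σ : Equiv.Perm (A t), IsNext (A t) σ ∧ ∃ b : A t, 3 ≤ (A t).ncard ∧
      ∀ v ∈ arcInner (A t) b, ∀ s, v ∉ A s
  · obtain ⟨t, σ, hσ, b, h3, hinner⟩ := hred
    set A' := Function.update A t (A t \ {(σ b : ZMod n)}) with hA'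
    have hAt : A' t = A t \ {(σ b : ZMod n)} := by simp [hA']
    have hAs : ∀ s, s ≠ t → A' s = A s := fun s hs => by simp [hA', hs]
    have hsub : ∀ s, A' s ⊆ A s := by
      intro s
      by_cases hs : s = t
      · subst hs; rw [hAt]; exact Set.sdiff_subset
      · rw [hAs s hs]
    have hcardt : (A' t).ncard + 1 = (A t).ncard := by
      rw [hAt, Set.ncard_sdiff_singleton_of_mem (σ b).2]
      omega
    have hG : crossGraph A' = crossGraph A := by
      have key : ∀ s, s ≠ t → (Cross (A' t) (A' s) ↔ Cross (A t) (A s)) := by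
        intro s hs
        rw [hAt, hAs s hs]
        exact cross_diff_iff (hdisj hs) (hne s) hσ (hσ.ne_self (hnt t) b) fun v hv => hinner v hv s
      ext i j
      refine and_congr_right fun hij => ?_
      by_cases hi : i = t
      · subst hi; exact key j hij.symm
      · by_cases hj : j = t
        · subst hj
          exact ⟨fun h => ((key i hi).1 h.symm).symm, fun h => ((key i hi).2 h.symm).symm⟩
        · rw [hAs i hi, hAs j hj]
    obtain ⟨γ, _, X, hX⟩ := ih (∑ s, (A' s).ncard) (by
        rw [← hN]
        refine Finset.sum_lt_sum (fun s _ => Set.ncard_le_ncard (hsub s) (Set.toFinite _))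
          ⟨t, Finset.mem_univ t, by omega⟩) ι A' rfl
      (fun s s' hss => (hdisj hss).mono (hsub s) (hsub s'))
      (fun s => by
        by_cases hs : s = t
        · subst hs; omega
        · rw [hAs s hs]; exact hcard s) (hG ▸ htree)
    obtain ⟨X', hX'⟩ := exists_doubleFamily_insert hdisj hσ b h3 hinner hAt hAs hX
    exact ⟨_, inferInstance, X', hX'⟩
  push Not at hred
  rcases subsingleton_or_nontrivial ι with hsing | hnontriv
  · obtain ⟨t⟩ := htree.connected.nonempty
    have ht : ∀ s, s = t := fun s => Subsingleton.elim s t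
    have hc : (A t).ncard = 2 := by
      by_contra h0
      obtain ⟨σ, hσ⟩ := exists_arcNext (hne t)
      obtain ⟨v, hv, s, hvs⟩ := hred t σ hσ ⟨_, (hne t).some_mem⟩ (by have := hcard t; omega)
      rw [ht s] at hvs
      exact hv.1 hvs
    obtain ⟨X, hX⟩ := exists_doubleFamily_of_pair A t ht hc
    exact ⟨_, inferInstance, X, hX⟩
  · obtain ⟨T, hT⟩ := htree.exists_vert_degree_one_of_nontrivial
    obtain ⟨U, hU, huniq⟩ := SimpleGraph.degree_eq_one_iff_existsUnique_adj.1 hT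
    have hconn := htree.connected.induce_compl_singleton_of_degree_eq_one hT
    obtain ⟨σ, hσ⟩ := exists_crossesOnly (A' := Function.update A T ∅) hdisj hcard hred hU huniq
      hconn (by simp) (fun s hs => by simp [hs])
    have hsum : ∑ s : {s // s ≠ T}, (A s).ncard < N := by
      have h1 := Fintype.sum_subtype_add_sum_subtype (fun s => s ≠ T) fun s => (A s).ncard
      have h2 : (A T).ncard ≤ ∑ s : {s // ¬s ≠ T}, (A s).ncard :=
        Finset.single_le_sum (f := fun s : {s // ¬s ≠ T} => (A s).ncard) (fun _ _ => Nat.zero_le _)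
          (Finset.mem_univ ⟨T, by simp⟩)
      have := hcard T
      omega
    obtain ⟨γ, _, X, hX⟩ := ih _ hsum {s // s ≠ T} (fun s => A s) rfl
      (fun s s' hss => hdisj fun h0 => hss (Subtype.ext h0)) (fun s => hcard s) (by
        have hiso : crossGraph (fun s : {s // s ≠ T} => A s) = (crossGraph A).induce {T}ᶜ := by
          ext i j
          exact and_congr_left fun _ => not_congr Subtype.ext_iff
        rw [hiso]
        exact ⟨hconn, htree.isAcyclic.induce _⟩)
    have hX' := hX.of_subtype (A' := Function.update A T ∅) (by simp) (fun s hs => by simp [hs])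
    obtain ⟨p, p', hne', hp⟩ := CrossesOnly.exists_pairs (A := A) (T := T) hX'
    exact ⟨_, inferInstance, _, hσ.recolor_doubleFamily hX' hne' hp⟩

end CycleBridges

/-! ### Cycles made of edges of a cycle and disjoint paths -/

namespace CycleBridges

open SimpleGraph

variable {V : Type*} {G : SimpleGraph V} {n : ℕ}

/-- The map `f` enumerates the vertices of the cycle `L` in cyclic order; the edge `e` of `L` joins
`f e` and `f (e + 1)`. -/
structure CycleParam (L : G.Subgraph) (f : ZMod n → V) : Prop where
  three_le : 3 ≤ n
  injective : Function.Injective f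
  verts_eq : L.verts = Set.range f
  adj_iff : ∀ x y, L.Adj x y ↔ ∃ e, s(x, y) = s(f e, f (e + 1))

lemma exists_cycleParam {L : G.Subgraph} (hL : IsCycleSubgraph L) :
    ∃ n, ∃ _ : NeZero n, ∃ f : ZMod n → V, CycleParam L f := by
  obtain ⟨u, c, hc, rfl⟩ := hL
  have h3 := hc.three_le_length
  have hn : NeZero c.length := ⟨by omega⟩
  have hval : ∀ e : ZMod c.length, c.getVert (e + 1).val = c.getVert (e.val + 1) := by
    intro e
    have he := ZMod.val_lt e
    rw [ZMod.val_add, ZMod.val_one_eq_one_mod, Nat.add_mod_mod]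
    by_cases h : e.val + 1 = c.length
    · rw [h, Nat.mod_self, Walk.getVert_zero, Walk.getVert_length]
    · rw [Nat.mod_eq_of_lt (by omega)]
  refine ⟨c.length, hn, fun e => c.getVert e.val, h3, ?_, ?_, ?_⟩
  · intro a b hab
    have ha := ZMod.val_lt a
    have hb := ZMod.val_lt b
    exact ZMod.val_injective _ (hc.getVert_injOn' (by rw [Set.mem_ofPred]; omega)
      (by rw [Set.mem_ofPred]; omega) hab)
  · ext x
    rw [Walk.mem_verts_toSubgraph, Walk.mem_support_iff_exists_getVert]
    constructor
    · rintro ⟨i, rfl, hi⟩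
      by_cases h : i = c.length
      · refine ⟨0, ?_⟩
        simp only [ZMod.val_zero]
        rw [h, Walk.getVert_zero, Walk.getVert_length]
      · refine ⟨(i : ZMod c.length), ?_⟩
        simp only []
        rw [ZMod.val_natCast_of_lt (by omega)]
    · rintro ⟨e, rfl⟩
      exact ⟨e.val, rfl, (ZMod.val_lt e).le⟩
  · intro x y
    rw [Walk.toSubgraph_adj_iff]
    constructor
    · rintro ⟨i, hi, hlt⟩
      refine ⟨(i : ZMod c.length), ?_⟩
      rw [hval, ZMod.val_natCast_of_lt hlt, hi]
    · rintro ⟨e, he⟩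
      exact ⟨e.val, by rw [he, hval], ZMod.val_lt e⟩

namespace CycleParam

variable {L : G.Subgraph} {f : ZMod n → V} (hf : CycleParam L f)
include hf

lemma sub_one_ne_add_one (v : ZMod n) : v - 1 ≠ v + 1 := by
  intro h
  have h2 : ((2 : ℕ) : ZMod n) = 0 := by
    have : (v + 1) - (v - 1) = 0 := by rw [h, sub_self]
    rw [← this]
    push_cast
    ring
  rw [ZMod.natCast_eq_zero_iff] at h2
  have := Nat.le_of_dvd (by norm_num) h2
  have := hf.three_le
  omega

lemma edge_eq_iff (e e' : ZMod n) : s(f e, f (e + 1)) = s(f e', f (e' + 1)) ↔ e = e' := by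
  constructor
  · intro h
    rw [Sym2.eq_iff] at h
    rcases h with ⟨h, -⟩ | ⟨h1, h2⟩
    · exact hf.injective h
    · exfalso
      have h1 := hf.injective h1
      have h2 := hf.injective h2
      apply hf.sub_one_ne_add_one e
      rw [h2, h1]; ring
  · rintro rfl; rfl

lemma exists_edge_iff {N : Set (ZMod n)} (v : ZMod n) (y : V) :
    (∃ e ∈ N, s(f v, y) = s(f e, f (e + 1))) ↔
      (v ∈ N ∧ y = f (v + 1)) ∨ (v - 1 ∈ N ∧ y = f (v - 1)) := by
  constructor
  · rintro ⟨e, he, h⟩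
    rw [Sym2.eq_iff] at h
    rcases h with ⟨h1, h2⟩ | ⟨h1, h2⟩
    · have := hf.injective h1
      subst this
      exact Or.inl ⟨he, h2⟩
    · have := hf.injective h1
      subst this
      right
      rw [add_sub_cancel_right]
      exact ⟨he, h2⟩
  · rintro (⟨h, rfl⟩ | ⟨h, rfl⟩)
    · exact ⟨v, h, rfl⟩
    · exact ⟨v - 1, h, by rw [sub_add_cancel, Sym2.eq_swap]⟩

/-- The subgraph consisting of the edges of the cycle with index in `N` and of the paths `P t`. Its
vertices are the ends of its edges. -/
def withPaths {κ : Type*} (N : Set (ZMod n)) {u w : κ → ZMod n}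
    (P : ∀ t, G.Walk (f (u t)) (f (w t))) : G.Subgraph where
  verts := {x | ∃ y, (∃ e ∈ N, s(x, y) = s(f e, f (e + 1))) ∨ ∃ t, (P t).toSubgraph.Adj x y}
  Adj x y := (∃ e ∈ N, s(x, y) = s(f e, f (e + 1))) ∨ ∃ t, (P t).toSubgraph.Adj x y
  adj_sub h := by
    rcases h with ⟨e, -, h⟩ | ⟨t, h⟩
    · exact ((hf.adj_iff _ _).2 ⟨e, h⟩).adj_sub
    · exact h.adj_sub
  edge_vert h := ⟨_, h⟩
  symm := ⟨fun x y h => by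
    rw [Sym2.eq_swap]
    rcases h with h | ⟨t, h⟩
    · exact Or.inl h
    · exact Or.inr ⟨t, h.symm⟩⟩

end CycleParam

lemma Walk.reachable_of_mem_support {H : SimpleGraph V} {a b x : V} (p : G.Walk a b)
    (hp : ∀ y z, p.toSubgraph.Adj y z → H.Adj y z) (hx : x ∈ p.support) : H.Reachable a x := by
  classical
  refine ⟨(p.takeUntil x hx).transfer H fun e he => ?_⟩
  have he' := p.edges_takeUntil_subset_edges hx he
  rw [← Walk.mem_edges_toSubgraph] at he'
  induction e with
  | _ y z => exact hp y z he'

namespace CycleParam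

variable {L : G.Subgraph} {f : ZMod n → V} (hf : CycleParam L f)

/-- The subgraph given by `N` and the paths `P` is a cycle: its vertices have degree two, and any
component with an edge is everything, because the edges of `L` in that component form a set `Y` that
is compatible with `N`. -/
theorem isCycleSubgraph_withPaths [Finite V] {κ : Type*} {N : Set (ZMod n)} {u w : κ → ZMod n}
    {P : ∀ t, G.Walk (f (u t)) (f (w t))} (huw : ∀ t, u t ≠ w t) (hP : ∀ t, (P t).IsPath)
    (hint : ∀ t, ∀ x ∈ (P t).support, x ∈ L.verts → x = f (u t) ∨ x = f (w t))
    (hdisj : ∀ t t', t ≠ t' → ∀ x ∈ (P t).support, x ∉ (P t').support)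
    (hPL : ∀ t x y, (P t).toSubgraph.Adj x y → ¬L.Adj x y)
    (hbd : ∀ v, v ∈ boundary N ↔ ∃ t, v = u t ∨ v = w t) (hne : (boundary N).Nonempty)
    (hgood : ∀ Y ⊆ N, boundary Y ⊆ boundary N → (∀ t, u t ∈ boundary Y ↔ w t ∈ boundary Y) →
      Y = ∅ ∨ Y = N) : IsCycleSubgraph (hf.withPaths N P) := by
  classical
  have := Fintype.ofFinite V
  set C := hf.withPaths N P with hC
  set H := C.spanningCoe with hH
  have hadj : ∀ x y, H.Adj x y ↔
      (∃ e ∈ N, s(x, y) = s(f e, f (e + 1))) ∨ ∃ t, (P t).toSubgraph.Adj x y := fun x y => Iff.rfl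
  have hadjf : ∀ v y, H.Adj (f v) y ↔ ((v ∈ N ∧ y = f (v + 1)) ∨ (v - 1 ∈ N ∧ y = f (v - 1))) ∨
      ∃ t, (P t).toSubgraph.Adj (f v) y := fun v y => by
    rw [hadj, hf.exists_edge_iff]
  have hLadj : ∀ v, L.Adj (f v) (f (v + 1)) := fun v => (hf.adj_iff _ _).2 ⟨v, rfl⟩
  have hLadj' : ∀ v, L.Adj (f v) (f (v - 1)) := fun v => by
    have := (hLadj (v - 1)).symm
    rwa [sub_add_cancel] at this
  have hsupp : ∀ t x y, (P t).toSubgraph.Adj x y → x ∈ (P t).support := fun t x y h =>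
    (P t).mem_verts_toSubgraph.1 h.fst_mem
  have hfL : ∀ v, f v ∈ L.verts := fun v => by rw [hf.verts_eq]; exact ⟨v, rfl⟩
  have hend : ∀ t v, f v ∈ (P t).support → v = u t ∨ v = w t := fun t v h =>
    (hint t _ h (hfL v)).imp (fun h => hf.injective h) fun h => hf.injective h
  have hnil : ∀ t, ¬(P t).Nil := fun t => Walk.not_nil_of_ne fun h => huw t (hf.injective h)
  -- every vertex that is not isolated has degree two
  have hcyc : H.IsCycles := by
    intro x hx
    by_cases hxL : x ∈ L.verts
    · rw [hf.verts_eq] at hxL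
      obtain ⟨v, rfl⟩ := hxL
      by_cases hv : v ∈ boundary N
      · obtain ⟨t, ht⟩ := (hbd v).1 hv
        obtain ⟨z, hz⟩ : ∃ z, (P t).toSubgraph.neighborSet (f v) = {z} := by
          rcases ht with rfl | rfl
          · exact ⟨_, (hP t).neighborSet_toSubgraph_startpoint (hnil t)⟩
          · exact ⟨_, (hP t).neighborSet_toSubgraph_endpoint (hnil t)⟩
        have hzadj : (P t).toSubgraph.Adj (f v) z := by
          have : z ∈ (P t).toSubgraph.neighborSet (f v) := by rw [hz]; rfl
          exact this
        have huniq : ∀ y, (∃ t, (P t).toSubgraph.Adj (f v) y) ↔ y = z := by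
          intro y
          constructor
          · rintro ⟨t', h'⟩
            have : t' = t := by
              by_contra hne
              exact hdisj _ _ hne _ (hsupp _ _ _ h') (hsupp _ _ _ hzadj)
            subst this
            have : y ∈ (P t').toSubgraph.neighborSet (f v) := h'
            rwa [hz] at this
          · rintro rfl; exact ⟨t, hzadj⟩
        by_cases hvN : v ∈ N
        · have hvN' : v - 1 ∉ N := by
            rw [mem_boundary] at hv
            tauto
          have : H.neighborSet (f v) = {f (v + 1), z} := by
            ext y
            rw [mem_neighborSet, hadjf, huniq]
            simp [hvN, hvN']
          rw [this, Set.ncard_pair]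
          rintro rfl
          exact hPL t _ _ hzadj (hLadj v)
        · have hvN' : v - 1 ∈ N := by
            rw [mem_boundary] at hv
            tauto
          have : H.neighborSet (f v) = {f (v - 1), z} := by
            ext y
            rw [mem_neighborSet, hadjf, huniq]
            simp [hvN, hvN']
          rw [this, Set.ncard_pair]
          rintro rfl
          exact hPL t _ _ hzadj (hLadj' v)
      · have hno : ∀ y, ¬∃ t, (P t).toSubgraph.Adj (f v) y := by
          rintro y ⟨t, ht⟩
          exact hv ((hbd v).2 ⟨t, hend t v (hsupp _ _ _ ht)⟩)
        obtain ⟨y, hy⟩ := hx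
        rw [mem_neighborSet, hadjf] at hy
        have hvv : v ∈ N ∧ v - 1 ∈ N := by
          rw [mem_boundary, not_not] at hv
          have := hno y
          tauto
        have : H.neighborSet (f v) = {f (v + 1), f (v - 1)} := by
          ext y
          rw [mem_neighborSet, hadjf]
          simp [hvv, hno]
        rw [this, Set.ncard_pair]
        exact fun h => hf.sub_one_ne_add_one v (hf.injective h).symm
    · obtain ⟨y, hy⟩ := hx
      have hnoL : ∀ y, ¬∃ e ∈ N, s(x, y) = s(f e, f (e + 1)) := by
        rintro y ⟨e, -, he⟩
        exact hxL ((hf.adj_iff _ _).2 ⟨e, he⟩).fst_mem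
      obtain ⟨t, ht⟩ := ((hadj x y).1 hy).resolve_left (hnoL y)
      have hnb : H.neighborSet x = (P t).toSubgraph.neighborSet x := by
        ext z
        rw [mem_neighborSet, hadj]
        constructor
        · rintro (h | ⟨t', h'⟩)
          · exact (hnoL z h).elim
          · have : t' = t := by
              by_contra hne
              exact hdisj _ _ hne _ (hsupp _ _ _ h') (hsupp _ _ _ ht)
            subst this
            exact h'
        · exact fun h => Or.inr ⟨t, h⟩
      obtain ⟨i, hi, hil⟩ := Walk.mem_support_iff_exists_getVert.1 (hsupp _ _ _ ht)
      rw [hnb, ← hi]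
      apply (hP t).ncard_neighborSet_toSubgraph_internal_eq_two
      · rintro rfl
        rw [Walk.getVert_zero] at hi
        exact hxL (hi ▸ hfL _)
      · refine lt_of_le_of_ne hil ?_
        rintro rfl
        rw [Walk.getVert_length] at hi
        exact hxL (hi ▸ hfL _)
  obtain ⟨v, hv⟩ := hne
  have hvn : (H.neighborSet (f v)).Nonempty := by
    rw [mem_boundary] at hv
    by_cases hvN : v ∈ N
    · exact ⟨f (v + 1), (hadjf _ _).2 (Or.inl (Or.inl ⟨hvN, rfl⟩))⟩
    · exact ⟨f (v - 1), (hadjf _ _).2 (Or.inl (Or.inr ⟨by tauto, rfl⟩))⟩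
  obtain ⟨p, hp, -⟩ := hcyc.exists_cycle_toSubgraph_verts_eq_connectedComponentSupp
    (c := H.connectedComponentMk (f v)) rfl hvn
  set D := p.toSubgraph with hD
  have : LocallyFinite H := fun x => Fintype.ofFinite _
  have hDadj : ∀ x ∈ D.verts, ∀ y, D.Adj x y ↔ H.Adj x y := fun x hx =>
    hp.adj_toSubgraph_iff_of_isCycles hcyc hx
  have hclosed : ∀ x ∈ D.verts, ∀ y, H.Adj x y → y ∈ D.verts := fun x hx y hxy =>
    ((hDadj x hx y).2 hxy).snd_mem
  have hvD : f v ∈ D.verts := p.start_mem_verts_toSubgraph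
  have hNadj : ∀ e ∈ N, H.Adj (f e) (f (e + 1)) := fun e he =>
    (hadjf _ _).2 (Or.inl (Or.inl ⟨he, rfl⟩))
  -- the edges of `L` on the cycle `p`
  set Y : Set (ZMod n) := {e | e ∈ N ∧ f e ∈ D.verts} with hY
  have hY' : ∀ e, e ∈ Y ↔ e ∈ N ∧ f (e + 1) ∈ D.verts := fun e =>
    and_congr_right fun he => ⟨fun h => hclosed _ h _ (hNadj e he),
      fun h => hclosed _ h _ (hNadj e he).symm⟩
  have hYb : ∀ x, x ∈ boundary Y ↔ x ∈ boundary N ∧ f x ∈ D.verts := by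
    intro x
    have h1 : x - 1 ∈ Y ↔ x - 1 ∈ N ∧ f x ∈ D.verts := by rw [hY', sub_add_cancel]
    have h2 : x ∈ Y ↔ x ∈ N ∧ f x ∈ D.verts := Iff.rfl
    rw [mem_boundary, mem_boundary, h1, h2]
    tauto
  have hreach : ∀ t, ∀ x ∈ (P t).support, H.Reachable (f (u t)) x := fun t x hx =>
    Walk.reachable_of_mem_support (P t) (fun y z h => Or.inr ⟨t, h⟩) hx
  have hYN : Y = N := by
    refine (hgood Y (fun e he => he.1) (fun x hx => ((hYb x).1 hx).1) fun t => ?_).resolve_left ?_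
    · have h1 := hreach t _ (P t).end_mem_support
      have h2 : u t ∈ boundary N := (hbd _).2 ⟨t, Or.inl rfl⟩
      have h3 : w t ∈ boundary N := (hbd _).2 ⟨t, Or.inr rfl⟩
      rw [hYb, hYb]
      simp only [h2, h3, true_and]
      exact ⟨fun h => h1.mem_of_adj_closed hclosed h, fun h => h1.symm.mem_of_adj_closed hclosed h⟩
    · intro h0
      have : v ∈ boundary Y := (hYb v).2 ⟨hv, hvD⟩
      rw [h0, boundary_empty] at this
      exact this
  have hPD : ∀ t, ∀ x ∈ (P t).support, x ∈ D.verts := by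
    intro t x hx
    have h2 : u t ∈ boundary Y := by rw [hYN]; exact (hbd _).2 ⟨t, Or.inl rfl⟩
    exact (hreach t x hx).mem_of_adj_closed hclosed ((hYb _).1 h2).2
  have hHD : ∀ x y, H.Adj x y → x ∈ D.verts := by
    intro x y h
    rcases (hadj x y).1 h with ⟨e, he, hxy⟩ | ⟨t, ht⟩
    · have h1 : e ∈ Y := hYN ▸ he
      rcases Sym2.eq_iff.1 hxy with ⟨rfl, -⟩ | ⟨rfl, -⟩
      · exact h1.2
      · exact ((hY' e).1 h1).2
    · exact hPD t x (hsupp _ _ _ ht)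
  have hle : H ≤ G := C.spanningCoe_le
  refine ⟨f v, p.mapLe hle, hp.mapLe hle, ?_⟩
  ext x y
  · rw [Walk.mem_verts_toSubgraph, Walk.support_mapLe_eq_support, ← Walk.mem_verts_toSubgraph]
    constructor
    · intro hx
      have h2 := hp.ncard_neighborSet_toSubgraph_eq_two (p.mem_verts_toSubgraph.1 hx)
      obtain ⟨y, hy⟩ := Set.nonempty_of_ncard_ne_zero (s := p.toSubgraph.neighborSet x) (by omega)
      exact ⟨y, hy.adj_sub⟩
    · rintro ⟨y, hy⟩
      exact hHD x y hy
  · rw [Walk.adj_toSubgraph_mapLe]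
    constructor
    · exact fun h => h.adj_sub
    · exact fun h => (hDadj x (hHD x y h) y).2 h

end CycleParam

end CycleBridges

/-! ### Overlapping bridges and crossing sets -/

namespace CycleBridges

open SimpleGraph

variable {V : Type*} {G : SimpleGraph V} {n : ℕ}

lemma mem_iff_of_forall_notMem_boundary {X : Set (ZMod n)} (a : ZMod n) {m : ℕ}
    (h : ∀ k : ℕ, 0 < k → k < m → a + k ∉ boundary X) : ∀ k : ℕ, k < m → (a + k ∈ X ↔ a ∈ X) := by
  intro k
  induction k with
  | zero => simp
  | succ k ih =>
    intro hk
    rw [← ih (by omega)]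
    have := h (k + 1) (by omega) hk
    rw [mem_boundary, not_not] at this
    rw [← this]
    push_cast
    rw [add_sub_assoc, add_sub_cancel_right]

/-- Sets that lie in complementary closed arcs, sharing at most the two ends, do not cross. -/
lemma not_cross_of_val_le [NeZero n] {A B : Set (ZMod n)} {m : ℕ} (x : ZMod n)
    (hA : ∀ a ∈ A, (a - x).val ≤ m) (hB : ∀ b ∈ B, (b - x).val = 0 ∨ m ≤ (b - x).val) :
    ¬Cross A B := by
  rintro ⟨a, ha, a', ha', b, hb, b', hb', hc⟩
  have hrel : ∀ v w : ZMod n, (v - w).val = if (w - x).val ≤ (v - x).val then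
      (v - x).val - (w - x).val else n + (v - x).val - (w - x).val := by
    intro v w
    have := val_sub_eq (v - x) (w - x)
    rwa [sub_sub_sub_cancel_right] at this
  rw [hrel b a, hrel a' a, hrel b' a] at hc
  have := ZMod.val_lt (a - x)
  have := ZMod.val_lt (a' - x)
  have := ZMod.val_lt (b - x)
  have := ZMod.val_lt (b' - x)
  have := hA a ha
  have := hA a' ha'
  have := hB b hb
  have := hB b' hb'
  split_ifs at hc <;> omega

namespace CycleParam

variable {L : G.Subgraph} {f : ZMod n → V} (hf : CycleParam L f)
include hf

lemma adj_add_one (v : ZMod n) : L.Adj (f v) (f (v + 1)) := (hf.adj_iff _ _).2 ⟨v, rfl⟩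

lemma apply_mem_verts (v : ZMod n) : f v ∈ L.verts := hf.verts_eq ▸ ⟨v, rfl⟩

lemma adj_apply_iff (v : ZMod n) (y : V) : L.Adj (f v) y ↔ y = f (v + 1) ∨ y = f (v - 1) := by
  have := hf.exists_edge_iff (N := Set.univ) v y
  simp only [Set.mem_univ, true_and] at this
  rw [hf.adj_iff, this]

variable [NeZero n]

/-- The path along the cycle that starts at `f a` and has `k < n` edges. -/
lemma exists_arcWalk (a : ZMod n) (k : ℕ) (hk : k < n) (b : ZMod n) (hb : b = a + k) :
    ∃ p : G.Walk (f a) (f b), p.IsPath ∧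
      (∀ x, x ∈ p.toSubgraph.verts ↔ ∃ v, (v - a).val ≤ k ∧ x = f v) ∧
      ∀ x y, p.toSubgraph.Adj x y ↔ ∃ e, (e - a).val < k ∧ s(x, y) = s(f e, f (e + 1)) := by
  induction k generalizing b with
  | zero =>
    obtain rfl : b = a := by simpa using hb
    refine ⟨Walk.nil, Walk.IsPath.nil, fun x => ?_, fun x y => by simp⟩
    simp only [Walk.toSubgraph, singletonSubgraph_verts, Set.mem_singleton_iff, nonpos_iff_eq_zero,
      ZMod.val_eq_zero, sub_eq_zero]
    exact ⟨fun h => ⟨_, rfl, h⟩, by rintro ⟨v, rfl, h⟩; exact h⟩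
  | succ k ih =>
    obtain ⟨p, hp, hv, ha⟩ := ih (by omega) (a + k) rfl
    have hb' : b = a + k + 1 := by rw [hb]; push_cast; ring
    subst hb'
    have hval : ∀ v : ZMod n, (v - a).val = k + 1 ↔ v = a + k + 1 := by
      intro v
      rw [← ZMod.val_natCast_of_lt hk, (ZMod.val_injective n).eq_iff, sub_eq_iff_eq_add]
      push_cast
      exact ⟨fun h => by rw [h]; ring, fun h => by rw [h]; ring⟩
    have hval' : ∀ v : ZMod n, (v - a).val = k ↔ v = a + k := by
      intro v
      conv_lhs => rw [← ZMod.val_natCast_of_lt (show k < n by omega)]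
      rw [(ZMod.val_injective n).eq_iff, sub_eq_iff_eq_add]
      exact ⟨fun h => by rw [h]; ring, fun h => by rw [h]; ring⟩
    refine ⟨p.concat (hf.adj_add_one (a + k)).adj_sub, ?_, fun x => ?_, fun x y => ?_⟩
    · rw [Walk.concat_isPath_iff]
      refine ⟨hp, fun h => ?_⟩
      obtain ⟨v, h1, h2⟩ := (hv _).1 (p.mem_verts_toSubgraph.2 h)
      rw [← hf.injective h2, (hval _).2 rfl] at h1
      omega
    · rw [Walk.mem_verts_toSubgraph, Walk.support_concat, List.mem_append,
        ← p.mem_verts_toSubgraph, hv, List.mem_singleton]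
      constructor
      · rintro (⟨v, h, rfl⟩ | rfl)
        · exact ⟨v, by omega, rfl⟩
        · exact ⟨_, ((hval _).2 rfl).le, rfl⟩
      · rintro ⟨v, h, rfl⟩
        by_cases h' : (v - a).val = k + 1
        · exact Or.inr (by rw [(hval v).1 h'])
        · exact Or.inl ⟨v, by omega, rfl⟩
    · rw [← Subgraph.mem_edgeSet, Walk.mem_edges_toSubgraph, Walk.edges_concat,
        List.concat_eq_append, List.mem_append, ← Walk.mem_edges_toSubgraph, Subgraph.mem_edgeSet,
        ha, List.mem_singleton]
      constructor
      · rintro (⟨v, h, h'⟩ | h')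
        · exact ⟨v, by omega, h'⟩
        · exact ⟨_, by rw [(hval' _).2 rfl]; omega, h'⟩
      · rintro ⟨v, h, h'⟩
        by_cases h'' : (v - a).val = k
        · exact Or.inr (by rw [h', (hval' v).1 h''])
        · exact Or.inl ⟨v, by omega, h'⟩

/-- If `A₁` and `A₂` do not cross, then `A₂` lies in one arc of `A₁`, and this arc and the rest of
the cycle are two paths that show that the bridges do not overlap. -/
theorem cross_of_overlap {B₁ B₂ : G.Subgraph} {A₁ A₂ : Set (ZMod n)}
    (h₁ : attachments L B₁ = f '' A₁) (h₂ : attachments L B₂ = f '' A₂) (hd : Disjoint A₁ A₂)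
    (hA₁ : A₁.Nontrivial) (hA₂ : A₂.Nonempty) (h : Overlap L B₁ B₂) : Cross A₁ A₂ := by
  by_contra hc
  apply h
  obtain ⟨y, hy⟩ := hA₂
  set a := arcStart A₁ y with ha
  have haA : a ∈ A₁ := arcStart_mem hA₁.nonempty y
  have hconst : ∀ v ∈ A₂, arcStart A₁ v = a := by
    intro v hv
    by_contra hne
    exact hc (cross_of_arcStart_ne hd hA₁.nonempty hv hy hne)
  obtain ⟨σ, hσ⟩ := exists_arcNext hA₁.nonempty
  set b : ZMod n := ((σ ⟨a, haA⟩ : A₁) : ZMod n) with hb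
  have hbA : b ∈ A₁ := (σ ⟨a, haA⟩).2
  have hba : b ≠ a := fun h => IsNext.ne_self hσ hA₁ ⟨a, haA⟩ (Subtype.ext h)
  have hab1 : arcStart A₁ (b - 1) = a := hσ ⟨a, haA⟩
  have hpos : 0 < (b - a).val := by
    rw [Nat.pos_iff_ne_zero, Ne, ZMod.val_eq_zero, sub_eq_zero]
    exact hba
  have hneg : (a - b).val = n - (b - a).val := by
    have := val_sub_eq a b
    have := val_sub_eq b a
    have := ZMod.val_lt a
    have := ZMod.val_lt b
    split_ifs at * <;> omega
  have htr : ∀ v : ZMod n, (v - b).val =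
      if (b - a).val ≤ (v - a).val then (v - a).val - (b - a).val
      else n + (v - a).val - (b - a).val := by
    intro v
    have := val_sub_eq (v - a) (b - a)
    rwa [sub_sub_sub_cancel_right] at this
  obtain ⟨q, hq, hqv, hqa⟩ := hf.exists_arcWalk a (b - a).val (ZMod.val_lt _) b (by simp)
  obtain ⟨p, hp, hpv, hpa⟩ := hf.exists_arcWalk b (a - b).val (ZMod.val_lt _) a (by simp)
  have hlt := ZMod.val_lt (b - a)
  refine ⟨f a, f b, p.reverse, q, hp.reverse, hq, ?_, ?_, ?_, ?_⟩
  · rw [Walk.toSubgraph_reverse]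
    ext x z
    · rw [Subgraph.verts_sup, Set.mem_union, hpv, hqv, hf.verts_eq]
      constructor
      · rintro (⟨v, -, rfl⟩ | ⟨v, -, rfl⟩) <;> exact ⟨v, rfl⟩
      · rintro ⟨v, rfl⟩
        by_cases h : (v - a).val ≤ (b - a).val
        · exact Or.inr ⟨v, h, rfl⟩
        · refine Or.inl ⟨v, ?_, rfl⟩
          have := htr v
          have := ZMod.val_lt (v - a)
          rw [if_pos (by omega)] at *
          omega
    · rw [Subgraph.sup_adj, hpa, hqa, hf.adj_iff]
      constructor
      · rintro (⟨v, -, h⟩ | ⟨v, -, h⟩) <;> exact ⟨v, h⟩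
      · rintro ⟨v, h'⟩
        by_cases h : (v - a).val < (b - a).val
        · exact Or.inr ⟨v, h, h'⟩
        · refine Or.inl ⟨v, ?_, h'⟩
          have := htr v
          have := ZMod.val_lt (v - a)
          rw [if_pos (by omega)] at *
          omega
  · rw [Walk.toSubgraph_reverse, Set.disjoint_left]
    intro e
    induction e with
    | _ x z =>
      rw [Subgraph.mem_edgeSet, Subgraph.mem_edgeSet, hpa, hqa]
      rintro ⟨v, hv, h⟩ ⟨v', hv', h'⟩
      obtain rfl := (hf.edge_eq_iff _ _).1 (h.symm.trans h')
      rw [htr v, if_neg (by omega)] at hv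
      omega
  · rw [h₁, Walk.toSubgraph_reverse]
    rintro _ ⟨x, hx, rfl⟩
    refine (hpv _).2 ⟨x, ?_, rfl⟩
    by_cases hxb : x = b
    · subst hxb; simp
    · have h3 := arcStart_val_le hx (b - 1)
      rw [hab1] at h3
      have h4 : (b - 1 - a).val + 1 = (b - a).val := by
        rw [← val_sub_one (sub_ne_zero.2 hba)]; congr 2; ring
      have h5 : (b - 1 - x).val + 1 = (b - x).val := by
        rw [← val_sub_one (sub_ne_zero.2 (Ne.symm hxb))]; congr 2; ring
      have h6 := htr x
      have h7 := val_sub_eq (b - a) (x - a)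
      rw [sub_sub_sub_cancel_right] at h7
      have := ZMod.val_lt (x - a)
      split_ifs at * <;> omega
  · rw [h₂]
    rintro _ ⟨v, hv, rfl⟩
    refine (hqv _).2 ⟨v, ?_, rfl⟩
    have h3 := arcStart_val_le hbA v
    rw [hconst v hv, htr v] at h3
    split_ifs at h3 <;> omega

omit [NeZero n] in
/-- A path in `L` contains both edges of `L` at each of its inner vertices. -/
lemma mem_of_mem_interior {x y v : ZMod n} {p : G.Walk (f x) (f y)} (hp : p.IsPath)
    (hpL : p.toSubgraph ≤ L) (hv : f v ∈ p.toSubgraph.verts) (hx : v ≠ x) (hy : v ≠ y) :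
    p.toSubgraph.Adj (f (v - 1)) (f v) ∧ p.toSubgraph.Adj (f v) (f (v + 1)) := by
  obtain ⟨i, hi, hil⟩ := Walk.mem_support_iff_exists_getVert.1 (p.mem_verts_toSubgraph.1 hv)
  have h2 : (p.toSubgraph.neighborSet (p.getVert i)).ncard = 2 := by
    apply hp.ncard_neighborSet_toSubgraph_internal_eq_two
    · rintro rfl
      rw [Walk.getVert_zero] at hi
      exact hx (hf.injective hi.symm)
    · refine lt_of_le_of_ne hil ?_
      rintro rfl
      rw [Walk.getVert_length] at hi
      exact hy (hf.injective hi.symm)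
  rw [hi] at h2
  have h3 : p.toSubgraph.neighborSet (f v) = {f (v + 1), f (v - 1)} := by
    apply Set.eq_of_subset_of_ncard_le
    · intro z hz
      exact (hf.adj_apply_iff v z).1 (hpL.2 hz)
    · rw [h2]
      exact (Set.ncard_insert_le _ _).trans (by rw [Set.ncard_singleton])
    · exact Set.toFinite _
  have h4 : f (v + 1) ∈ p.toSubgraph.neighborSet (f v) := by rw [h3]; simp
  have h5 : f (v - 1) ∈ p.toSubgraph.neighborSet (f v) := by rw [h3]; simp
  exact ⟨h5.symm, h4⟩

theorem overlap_of_cross {B₁ B₂ : G.Subgraph} {A₁ A₂ : Set (ZMod n)}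
    (h₁ : attachments L B₁ = f '' A₁) (h₂ : attachments L B₂ = f '' A₂) (h : Cross A₁ A₂) :
    Overlap L B₁ B₂ := by
  rintro ⟨x, y, p, q, hp, hq, hpq, hdis, hAp, hAq⟩
  have hpL : p.toSubgraph ≤ L := hpq ▸ le_sup_left
  have hqL : q.toSubgraph ≤ L := hpq ▸ le_sup_right
  obtain ⟨x, rfl⟩ : ∃ v, f v = x := by
    have := hpL.1 p.start_mem_verts_toSubgraph
    rwa [hf.verts_eq] at this
  obtain ⟨y, rfl⟩ : ∃ v, f v = y := by
    have := hpL.1 p.end_mem_verts_toSubgraph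
    rwa [hf.verts_eq] at this
  -- the edges of `p`, as positions on `L`
  set X : Set (ZMod n) := {e | p.toSubgraph.Adj (f e) (f (e + 1))} with hX
  have hXq : ∀ e, e ∉ X ↔ q.toSubgraph.Adj (f e) (f (e + 1)) := by
    intro e
    have h1 : (p.toSubgraph ⊔ q.toSubgraph).Adj (f e) (f (e + 1)) := hpq ▸ hf.adj_add_one e
    rw [Subgraph.sup_adj] at h1
    exact ⟨fun h => h1.resolve_left h, fun h2 h3 => Set.disjoint_left.1 hdis
      (Subgraph.mem_edgeSet.2 h3) (Subgraph.mem_edgeSet.2 h2)⟩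
  have hbdp : ∀ v, f v ∈ p.toSubgraph.verts → v ≠ x → v ≠ y → v - 1 ∈ X ∧ v ∈ X := by
    intro v hv hx hy
    have := hf.mem_of_mem_interior hp hpL hv hx hy
    refine ⟨?_, this.2⟩
    rw [hX, Set.mem_ofPred, sub_add_cancel]
    exact this.1
  have hbdq : ∀ v, f v ∈ q.toSubgraph.verts → v ≠ x → v ≠ y → v - 1 ∉ X ∧ v ∉ X := by
    intro v hv hx hy
    have := hf.mem_of_mem_interior hq hqL hv hx hy
    rw [hXq, hXq, sub_add_cancel]
    exact this
  have hbd : ∀ v ∈ boundary X, v = x ∨ v = y := by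
    intro v hv
    by_contra! hne
    have h1 : f v ∈ (p.toSubgraph ⊔ q.toSubgraph).verts := hpq ▸ hf.apply_mem_verts v
    rw [mem_boundary] at hv
    rcases h1 with h1 | h1
    · have := hbdp v h1 hne.1 hne.2; tauto
    · have := hbdq v h1 hne.1 hne.2; tauto
  have hxy : x ≠ y := by
    rintro rfl
    rw [Walk.isPath_iff_nil, ← Walk.eq_nil_iff_nil] at hp hq
    have h1 := hf.adj_add_one 0
    rw [← hpq, hp, hq] at h1
    simp at h1
  have hedge : ∀ r : G.Walk (f x) (f y), r.toSubgraph ≤ L →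
      ∃ e, r.toSubgraph.Adj (f e) (f (e + 1)) := by
    intro r hr
    have h1 := r.toSubgraph_adj_snd (Walk.not_nil_of_ne (hf.injective.ne hxy))
    obtain ⟨e, he⟩ := (hf.adj_iff _ _).1 (hr.2 h1)
    exact ⟨e, by rwa [← Subgraph.mem_edgeSet, ← he, Subgraph.mem_edgeSet]⟩
  have hcoe : ∀ a e : ZMod n, a + ((e - a).val : ℕ) = e := fun a e => by simp
  have htr : ∀ v : ZMod n, (v - y).val =
      if (y - x).val ≤ (v - x).val then (v - x).val - (y - x).val
      else n + (v - x).val - (y - x).val := by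
    intro v
    have := val_sub_eq (v - x) (y - x)
    rwa [sub_sub_sub_cancel_right] at this
  have hval : ∀ a : ZMod n, ∀ k : ℕ, k < n → (a + k - a).val = k := by
    intro a k hk
    rw [add_sub_cancel_left, ZMod.val_natCast_of_lt hk]
  have hlt := ZMod.val_lt (y - x)
  -- `X` is constant on each of the two arcs between `x` and `y`
  have hcx : ∀ e, (e - x).val < (y - x).val → (e ∈ X ↔ x ∈ X) := by
    intro e he
    have := mem_iff_of_forall_notMem_boundary (X := X) x (m := (y - x).val) (fun k h0 hk hb => by
      have h3 := hval x k (by omega)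
      rcases hbd _ hb with h | h <;> rw [h] at h3
      · rw [sub_self, ZMod.val_zero] at h3; omega
      · omega) _ he
    rwa [hcoe] at this
  have hcy : ∀ e, (y - x).val ≤ (e - x).val → (e ∈ X ↔ y ∈ X) := by
    intro e he
    have h4 := ZMod.val_lt (e - x)
    have h5 := htr e
    rw [if_pos he] at h5
    have h6 := htr x
    rw [sub_self, ZMod.val_zero, if_neg (by
      rw [nonpos_iff_eq_zero, ZMod.val_eq_zero, sub_eq_zero]; exact hxy.symm)] at h6
    have := mem_iff_of_forall_notMem_boundary (X := X) y (m := n - (y - x).val)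
      (fun k h0 hk hb => by
        have h3 := hval y k (by omega)
        rcases hbd _ hb with h | h <;> rw [h] at h3
        · omega
        · rw [sub_self, ZMod.val_zero] at h3; omega) (e - y).val (by omega)
    rwa [hcoe] at this
  have hne : x ∈ X ↔ y ∉ X := by
    obtain ⟨e, he⟩ := hedge p hpL
    obtain ⟨e', he'⟩ := hedge q hqL
    rw [← hXq] at he'
    have h1 := hcx e
    have h2 := hcy e
    have h3 := hcx e'
    have h4 := hcy e'
    have h5 : e ∈ X := he
    rcases lt_or_ge (e - x).val (y - x).val with h | h <;>
      rcases lt_or_ge (e' - x).val (y - x).val with h' | h' <;>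
      simp only [h, h', true_imp_iff] at * <;> tauto
  have hap : ∀ a ∈ A₁, a ≠ x → a ≠ y → a ∈ X := fun a ha h1 h2 =>
    (hbdp a (hAp (h₁ ▸ ⟨a, ha, rfl⟩)) h1 h2).2
  have hbq : ∀ b ∈ A₂, b ≠ x → b ≠ y → b ∉ X := fun b hb h1 h2 =>
    (hbdq b (hAq (h₂ ▸ ⟨b, hb, rfl⟩)) h1 h2).2
  have hloc : ∀ a, a = x ∨ a = y ∨ a ≠ x ∧ a ≠ y ∧
      ((a - x).val < (y - x).val ∧ (a ∈ X ↔ x ∈ X) ∨ (y - x).val ≤ (a - x).val ∧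
      (a ∈ X ↔ y ∈ X)) := by
    intro a
    have := hcx a
    have := hcy a
    rcases lt_or_ge (a - x).val (y - x).val with h | h <;> tauto
  by_cases hxX : x ∈ X
  · have hyX : y ∉ X := hne.1 hxX
    refine not_cross_of_val_le (m := (y - x).val) x (fun a ha => ?_) (fun b hb => ?_) h
    · rcases hloc a with rfl | rfl | ⟨h1, h2, h3⟩
      · simp
      · exact le_rfl
      · rcases h3 with h3 | h3
        · exact h3.1.le
        · exact absurd (h3.2.1 (hap a ha h1 h2)) hyX
    · rcases hloc b with rfl | rfl | ⟨h1, h2, h3⟩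
      · simp
      · exact Or.inr le_rfl
      · rcases h3 with h3 | h3
        · exact absurd (h3.2.2 hxX) (hbq b hb h1 h2)
        · exact Or.inr h3.1
  · have hyX : y ∈ X := by_contra fun hy => hxX (hne.2 hy)
    refine not_cross_of_val_le (m := (y - x).val) x (fun b hb => ?_) (fun a ha => ?_) h.symm
    · rcases hloc b with rfl | rfl | ⟨h1, h2, h3⟩
      · simp
      · exact le_rfl
      · rcases h3 with h3 | h3
        · exact h3.1.le
        · exact absurd (h3.2.2 hyX) (hbq b hb h1 h2)
    · rcases hloc a with rfl | rfl | ⟨h1, h2, h3⟩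
      · simp
      · exact Or.inr le_rfl
      · rcases h3 with h3 | h3
        · exact absurd (h3.2.1 (hap a ha h1 h2)) hxX
        · exact Or.inr h3.1

end CycleParam

end CycleBridges

/-! ### Tree bridges and the family of cycles -/

namespace CycleBridges

open SimpleGraph

variable {V : Type*} {G : SimpleGraph V}

/-- For an edge `xy` of a finite forest, a longest path that starts with `y, x` ends in a leaf on
the side of `x`. -/
lemma exists_leaf_of_adj {W : Type*} [Finite W] {H : SimpleGraph W} (hH : H.IsAcyclic) {x y : W}
    (h : H.Adj x y) : ∃ v, (∃! w, H.Adj v w) ∧ ∃ p : H.Walk x v, y ∉ p.support := by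
  classical
  have := Fintype.ofFinite W
  obtain ⟨k, ⟨v, p, hp, hy, hk⟩, hmax⟩ : ∃ k, (∃ v, ∃ p : H.Walk x v, p.IsPath ∧ y ∉ p.support ∧
      p.length = k) ∧ ∀ l, k < l → ¬∃ v, ∃ p : H.Walk x v, p.IsPath ∧ y ∉ p.support ∧
      p.length = l := by
    let Q : ℕ → Prop := fun k => ∃ v, ∃ p : H.Walk x v, p.IsPath ∧ y ∉ p.support ∧ p.length = k
    have hQ : Q 0 := ⟨x, Walk.nil, Walk.IsPath.nil, by simpa using h.ne', rfl⟩
    have hb : ∀ l, Q l → l ≤ Fintype.card W := by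
      rintro l ⟨v, p, hp, -, rfl⟩
      exact hp.length_lt.le
    refine ⟨Nat.findGreatest Q (Fintype.card W), Nat.findGreatest_spec (Nat.zero_le _) hQ, ?_⟩
    exact fun l hl hl' => Nat.findGreatest_is_greatest hl (hb l hl') hl'
  refine ⟨v, ?_, p, hy⟩
  have hP : (Walk.cons h.symm p).IsPath := hp.cons hy
  refine ⟨(Walk.cons h.symm p).penultimate, ((Walk.cons h.symm p).adj_penultimate (by simp)).symm,
    fun w hw => ?_⟩
  refine hH.eq_penultimate_of_adj_end hP hw ?_
  by_contra hws
  rw [Walk.support_cons, List.mem_cons, not_or] at hws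
  refine hmax (k + 1) (Nat.lt_succ_self k) ⟨w, p.concat hw, ?_, ?_, ?_⟩
  · exact (Walk.concat_isPath_iff _).2 ⟨hp, hws.2⟩
  · rw [Walk.support_concat, List.mem_append, List.mem_singleton]
    exact fun h' => h'.elim hy (Ne.symm hws.1)
  · rw [Walk.length_concat, hk]

/-- Removing an edge separates a tree into two parts, each containing a leaf of the tree. -/
lemma exists_separation [Finite V] {T : G.Subgraph} (hT : T.coe.IsAcyclic) {x y : V}
    (h : T.Adj x y) : ∃ S : Set V, (∀ v w, T.Adj v w → v ∈ S → w ∉ S → s(v, w) = s(x, y)) ∧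
      (∃ a ∈ leaves T, a ∈ S) ∧ ∃ a ∈ leaves T, a ∉ S := by
  classical
  set x' : T.verts := ⟨x, h.fst_mem⟩
  set y' : T.verts := ⟨y, h.snd_mem⟩
  have h' : T.coe.Adj x' y' := h
  set H := T.coe.deleteEdges {s(x', y')} with hH
  have hbr : ¬H.Reachable x' y' := by
    have := isAcyclic_iff_forall_adj_isBridge.1 hT h'
    rwa [isBridge_iff] at this
  have hleaf : ∀ v : T.verts, (∃! w, T.coe.Adj v w) → (v : V) ∈ leaves T := by
    rintro v ⟨w, hw, huniq⟩
    exact ⟨w, hw, fun z hz => congrArg Subtype.val (huniq ⟨z, hz.snd_mem⟩ hz)⟩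
  have hreach : ∀ {a b v : T.verts} (p : T.coe.Walk a v), s(a, b) = s(x', y') →
      b ∉ p.support → H.Reachable a v := by
    intro a b v p hab hb
    refine ⟨p.toDeleteEdge s(x', y') fun he => hb ?_⟩
    rw [← hab] at he
    exact p.snd_mem_support_of_mem_edges he
  obtain ⟨a, ha, p, hp⟩ := exists_leaf_of_adj hT h'
  obtain ⟨b, hb, q, hq⟩ := exists_leaf_of_adj hT h'.symm
  refine ⟨Subtype.val '' {v | H.Reachable x' v}, ?_, ⟨a, hleaf a ha, a, hreach p rfl hp, rfl⟩,
    b, hleaf b hb, ?_⟩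
  · rintro _ w hvw ⟨v, hv, rfl⟩ hw
    by_contra hne
    refine hw ⟨⟨w, hvw.snd_mem⟩, hv.trans (Adj.reachable ?_), rfl⟩
    rw [hH, deleteEdges_adj]
    refine ⟨hvw, fun heq => hne ?_⟩
    exact congrArg (Sym2.map Subtype.val) heq
  · rintro ⟨b', hb', hbb⟩
    obtain rfl := Subtype.ext hbb
    exact hbr (hb'.trans (hreach q Sym2.eq_swap hq).symm)

lemma exists_isPath_le {T : G.Subgraph} (hT : T.coe.Connected) {a b : V} (ha : a ∈ T.verts)
    (hb : b ∈ T.verts) : ∃ p : G.Walk a b, p.IsPath ∧ p.toSubgraph ≤ T := by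
  obtain ⟨p, hp⟩ := hT.exists_isPath ⟨a, ha⟩ ⟨b, hb⟩
  have hle : (p.map T.hom).toSubgraph ≤ T := by
    rw [Walk.toSubgraph_map]
    exact (Subgraph.map_mono le_top).trans (le_of_eq T.map_hom_top)
  exact ⟨p.map T.hom, hp.map T.hom_injective, hle⟩

/-- A path in `T` contains no leaf of `T` apart from its ends. -/
lemma eq_or_eq_of_mem_leaves {T : G.Subgraph} [Finite V] {a b x : V} {p : G.Walk a b}
    (hp : p.IsPath) (hpT : p.toSubgraph ≤ T) (hx : x ∈ p.support) (hxT : x ∈ leaves T) :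
    x = a ∨ x = b := by
  by_contra! hne
  obtain ⟨i, rfl, hi⟩ := Walk.mem_support_iff_exists_getVert.1 hx
  have h2 : (p.toSubgraph.neighborSet (p.getVert i)).ncard = 2 := by
    apply hp.ncard_neighborSet_toSubgraph_internal_eq_two
    · rintro rfl
      exact hne.1 p.getVert_zero
    · refine lt_of_le_of_ne hi ?_
      rintro rfl
      exact hne.2 p.getVert_length
  obtain ⟨w, -, huniq⟩ := hxT
  have h3 : p.toSubgraph.neighborSet (p.getVert i) ⊆ {w} := fun z hz => huniq z (hpT.2 hz)
  have := Set.ncard_le_ncard h3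
  rw [Set.ncard_singleton] at this
  omega

lemma IsBridgeOf.not_adj {L B : G.Subgraph} (hB : IsBridgeOf L B) {x y : V} (h : B.Adj x y) :
    ¬L.Adj x y := by
  intro hL
  rcases hB with ⟨a, b, hab, ha, hb, hn, rfl⟩ | ⟨D, rfl⟩
  · rw [subgraphOfAdj_adj] at h
    rcases Sym2.eq_iff.1 h with ⟨rfl, rfl⟩ | ⟨rfl, rfl⟩
    · exact hn hL
    · exact hn hL.symm
  · rcases h.2 with ⟨z, -, hz⟩ | ⟨z, -, hz⟩
    · exact z.2 (hz ▸ hL.fst_mem)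
    · exact z.2 (hz ▸ hL.snd_mem)

/-- Bridges have edges; for the bridge of a component this uses that the graph is connected. -/
lemma IsBridgeOf.exists_adj {L B : G.Subgraph} (hB : IsBridgeOf L B) (hG : G.Preconnected)
    (hL : L.verts.Nonempty) : ∃ x y, B.Adj x y := by
  rcases hB with ⟨a, b, hab, ha, hb, hn, rfl⟩ | ⟨D, rfl⟩
  · exact ⟨a, b, by simp⟩
  · obtain ⟨d, hd⟩ := D.nonempty_supp
    obtain ⟨l, hl⟩ := hL
    have : Nontrivial V := ⟨d, l, fun h => d.2 (h ▸ hl)⟩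
    obtain ⟨w, hw⟩ := hG.exists_adj_of_nontrivial (d : V)
    exact ⟨d, w, hw, Or.inl ⟨d, hd, rfl⟩⟩

/-- A set `N` as in `DoubleFamily` yields a cycle `C` such that `L △ C` is a cycle too: join the two
boundary vertices of `N` in each bridge by the path in that bridge. If the removal of an edge of a
bridge separates these two vertices, then `C` contains that edge; here `S` is one of the sides. -/
theorem CycleParam.exists_isCycleSubgraph_pair {n : ℕ} [NeZero n] [Finite V] {L : G.Subgraph}
    {f : ZMod n → V} (hf : CycleParam L f) {ι : Type*} {T : ι → G.Subgraph}
    (hT : ∀ i, IsBridgeOf L (T i)) (hdisj : Pairwise fun i j => Disjoint (T i).verts (T j).verts)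
    (htree : ∀ i, (T i).coe.IsTree) (hleaves : ∀ i, leaves (T i) = attachments L (T i))
    {A : ι → Set (ZMod n)} (hA : ∀ i v, v ∈ A i ↔ f v ∈ (T i).verts) {N : Set (ZMod n)}
    (hsub : boundary N ⊆ ⋃ i, A i) (hne : (boundary N).Nonempty)
    (htwo : ∀ i, boundary N ∩ A i = ∅ ∨ (boundary N ∩ A i).ncard = 2)
    (hgood : Good A N) (hgood' : Good A Nᶜ) :
    ∃ C : G.Subgraph, IsCycleSubgraph C ∧ IsCycleSubgraph (symmDiffSubgraph L C) ∧
      C ≤ L ⊔ ⨆ i, T i ∧ (∀ e, C.Adj (f e) (f (e + 1)) ↔ e ∈ N) ∧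
      ∀ i x y (S : Set V), (∀ v w, (T i).Adj v w → v ∈ S → w ∉ S → s(v, w) = s(x, y)) →
        (boundary N ∩ {v | v ∈ A i ∧ f v ∈ S}).ncard = 1 → C.Adj x y := by
  classical
  let κ := {i // (boundary N ∩ A i).Nonempty}
  have hpair : ∀ t : κ, ∃ u w, u ≠ w ∧ boundary N ∩ A t = {u, w} := fun t =>
    Set.ncard_eq_two.1 ((htwo t).resolve_left t.2.ne_empty)
  choose u w huw hpair using hpair
  have hu : ∀ t : κ, u t ∈ boundary N ∩ A t := fun t => by rw [hpair]; simp
  have hw : ∀ t : κ, w t ∈ boundary N ∩ A t := fun t => by rw [hpair]; simp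
  have hpath : ∀ t : κ, ∃ p : G.Walk (f (u t)) (f (w t)), p.IsPath ∧ p.toSubgraph ≤ T t :=
    fun t => exists_isPath_le (htree t).connected ((hA _ _).1 (hu t).2) ((hA _ _).1 (hw t).2)
  choose P hP hPT using hpath
  have hmem : ∀ t, ∀ x ∈ (P t).support, x ∈ (T t).verts := fun t x hx =>
    (hPT t).1 ((P t).mem_verts_toSubgraph.2 hx)
  have hint : ∀ t, ∀ x ∈ (P t).support, x ∈ L.verts → x = f (u t) ∨ x = f (w t) :=
    fun t x hx hxL => eq_or_eq_of_mem_leaves (hP t) (hPT t) hx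
      (by rw [hleaves]; exact ⟨hxL, hmem t x hx⟩)
  have hPdisj : ∀ t t', t ≠ t' → ∀ x ∈ (P t).support, x ∉ (P t').support :=
    fun t t' htt x hx hx' => Set.disjoint_left.1 (hdisj (Subtype.coe_injective.ne htt))
      (hmem t x hx) (hmem t' x hx')
  have hPL : ∀ t x y, (P t).toSubgraph.Adj x y → ¬L.Adj x y := fun t x y h =>
    (hT t).not_adj ((hPT t).2 h)
  have hbd : ∀ v, v ∈ boundary N ↔ ∃ t, v = u t ∨ v = w t := by
    intro v
    constructor
    · intro hv
      obtain ⟨i, hi⟩ := Set.mem_iUnion.1 (hsub hv)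
      have h2 : v ∈ boundary N ∩ A i := ⟨hv, hi⟩
      have h3 := hpair ⟨i, v, h2⟩
      rw [h3] at h2
      exact ⟨_, h2⟩
    · rintro ⟨t, rfl | rfl⟩
      · exact (hu t).1
      · exact (hw t).1
  have hcyc : ∀ M, boundary M = boundary N → Good A M → IsCycleSubgraph (hf.withPaths M P) := by
    intro M hM hMgood
    refine hf.isCycleSubgraph_withPaths huw hP hint hPdisj hPL (by rwa [hM]) (by rwa [hM]) ?_
    intro Y hYM hY hYt
    refine hMgood Y ⟨hYM, hY, fun i => ?_⟩
    rw [hM] at hY ⊢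
    rcases (boundary N ∩ A i).eq_empty_or_nonempty with h0 | h0
    · left
      exact Set.subset_empty_iff.1 ((Set.inter_subset_inter_left _ hY).trans h0.subset)
    · have h1 : ∀ v, v ∈ boundary Y ∩ A i ↔ (v = u ⟨i, h0⟩ ∨ v = w ⟨i, h0⟩) ∧ v ∈ boundary Y := by
        intro v
        have h2 : v ∈ boundary N ∩ A i ↔ v = u ⟨i, h0⟩ ∨ v = w ⟨i, h0⟩ := by
          rw [hpair ⟨i, h0⟩]; rfl
        rw [← h2]
        exact ⟨fun h => ⟨⟨hY h.1, h.2⟩, h.1⟩, fun h => ⟨h.2, h.1.2⟩⟩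
      by_cases h3 : u ⟨i, h0⟩ ∈ boundary Y
      · right
        ext v
        rw [h1, hpair ⟨i, h0⟩]
        refine ⟨fun h => h.1, fun h => ⟨h, ?_⟩⟩
        rcases h with rfl | rfl
        · exact h3
        · exact (hYt _).1 h3
      · left
        rw [Set.eq_empty_iff_forall_notMem]
        intro v hv
        rcases (h1 v).1 hv with ⟨rfl | rfl, h⟩
        · exact h3 h
        · exact h3 ((hYt _).2 h)
  have hsymm : symmDiffSubgraph L (hf.withPaths N P) = hf.withPaths Nᶜ P := by
    have hadj : ∀ x y, Xor (L.Adj x y) ((hf.withPaths N P).Adj x y) ↔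
        (hf.withPaths Nᶜ P).Adj x y := by
      intro x y
      change Xor (L.Adj x y) ((∃ e ∈ N, s(x, y) = s(f e, f (e + 1))) ∨
        ∃ t, (P t).toSubgraph.Adj x y) ↔ (∃ e ∈ Nᶜ, s(x, y) = s(f e, f (e + 1))) ∨
        ∃ t, (P t).toSubgraph.Adj x y
      by_cases hL : L.Adj x y
      · have h1 : ¬∃ t, (P t).toSubgraph.Adj x y := fun ⟨t, ht⟩ => hPL t x y ht hL
        obtain ⟨e, he⟩ := (hf.adj_iff _ _).1 hL
        simp only [h1, or_false, he, hf.edge_eq_iff, hL, Xor, true_and, not_true, and_false,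
          exists_eq_right', Set.mem_compl_iff]
      · have h1 : ∀ M : Set (ZMod n), ¬∃ e ∈ M, s(x, y) = s(f e, f (e + 1)) :=
          fun M ⟨e, _, he⟩ => hL ((hf.adj_iff _ _).2 ⟨e, he⟩)
        simp only [h1, false_or, hL, Xor, false_and, not_false_iff, and_true]
    ext x y
    · exact exists_congr fun y => hadj x y
    · exact hadj x y
  have hCle : ∀ x y, (hf.withPaths N P).Adj x y → (L ⊔ ⨆ i, T i).Adj x y := by
    rintro x y (⟨e, -, h⟩ | ⟨t, h⟩)
    · exact Or.inl ((hf.adj_iff _ _).2 ⟨e, h⟩)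
    · exact Or.inr (Subgraph.iSup_adj.2 ⟨t, (hPT t).2 h⟩)
  refine ⟨hf.withPaths N P, hcyc N rfl hgood, ?_, ⟨?_, fun x y => hCle x y⟩, fun e => ?_, ?_⟩
  · rw [hsymm]
    exact hcyc Nᶜ (boundary_compl _) hgood'
  · rintro x ⟨y, h⟩
    exact (hCle x y h).fst_mem
  · constructor
    · rintro (⟨e', he', h⟩ | ⟨t, h⟩)
      · rwa [(hf.edge_eq_iff _ _).1 h]
      · exact (hPL t _ _ h (hf.adj_add_one e)).elim
    · exact fun h => Or.inl ⟨e, h, rfl⟩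
  · intro i x y S hS hcard
    obtain ⟨v, hv⟩ := Set.ncard_eq_one.1 hcard
    have hv' : v ∈ boundary N ∩ {v | v ∈ A i ∧ f v ∈ S} := by rw [hv]; rfl
    let t : κ := ⟨i, v, hv'.1, hv'.2.1⟩
    -- exactly one end of the path inside `T i` belongs to `S`
    have hends : ∀ z ∈ boundary N ∩ A i, f z ∈ S → z = v := by
      intro z hz hzS
      have : z ∈ boundary N ∩ {v | v ∈ A i ∧ f v ∈ S} := ⟨hz.1, hz.2, hzS⟩
      rwa [hv] at this
    have huse : ∀ {a b : V} (p : G.Walk a b), p.toSubgraph ≤ T i → a ∈ S → b ∉ S →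
        p.toSubgraph.Adj x y := by
      intro a b p hp ha hb
      obtain ⟨d, hd, h1, h2⟩ := p.exists_boundary_dart S ha hb
      have h3 : p.toSubgraph.Adj d.fst d.snd := by
        rw [← Subgraph.mem_edgeSet, Walk.mem_edges_toSubgraph]
        exact List.mem_map_of_mem hd
      rw [← Subgraph.mem_edgeSet, ← hS _ _ (hp.2 h3) h1 h2, Subgraph.mem_edgeSet]
      exact h3
    refine Or.inr ⟨t, ?_⟩
    have hvt : v ∈ boundary N ∩ A t := ⟨hv'.1, hv'.2.1⟩
    rw [hpair t] at hvt
    rcases hvt with h | h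
    · refine huse (P t) (hPT t) (h ▸ hv'.2.2) fun hwS => huw t ?_
      rw [hends _ (hw t) hwS, h]
    · have := huse (P t).reverse (by rw [Walk.toSubgraph_reverse]; exact hPT t) (h ▸ hv'.2.2)
        fun huS => huw t ?_
      · rwa [Walk.toSubgraph_reverse] at this
      · rw [hends _ (hu t) huS, h]

end CycleBridges

theorem theorem4 {V : Type*} [Finite V] (G : SimpleGraph V)
    (hG : CycleBridges.TwoConnected G)
    (L : G.Subgraph) (hL : CycleBridges.IsCycleSubgraph L)
    (k : ℕ) (T : Fin k → CycleBridges.Bridge L)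
    (hdisj : Pairwise fun i j => Disjoint (T i).1.verts (T j).1.verts)
    (hoverlap : ((CycleBridges.overlapGraph L).induce (Set.range T)).IsTree)
    (htree : ∀ i, (T i).1.coe.IsTree)
    (hleaves : ∀ i, CycleBridges.leaves (T i).1 = CycleBridges.attachments L (T i).1) :
    ∃ (m : ℕ) (C : Fin m → G.Subgraph),
      (∀ j, CycleBridges.IsCycleSubgraph (C j) ∧ C j ≤ L ⊔ ⨆ i, (T i).1) ∧
      (∀ e ∈ L.edgeSet, {j | e ∈ (C j).edgeSet}.ncard = 2) ∧
      (∀ i, ∀ e ∈ (T i).1.edgeSet, 4 ≤ {j | e ∈ (C j).edgeSet}.ncard) ∧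
      (∀ j, CycleBridges.IsCycleSubgraph (CycleBridges.symmDiffSubgraph L (C j))) := by
  open CycleBridges in
  obtain ⟨n, _, f, hf⟩ := exists_cycleParam hL
  let A : Fin k → Set (ZMod n) := fun i => {v | f v ∈ (T i).1.verts}
  have hatt : ∀ i, attachments L (T i).1 = f '' A i := by
    intro i
    ext x
    constructor
    · rintro ⟨h1, h2⟩
      rw [hf.verts_eq] at h1
      obtain ⟨v, rfl⟩ := h1
      exact ⟨v, h2, rfl⟩
    · rintro ⟨v, hv, rfl⟩
      exact ⟨hf.apply_mem_verts v, hv⟩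
  have hAdisj : Pairwise fun i j => Disjoint (A i) (A j) := fun i j hij =>
    Set.disjoint_left.2 fun v hv hv' => Set.disjoint_left.1 (hdisj hij) hv hv'
  -- the two sides of an edge of a bridge split its attachments
  have hsep : ∀ i x y, (T i).1.Adj x y → ∃ S : Set V,
      (∀ v w, (T i).1.Adj v w → v ∈ S → w ∉ S → s(v, w) = s(x, y)) ∧
      (∃ v ∈ A i, f v ∈ S) ∧ ∃ v ∈ A i, f v ∉ S := by
    intro i x y h
    obtain ⟨S, hS, ⟨a, ha, haS⟩, b, hb, hbS⟩ := exists_separation (htree i).isAcyclic h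
    rw [hleaves, hatt] at ha hb
    obtain ⟨a, ha, rfl⟩ := ha
    obtain ⟨b, hb, rfl⟩ := hb
    exact ⟨S, hS, ⟨a, ha, haS⟩, b, hb, hbS⟩
  have hnt : ∀ i, (A i).Nontrivial := by
    intro i
    obtain ⟨x, y, hxy⟩ := (T i).2.exists_adj hG.2.1.preconnected ⟨f 0, hf.apply_mem_verts 0⟩
    obtain ⟨S, -, ⟨a, ha, haS⟩, b, hb, hbS⟩ := hsep i x y hxy
    exact ⟨a, ha, b, hb, fun h => hbS (h ▸ haS)⟩
  have hinj : Function.Injective T := by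
    intro i j hij
    by_contra hne
    obtain ⟨v, hv⟩ := (hnt i).nonempty
    have : f v ∈ (T i).1.verts := hv
    exact Set.disjoint_left.1 (hdisj hne) this (hij ▸ this)
  have hcross : (crossGraph A).IsTree := by
    refine (SimpleGraph.Iso.isTree_iff (G' := (overlapGraph L).induce (Set.range T))
      ⟨Equiv.ofInjective T hinj, ?_⟩).2 hoverlap
    intro i j
    change T i ≠ T j ∧ Overlap L (T i).1 (T j).1 ↔ i ≠ j ∧ Cross (A i) (A j)
    rw [hinj.ne_iff]
    exact and_congr_right fun hij =>
      ⟨hf.cross_of_overlap (hatt i) (hatt j) (hAdisj hij) (hnt i) (hnt j).nonempty,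
        hf.overlap_of_cross (hatt i) (hatt j)⟩
  obtain ⟨γ, _, X, hX⟩ := exists_doubleFamily _ (Fin k) A rfl hAdisj
    (fun i => Set.one_lt_ncard_iff_nontrivial.2 (hnt i)) hcross
  have hC := fun c => hf.exists_isCycleSubgraph_pair (T := fun i => (T i).1) (fun i => (T i).2)
    hdisj htree hleaves (A := A) (fun i v => Iff.rfl) (hX.sub c) (hX.ne c) (hX.two c) (hX.good c)
    (hX.good_compl c)
  choose C hC1 hC2 hC3 hC4 hC5 using hC
  obtain ⟨m, ⟨φ⟩⟩ := Finite.exists_equiv_fin γ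
  have hcard : ∀ e, {j | e ∈ (C (φ.symm j)).edgeSet}.ncard = {c | e ∈ (C c).edgeSet}.ncard := by
    intro e
    exact Set.ncard_preimage_of_injective_subset_range (f := φ.symm)
      (s := {c | e ∈ (C c).edgeSet}) φ.symm.injective (by simp)
  refine ⟨m, fun j => C (φ.symm j), fun j => ⟨hC1 _, hC3 _⟩, fun e he => ?_, fun i e he => ?_,
    fun j => hC2 _⟩
  · rw [hcard]
    induction e with
    | _ x y =>
      obtain ⟨v, hv⟩ := (hf.adj_iff x y).1 he
      rw [← hX.cover v]
      congr 1
      ext c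
      rw [hv]
      exact hC4 c v
  · rw [hcard]
    induction e with
    | _ x y =>
      obtain ⟨S, hS, ⟨a, ha, haS⟩, b, hb, hbS⟩ := hsep i x y he
      refine (hX.cut i {v | v ∈ A i ∧ f v ∈ S} (fun v hv => hv.1) ⟨a, ha, haS⟩ ?_).trans
        (Set.ncard_le_ncard fun c hc => hC5 c i x y S hS hc)
      exact fun h => hbS (h.symm.subset hb).2
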